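/- Let $l\ge -\tfrac12$, let $q\in L^1_{\mathrm{loc}}(0,\infty)$ be real-valued, let $\tau=-\frac{d^2}{dx^2}+\frac{l(l+1)}{x^2}+q(x)$ on $(0,\infty)$, and let $p\in[1,\infty]$. Assume one of the following: (a) $l>-\tfrac12$ and $xq(x)\in L^p(0,1)$; (b) $l=-\tfrac12$ and either $p\in(1,\infty]$ and $xq(x)\in L^p(0,1)$, or $p=1$ and $(1-\log x)\,xq(x)\in L^1(0,1)$. Then for every $z\in\mathbb C$ there are two linearly independent solutions $\phi(z,\cdot)$, $\theta(z,\cdot)$ of $\tau u=zu$ on $(0,\infty)$ (that is, $u$ and $u'$ are locally absolutely continuous and the equation holds almost everywhere), which can be chosen such that $\phi(\cdot,x)$ and $\theta(\cdot,x)$ are entire for every $x>0$ and the following holds. There are functions $\widetilde\phi,\widetilde\theta$ with $\widetilde\phi(z,0)=\widetilde\theta(z,0)=1$ for all $z\in\mathbb C$ and $$\phi(z,x)=x^{l+1}\widetilde\phi(z,x)\ (x>0),\qquad \theta(z,x)=\begin{cases}\dfrac{x^{-l}}{2l+1}\,\widetilde\theta(z,x)\ (x>0), & l>-\tfrac12,\\[1ex]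 -\log(x)\,x^{1/2}\,\widetilde\theta(z,x)\ (0<x<1), & l=-\tfrac12.\end{cases}$$ Write $W^{1,r}(0,1)$ for the space of absolutely continuous functions on $[0,1]$ whose derivative lies in $L^r(0,1)$, and $W_x(f,g)=f(x)g'(x)-f'(x)g(x)$. 1. $\widetilde\phi(z,\cdot)\in W^{1,p}(0,1)$ for all $z\in\mathbb C$, and $\widetilde\phi\in C(\mathbb C\times[0,1])$. 2. If $l>0$, then $\widetilde\theta(z,\cdot)\in W^{1,p}(0,1)$ for all $z\in\mathbb C$. If $-\tfrac12<l\le 0$, then $\widetilde\theta(z,\cdot)\in W^{1,r}(0,1)$ for all $z\in\mathbb C$ and all $r\in[1,p]$ with $r<\frac{-1}{2l}$ (read as $r<\infty$ if $l=0$). In both cases $\widetilde\theta\in C(\mathbb C\times[0,1])$. 3. If $l>-\tfrac12$, then for all $z,\zeta\in\mathbb C$, as $x\to0$, $x\,\widetilde\phi'(z,x)\to0$, $x\,\widetilde\theta'(z,x)\to0$ and $W_x(\theta(z),\phi(\zeta))\to1$, where primes denote derivatives in $x$. 4. If $l=-\tfrac12$, then $\widetilde\theta\in C(\mathbb C\times[0,1))$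 and $\theta\in C(\mathbb C\times(0,1])$. -/

import Mathlib

open Set Filter Topology MeasureTheory
open scoped ENNReal

/-- `u` is a solution on `(0, ∞)` of `τ u = z u`, where
`τ = -d²/dx² + l (l + 1) / x² + q`: the function `u` is differentiable on `(0, ∞)`, its derivative
is locally absolutely continuous there, and the equation holds almost everywhere. -/
def IsBesselSolution (l : ℝ) (q : ℝ → ℝ) (z : ℂ) (u : ℝ → ℂ) : Prop :=
  (∀ x : ℝ, 0 < x → DifferentiableAt ℝ u x) ∧
  (∀ a b : ℝ, 0 < a → a ≤ b → AbsolutelyContinuousOnInterval (deriv u) a b) ∧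
  ∀ᵐ x : ℝ ∂(volume.restrict (Ioi (0 : ℝ))),
    -deriv (deriv u) x + ((l * (l + 1) / x ^ 2 + q x : ℝ) : ℂ) * u x = z * u x

/-- The Sobolev space `W^{1,p}(0,1)`: absolutely continuous functions on `[0,1]` whose (almost
everywhere existing) derivative lies in `L^p(0,1)`. -/
def MemSobolevOne (p : ℝ≥0∞) (f : ℝ → ℂ) : Prop :=
  AbsolutelyContinuousOnInterval f 0 1 ∧ MemLp (deriv f) p (volume.restrict (Ioo (0 : ℝ) 1))

/-- The Wronskian `W_x(f, g) = f(x) g'(x) - f'(x) g(x)`. -/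
noncomputable def besselWronskian (f g : ℝ → ℂ) (x : ℝ) : ℂ :=
  f x * deriv g x - deriv f x * g x

/-! ### Locally absolutely continuous functions on the half-line -/

/-! Put κ = 2l + 2. The substitution φ = x^(l+1) U turns τφ = zφ into (x^κ U')' = x^κ (q - z) U, and
the normalization at 0 turns this into the Volterra equation U = 1 + ∫₀ˣ s^(-κ) ∫₀ˢ y^κ (q - z) U dy
ds. Its total weight is finite by Hardy's inequality for h ↦ x^(-κ) ∫₀ˣ y^(κ-1) |h|, applied to h =
xq. This operator is bounded on L^p(0,1) if κ > 1 or p > 1 (`memLp_hardy_left`); the endpoint κ = p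
= 1 costs a logarithm (`memLp_hardy_log`), which is why l = -1/2, p = 1 has its own hypothesis. The
same function dominates U', so U lies in W^{1,p}. Iterates of the Volterra operator decay like
Wⁿ/n!, so 1 - T is invertible on every [0, X]; as T is affine in z, the solution is entire in z
(`VolterraAdmissible.exists_solution`).

The second solution cannot be taken as φ ∫ₓ¹ φ⁻² for every z: φ(z,·) may vanish, and entire
dependence would be lost. At z = i, however, φ has no zeros, since a zero would make i an eigenvalue
of a symmetric boundary value problem (`VolterraAdmissible.ne_zero_of_eq`). So θ is built from a
finite Taylor expansion at i: θ₀ comes from reduction of order, and (τ - i) θₖ₊₁ = θₖ is solved by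
the same device, each step improving the behaviour at 0 (`besselChain_spec`). After N = ⌊2l+1⌋ steps
the defect is small enough for a Volterra equation to absorb it, and θ(z) = ∑_{k≤N} (z-i)^k θₖ +
(z-i)^(N+1) R(z) with R entire in z (`exists_singular_solution`). At the origin θ₀ dominates, and
its asymptotics are those of ∫ₓ¹ s^(-κ) ds.

For the regularity of θ with l > -1/2, put ψ = (2l+1) x^l θ. Then (x^(-2l) ψ')' = x^(-2l) (q - z) ψ,
so integrating from 1 down to x bounds ψ' by x^(2l) plus the dual Hardy operator
(`memLp_hardy_right`). Both terms lie in L^r for r < -1/(2l) if l ≤ 0, and no restriction arises for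
l > 0. The limits xU' → 0 and xψ' → 0 need only xq ∈ L¹, and they give the Wronskian. -/

theorem AbsolutelyContinuousOnInterval.congr_on {f g : ℝ → ℂ} {a b : ℝ}
    (hf : AbsolutelyContinuousOnInterval f a b) (h : EqOn f g (uIcc a b)) :
    AbsolutelyContinuousOnInterval g a b := by
  rw [absolutelyContinuousOnInterval_iff] at hf ⊢
  intro ε hε
  obtain ⟨δ, hδ, H⟩ := hf ε hε
  refine ⟨δ, hδ, fun E hE hl => ?_⟩
  have := H E hE hl
  convert this using 1
  refine Finset.sum_congr rfl fun i hi => ?_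
  rw [h (hE.1 i hi).1, h (hE.1 i hi).2]

/-- Absolute continuity of real indefinite integrals is applied to the real and imaginary parts
separately. -/
theorem IntervalIntegrable.absolutelyContinuousOnInterval_primitive {f : ℝ → ℂ} {a b c : ℝ}
    (h : IntervalIntegrable f volume a b) (hc : c ∈ uIcc a b) :
    AbsolutelyContinuousOnInterval (fun x => ∫ v in c..x, f v) a b := by
  have hre : IntervalIntegrable (fun x => (f x).re) volume a b := ⟨h.1.re, h.2.re⟩
  have him : IntervalIntegrable (fun x => (f x).im) volume a b := ⟨h.1.im, h.2.im⟩
  have aux : ∀ F : ℝ → ℝ, AbsolutelyContinuousOnInterval F a b →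
      AbsolutelyContinuousOnInterval (fun x => ((F x : ℝ) : ℂ)) a b := by
    intro F hF
    rw [absolutelyContinuousOnInterval_iff] at hF ⊢
    simpa only [Complex.dist_eq, Real.dist_eq, ← Complex.ofReal_sub, Complex.norm_real,
      Real.norm_eq_abs] using hF
  have h1 := aux _ (hre.absolutelyContinuousOnInterval_intervalIntegral hc)
  have h2 := (aux _ (him.absolutelyContinuousOnInterval_intervalIntegral hc)).const_smul Complex.I
  refine (h1.add h2).congr_on fun x hx => ?_
  have hcx : IntervalIntegrable f volume c x := h.mono_set (uIcc_subset_uIcc hc hx)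
  have hre' : IntervalIntegrable (fun x => (f x).re) volume c x := ⟨hcx.1.re, hcx.2.re⟩
  have him' : IntervalIntegrable (fun x => (f x).im) volume c x := ⟨hcx.1.im, hcx.2.im⟩
  simp only [Pi.add_apply, smul_eq_mul]
  rw [← intervalIntegral.integral_ofReal, ← intervalIntegral.integral_ofReal,
    ← intervalIntegral.integral_const_mul, ← intervalIntegral.integral_add]
  · congr 1
    ext t
    rw [mul_comm]
    exact Complex.re_add_im (f t)
  · exact ⟨hre'.1.ofReal, hre'.2.ofReal⟩
  · exact IntervalIntegrable.const_mul (f := fun x => (((f x).im : ℝ) : ℂ))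
      ⟨him'.1.ofReal, him'.2.ofReal⟩ _

/-- The fundamental theorem of calculus for absolutely continuous functions. -/
theorem AbsolutelyContinuousOnInterval.integral_eq_sub_of_ae_hasDerivAt {f r : ℝ → ℂ} {a b : ℝ}
    (hf : AbsolutelyContinuousOnInterval f a b) (hr : IntervalIntegrable r volume a b)
    (h : ∀ᵐ x, x ∈ uIcc a b → HasDerivAt f (r x) x) :
    ∫ x in a..b, r x = f b - f a := by
  -- `f` minus the primitive of `r` is absolutely continuous with derivative zero almost everywhere,
  -- hence constant.
  have hp := hr.absolutelyContinuousOnInterval_primitive (c := a) (by simp)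
  have h0 : ∀ᵐ x, x ∈ uIcc a b → HasDerivAt (f - fun x => ∫ v in a..x, r v) 0 x := by
    filter_upwards [h, hr.ae_hasDerivAt_integral] with x h1 h2 hx
    simpa using (h1 hx).sub (h2 hx a (by simp))
  obtain ⟨C, hC⟩ := (hf.sub hp).const_of_ae_hasDerivAt_zero h0
  have ha := hC a (by simp)
  have hb := hC b (by simp)
  simp only [Pi.sub_apply, intervalIntegral.integral_same, sub_zero] at ha hb
  rw [ha, ← hb]
  ring

theorem absolutelyContinuousOnInterval_of_hasDerivAt {f f' : ℝ → ℂ} {a b : ℝ} (hab : a ≤ b)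
    (hf : ∀ x ∈ Icc a b, HasDerivAt f (f' x) x) (hf' : ContinuousOn f' (Icc a b)) :
    AbsolutelyContinuousOnInterval f a b := by
  have hint : IntervalIntegrable f' volume a b := by
    apply ContinuousOn.intervalIntegrable
    rwa [uIcc_of_le hab]
  have hp := hint.absolutelyContinuousOnInterval_primitive (c := a) (by simp)
  have hc : AbsolutelyContinuousOnInterval (fun _ : ℝ => f a) a b :=
    (LipschitzWith.const (f a)).lipschitzOnWith.absolutelyContinuousOnInterval
  refine (hp.add hc).congr_on fun x hx => ?_
  rw [uIcc_of_le hab] at hx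
  have : ∫ v in a..x, f' v = f x - f a := by
    apply intervalIntegral.integral_eq_sub_of_hasDerivAt
    · intro y hy
      rw [uIcc_of_le hx.1] at hy
      exact hf y ⟨hy.1, hy.2.trans hx.2⟩
    · exact hint.mono_set (uIcc_subset_uIcc (by simp) (by rw [uIcc_of_le hab]; exact hx))
  simp [this]

/-- `w` is locally absolutely continuous on `(0, ∞)` with almost everywhere derivative `r`. -/
def HasLocACDeriv (w r : ℝ → ℂ) : Prop :=
  (∀ a b : ℝ, 0 < a → a ≤ b → AbsolutelyContinuousOnInterval w a b) ∧
  ∀ᵐ x : ℝ, 0 < x → HasDerivAt w (r x) x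

namespace HasLocACDeriv

variable {w r w₁ r₁ w₂ r₂ : ℝ → ℂ}

theorem add (h₁ : HasLocACDeriv w₁ r₁) (h₂ : HasLocACDeriv w₂ r₂) :
    HasLocACDeriv (fun x => w₁ x + w₂ x) (fun x => r₁ x + r₂ x) := by
  refine ⟨fun a b ha hab => (h₁.1 a b ha hab).add (h₂.1 a b ha hab), ?_⟩
  filter_upwards [h₁.2, h₂.2] with x hx₁ hx₂ hx
  exact (hx₁ hx).add (hx₂ hx)

theorem mul (h₁ : HasLocACDeriv w₁ r₁) (h₂ : HasLocACDeriv w₂ r₂) :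
    HasLocACDeriv (fun x => w₁ x * w₂ x) (fun x => r₁ x * w₂ x + w₁ x * r₂ x) := by
  refine ⟨fun a b ha hab => (h₁.1 a b ha hab).smul (h₂.1 a b ha hab), ?_⟩
  filter_upwards [h₁.2, h₂.2] with x hx₁ hx₂ hx
  exact (hx₁ hx).mul (hx₂ hx)

theorem of_hasDerivAt (h : ∀ x, 0 < x → HasDerivAt w (r x) x) (hr : ContinuousOn r (Ioi 0)) :
    HasLocACDeriv w r := by
  refine ⟨fun a b ha hab => ?_, Eventually.of_forall h⟩
  exact absolutelyContinuousOnInterval_of_hasDerivAt hab (fun x hx => h x (ha.trans_le hx.1))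
    (hr.mono fun x hx => ha.trans_le hx.1)

theorem const_mul (c : ℂ) (h : HasLocACDeriv w r) :
    HasLocACDeriv (fun x => c * w x) (fun x => c * r x) := by
  refine ⟨fun a b ha hab => (h.1 a b ha hab).const_smul c, ?_⟩
  filter_upwards [h.2] with x hx h0
  exact (hx h0).const_mul c

theorem congr (h : HasLocACDeriv w₁ r₁) (hw : EqOn w₁ w₂ (Ioi 0)) (hr : EqOn r₁ r₂ (Ioi 0)) :
    HasLocACDeriv w₂ r₂ := by
  refine ⟨fun a b ha hab => (h.1 a b ha hab).congr_on fun x hx => hw ?_, ?_⟩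
  · rw [uIcc_of_le hab] at hx
    exact ha.trans_le hx.1
  · filter_upwards [h.2] with x hx h0
    rw [← hr h0]
    refine (hx h0).congr_of_eventuallyEq ?_
    filter_upwards [Ioi_mem_nhds h0] with y hy using (hw hy).symm

theorem primitive {F : ℝ → ℂ} (hF : ∀ X : ℝ, 0 < X → IntervalIntegrable F volume 0 X) :
    HasLocACDeriv (fun x => ∫ y in (0 : ℝ)..x, F y) F := by
  refine ⟨fun a b ha hab => ?_, ?_⟩
  · refine ((hF b (ha.trans_le hab)).absolutelyContinuousOnInterval_primitive
      (c := 0) (by simp)).mono (uIcc_subset_uIcc ?_ (by simp))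
    rw [uIcc_of_le (ha.le.trans hab)]
    exact ⟨ha.le, hab⟩
  -- Lebesgue differentiation holds on each bounded interval; countably many null sets are discarded
  -- to cover the half-line.
  · have : ∀ n : ℕ, ∀ᵐ x : ℝ, x ∈ uIcc (0 : ℝ) ((n : ℝ) + 1) →
        HasDerivAt (fun x => ∫ y in (0 : ℝ)..x, F y) (F x) x := by
      intro n
      filter_upwards [(hF ((n : ℝ) + 1) (by positivity)).ae_hasDerivAt_integral] with x hx h
      exact hx h 0 (by simp)
    filter_upwards [ae_all_iff.2 this] with x hx h0
    obtain ⟨n, hn⟩ := exists_nat_gt x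
    refine hx n ?_
    rw [uIcc_of_le (by positivity)]
    exact ⟨h0.le, by linarith⟩

theorem integral_eq_sub (h : HasLocACDeriv w r) {a b : ℝ} (ha : 0 < a) (hab : a ≤ b)
    (hr : IntervalIntegrable r volume a b) : ∫ x in a..b, r x = w b - w a := by
  refine (h.1 a b ha hab).integral_eq_sub_of_ae_hasDerivAt hr ?_
  filter_upwards [h.2] with x hx hm
  rw [uIcc_of_le hab] at hm
  exact hx (ha.trans_le hm.1)

theorem continuousOn (h : HasLocACDeriv w r) : ContinuousOn w (Ioi 0) := by
  intro x hx
  have hx' : (0 : ℝ) < x := hx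
  have := (h.1 (x / 2) (2 * x) (by positivity) (by linarith)).continuousOn
  rw [uIcc_of_le (by linarith)] at this
  exact (this.continuousAt (Icc_mem_nhds (by linarith) (by linarith))).continuousWithinAt

end HasLocACDeriv

/-! ### Inhomogeneous equations -/

/-- `u` solves `τ u = z u + f` on `(0, ∞)` and has derivative `w`. -/
def SolvesBessel (l : ℝ) (q : ℝ → ℝ) (z : ℂ) (f u w : ℝ → ℂ) : Prop :=
  (∀ x : ℝ, 0 < x → HasDerivAt u (w x) x) ∧
  HasLocACDeriv w fun x => (((l * (l + 1) / x ^ 2 + q x : ℝ) : ℂ) - z) * u x - f x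

namespace SolvesBessel

variable {l : ℝ} {q : ℝ → ℝ} {z : ℂ} {f u w f₁ u₁ w₁ f₂ u₂ w₂ : ℝ → ℂ}

theorem isBesselSolution (h : SolvesBessel l q z f u w) (hf : ∀ x, 0 < x → f x = 0) :
    IsBesselSolution l q z u := by
  have hd : ∀ x, 0 < x → deriv u x = w x := fun x hx => (h.1 x hx).deriv
  have hw : HasLocACDeriv (deriv u)
      fun x => (((l * (l + 1) / x ^ 2 + q x : ℝ) : ℂ) - z) * u x - f x :=
    h.2.congr (fun x hx => (hd x hx).symm) fun _ _ => rfl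
  refine ⟨fun x hx => (h.1 x hx).differentiableAt, hw.1, ?_⟩
  rw [ae_restrict_iff' measurableSet_Ioi]
  filter_upwards [hw.2] with x hx h0
  rw [(hx h0).deriv, hf x h0]
  ring

theorem add (h₁ : SolvesBessel l q z f₁ u₁ w₁) (h₂ : SolvesBessel l q z f₂ u₂ w₂) :
    SolvesBessel l q z (fun x => f₁ x + f₂ x) (fun x => u₁ x + u₂ x) (fun x => w₁ x + w₂ x) :=
  ⟨fun x hx => (h₁.1 x hx).add (h₂.1 x hx),
    (h₁.2.add h₂.2).congr (fun _ _ => rfl) fun x _ => by ring⟩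

theorem const_mul (c : ℂ) (h : SolvesBessel l q z f u w) :
    SolvesBessel l q z (fun x => c * f x) (fun x => c * u x) (fun x => c * w x) :=
  ⟨fun x hx => (h.1 x hx).const_mul c, (h.2.const_mul c).congr (fun _ _ => rfl) fun x _ => by ring⟩

theorem congr_right (h : SolvesBessel l q z f₁ u w) (hf : ∀ x, 0 < x → f₁ x = f₂ x) :
    SolvesBessel l q z f₂ u w :=
  ⟨h.1, h.2.congr (fun _ _ => rfl) fun x hx => by simp only [hf x hx]⟩

/-- A change of spectral parameter is paid for by the inhomogeneity. This is what allows solutions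
at one fixed parameter to generate a solution at every parameter. -/
theorem change_parameter (z' : ℂ) (h : SolvesBessel l q z f u w) :
    SolvesBessel l q z' (fun x => f x + (z - z') * u x) u w :=
  ⟨h.1, h.2.congr (fun _ _ => rfl) fun x _ => by ring⟩

theorem continuousOn (h : SolvesBessel l q z f u w) : ContinuousOn u (Ioi 0) := fun x hx =>
  (h.1 x hx).continuousAt.continuousWithinAt

end SolvesBessel

/-! ### Hardy inequalities via the Schur test -/

/-- The Schur test in `L^p` with the same test function on both sides. -/
theorem lintegral_schur {μ : Measure ℝ} [SFinite μ] {p : ℝ} (hp : 1 ≤ p)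
    {K : ℝ → ℝ → ℝ≥0∞} (hK : Measurable (Function.uncurry K))
    {f g : ℝ → ℝ≥0∞} (hf : Measurable f) (hg : Measurable g)
    (hg0 : ∀ᵐ y ∂μ, g y ≠ 0) (hgt : ∀ᵐ y ∂μ, g y ≠ ∞) {A B : ℝ≥0∞}
    (h₁ : ∀ᵐ x ∂μ, ∫⁻ y, K x y * g y ∂μ ≤ A * g x)
    (h₂ : ∀ᵐ y ∂μ, ∫⁻ x, K x y * g x ^ (p - 1) ∂μ ≤ B * g y ^ (p - 1)) :
    ∫⁻ x, (∫⁻ y, K x y * f y ∂μ) ^ p ∂μ ≤ A ^ (p - 1) * B * ∫⁻ y, f y ^ p ∂μ := by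
  have hp0 : 0 < p := by linarith
  have hKx : ∀ x, Measurable (K x) := fun x => hK.of_uncurry_left
  have hKy : ∀ y, Measurable (fun x => K x y) := fun y => hK.of_uncurry_right
  have hR : Measurable (fun y => g y * (f y / g y) ^ p) := by fun_prop
  have key : ∀ᵐ x ∂μ, (∫⁻ y, K x y * f y ∂μ) ^ p ≤
      A ^ (p - 1) * ∫⁻ y, K x y * g x ^ (p - 1) * (g y * (f y / g y) ^ p) ∂μ := by
    filter_upwards [h₁] with x hx
    -- The integrand is split so that Hölder's inequality with exponent `p` leaves K g in the second
    -- factor, which `h₁` controls. At p = 1 the second exponent is 0 and the splitting remains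
    -- valid.
    have e1 : ∫⁻ y, K x y * f y ∂μ =
        ∫⁻ y, (K x y * (g y * (f y / g y) ^ p)) ^ (1 / p) * (K x y * g y) ^ (1 - 1 / p) ∂μ := by
      refine lintegral_congr_ae ?_
      filter_upwards [hg0, hgt] with y h0 ht
      have hq : 0 ≤ 1 - 1 / p := by
        rw [sub_nonneg, div_le_one hp0]; exact hp
      have hq' : 0 ≤ 1 / p := by positivity
      rw [ENNReal.mul_rpow_of_nonneg _ _ hq', ENNReal.mul_rpow_of_nonneg _ _ hq',
        ENNReal.mul_rpow_of_nonneg _ _ hq, ← ENNReal.rpow_mul, mul_one_div_cancel hp0.ne',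
        ENNReal.rpow_one]
      have a1 : ∀ c : ℝ≥0∞, c ^ (1 / p) * c ^ (1 - 1 / p) = c := by
        intro c
        rw [← ENNReal.rpow_add_of_nonneg _ _ hq' hq]
        simp
      calc K x y * f y = K x y * (g y * (f y / g y)) := by
            rw [ENNReal.mul_div_cancel h0 ht]
        _ = (K x y ^ (1 / p) * K x y ^ (1 - 1 / p)) *
              ((g y ^ (1 / p) * g y ^ (1 - 1 / p)) * (f y / g y)) := by rw [a1, a1]
        _ = _ := by ring
    have e2 : (∫⁻ y, K x y * f y ∂μ) ≤
        (∫⁻ y, K x y * (g y * (f y / g y) ^ p) ∂μ) ^ (1 / p) *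
          (∫⁻ y, K x y * g y ∂μ) ^ (1 - 1 / p) := by
      rw [e1]
      refine ENNReal.lintegral_mul_norm_pow_le (((hKx x).mul hR).aemeasurable)
        (((hKx x).mul hg).aemeasurable) (by positivity) ?_ (by ring)
      rw [sub_nonneg, div_le_one hp0]; exact hp
    calc (∫⁻ y, K x y * f y ∂μ) ^ p ≤ ((∫⁻ y, K x y * (g y * (f y / g y) ^ p) ∂μ) ^ (1 / p) *
          (∫⁻ y, K x y * g y ∂μ) ^ (1 - 1 / p)) ^ p := ENNReal.rpow_le_rpow e2 hp0.le
      _ = (∫⁻ y, K x y * (g y * (f y / g y) ^ p) ∂μ) *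
          (∫⁻ y, K x y * g y ∂μ) ^ (p - 1) := by
        rw [ENNReal.mul_rpow_of_nonneg _ _ hp0.le, ← ENNReal.rpow_mul, ← ENNReal.rpow_mul,
          one_div_mul_cancel hp0.ne', ENNReal.rpow_one, sub_mul, one_div_mul_cancel hp0.ne',
          one_mul]
      _ ≤ (∫⁻ y, K x y * (g y * (f y / g y) ^ p) ∂μ) * (A * g x) ^ (p - 1) := by
        gcongr
      _ = A ^ (p - 1) * ((∫⁻ y, K x y * (g y * (f y / g y) ^ p) ∂μ) * g x ^ (p - 1)) := by
        rw [ENNReal.mul_rpow_of_nonneg _ _ (by linarith)]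
        ring
      _ = _ := by
        congr 1
        rw [← lintegral_mul_const _
          (by fun_prop : Measurable fun y => K x y * (g y * (f y / g y) ^ p))]
        refine lintegral_congr fun y => ?_
        ring
  have hm : Measurable (Function.uncurry fun x y =>
      K x y * g x ^ (p - 1) * (g y * (f y / g y) ^ p)) := by
    refine (hK.mul ((hg.comp measurable_fst).pow_const _)).mul (hR.comp measurable_snd)
  calc ∫⁻ x, (∫⁻ y, K x y * f y ∂μ) ^ p ∂μ
      ≤ ∫⁻ x, A ^ (p - 1) * ∫⁻ y, K x y * g x ^ (p - 1) * (g y * (f y / g y) ^ p) ∂μ ∂μ :=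
        lintegral_mono_ae key
    _ = A ^ (p - 1) * ∫⁻ x, ∫⁻ y, K x y * g x ^ (p - 1) * (g y * (f y / g y) ^ p) ∂μ ∂μ :=
        lintegral_const_mul _ hm.lintegral_prod_right
    -- Tonelli brings the x-integral inside, where `h₂` applies; the powers of g then recombine to
    -- f^p.
    _ = A ^ (p - 1) * ∫⁻ y, ∫⁻ x, K x y * g x ^ (p - 1) * (g y * (f y / g y) ^ p) ∂μ ∂μ := by
        rw [lintegral_lintegral_swap hm.aemeasurable]
    _ ≤ A ^ (p - 1) * ∫⁻ y, B * f y ^ p ∂μ := by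
        refine mul_le_mul_right (lintegral_mono_ae ?_) _
        filter_upwards [h₂, hg0, hgt] with y hy h0 ht
        rw [lintegral_mul_const _ (by fun_prop : Measurable fun x => K x y * g x ^ (p - 1))]
        calc (∫⁻ x, K x y * g x ^ (p - 1) ∂μ) * (g y * (f y / g y) ^ p)
            ≤ (B * g y ^ (p - 1)) * (g y * (f y / g y) ^ p) := by gcongr
          _ = B * ((g y ^ (p - 1) * g y ^ (1 : ℝ)) * (f y / g y) ^ p) := by
            rw [ENNReal.rpow_one]; ring
          _ = B * (g y * (f y / g y)) ^ p := by
            rw [← ENNReal.rpow_add_of_nonneg _ _ (by linarith) zero_le_one, sub_add_cancel,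
              ← ENNReal.mul_rpow_of_nonneg _ _ hp0.le]
          _ = B * f y ^ p := by rw [ENNReal.mul_div_cancel h0 ht]
    _ = _ := by
        rw [lintegral_const_mul _ (hf.pow_const _), mul_assoc]

theorem lintegral_Ioo_zero_rpow {a x : ℝ} (ha : 0 < a) (hx : 0 < x) :
    ∫⁻ y in Ioo 0 x, ENNReal.ofReal (y ^ (a - 1)) = ENNReal.ofReal (x ^ a / a) := by
  have hi : IntervalIntegrable (fun y : ℝ => y ^ (a - 1)) volume 0 x :=
    intervalIntegral.intervalIntegrable_rpow' (by linarith)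
  rw [← ofReal_integral_eq_lintegral_ofReal]
  · rw [← integral_Ioc_eq_integral_Ioo, ← intervalIntegral.integral_of_le hx.le,
      integral_rpow (Or.inl (by linarith))]
    simp [Real.zero_rpow ha.ne']
  · exact (intervalIntegrable_iff_integrableOn_Ioo_of_le hx.le).1 hi
  · filter_upwards [ae_restrict_mem measurableSet_Ioo] with y hy using Real.rpow_nonneg hy.1.le _

theorem lintegral_Ioi_rpow {a x : ℝ} (ha : 0 < a) (hx : 0 < x) :
    ∫⁻ y in Ioi x, ENNReal.ofReal (y ^ (-a - 1)) = ENNReal.ofReal (x ^ (-a) / a) := by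
  rw [← ofReal_integral_eq_lintegral_ofReal]
  · rw [integral_Ioi_rpow_of_lt (by linarith) hx]
    congr 1
    rw [sub_add_cancel, neg_div_neg_eq]
  · exact integrableOn_Ioi_rpow_of_lt (by linarith) hx
  · filter_upwards [ae_restrict_mem measurableSet_Ioi] with y hy
    exact Real.rpow_nonneg (hx.trans hy).le _

/-- The kernel `x ^ (-κ) y ^ (κ - 1)` of the Hardy operator, restricted to `y < x`. -/
noncomputable def hardyKernel (κ x y : ℝ) : ℝ≥0∞ :=
  if y < x then ENNReal.ofReal (x ^ (-κ) * y ^ (κ - 1)) else 0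

theorem measurable_hardyKernel (κ : ℝ) : Measurable (Function.uncurry (hardyKernel κ)) := by
  unfold hardyKernel Function.uncurry
  refine Measurable.ite (measurableSet_lt measurable_snd measurable_fst) ?_ measurable_const
  fun_prop

theorem lintegral_hardyKernel_left {κ x : ℝ} (hx : x ∈ Ioo (0 : ℝ) 1) (f : ℝ → ℝ≥0∞) :
    ∫⁻ y in Ioo 0 1, hardyKernel κ x y * f y =
      ∫⁻ y in Ioo 0 x, ENNReal.ofReal (x ^ (-κ) * y ^ (κ - 1)) * f y := by
  have : ∀ y, hardyKernel κ x y * f y = (Iio x).indicator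
      (fun y => ENNReal.ofReal (x ^ (-κ) * y ^ (κ - 1)) * f y) y := by
    intro y
    by_cases h : y < x <;> simp [hardyKernel, h]
  simp_rw [this]
  rw [lintegral_indicator measurableSet_Iio, Measure.restrict_restrict measurableSet_Iio]
  congr 2
  ext y
  simp only [mem_inter_iff, mem_Iio, mem_Ioo]
  exact ⟨fun h => ⟨h.2.1, h.1⟩, fun h => ⟨h.2, h.1, h.2.trans hx.2⟩⟩

theorem lintegral_hardyKernel_right {κ y : ℝ} (hy : y ∈ Ioo (0 : ℝ) 1) (f : ℝ → ℝ≥0∞) :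
    ∫⁻ x in Ioo 0 1, hardyKernel κ x y * f x =
      ∫⁻ x in Ioo y 1, ENNReal.ofReal (x ^ (-κ) * y ^ (κ - 1)) * f x := by
  have : ∀ x, hardyKernel κ x y * f x = (Ioi y).indicator
      (fun x => ENNReal.ofReal (x ^ (-κ) * y ^ (κ - 1)) * f x) x := by
    intro x
    by_cases h : y < x <;> simp [hardyKernel, h]
  simp_rw [this]
  rw [lintegral_indicator measurableSet_Ioi, Measure.restrict_restrict measurableSet_Ioi]
  congr 2
  ext x
  simp only [mem_inter_iff, mem_Ioi, mem_Ioo]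
  exact ⟨fun h => ⟨h.1, h.2.2⟩, fun h => ⟨h.1, hy.1.trans h.1, h.2⟩⟩

/-- The kernel is homogeneous of degree -1, so powers are eigenfunctions of the Hardy operator and
natural test functions for Schur's test. In the transposed version below, the truncation at 1 turns
equality into an inequality. -/
theorem lintegral_hardyKernel_rpow_left {κ s x : ℝ} (hs : s < κ) (hx : x ∈ Ioo (0 : ℝ) 1) :
    ∫⁻ y in Ioo 0 1, hardyKernel κ x y * ENNReal.ofReal (y ^ (-s)) ≤
      ENNReal.ofReal (1 / (κ - s)) * ENNReal.ofReal (x ^ (-s)) := by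
  rw [lintegral_hardyKernel_left hx]
  have e : ∫⁻ y in Ioo 0 x, ENNReal.ofReal (x ^ (-κ) * y ^ (κ - 1)) * ENNReal.ofReal (y ^ (-s)) =
      ∫⁻ y in Ioo 0 x, ENNReal.ofReal (x ^ (-κ)) * ENNReal.ofReal (y ^ (κ - s - 1)) := by
    refine setLIntegral_congr_fun measurableSet_Ioo fun y hy => ?_
    have hxp := Real.rpow_nonneg hx.1.le (-κ)
    have hyp := Real.rpow_nonneg hy.1.le (κ - 1)
    rw [← ENNReal.ofReal_mul (mul_nonneg hxp hyp), ← ENNReal.ofReal_mul hxp, mul_assoc,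
      ← Real.rpow_add hy.1]
    ring_nf
  rw [e, lintegral_const_mul _ (by fun_prop), lintegral_Ioo_zero_rpow (by linarith) hx.1,
    ← ENNReal.ofReal_mul (Real.rpow_nonneg hx.1.le _), ← ENNReal.ofReal_mul
    (by rw [one_div_nonneg]; linarith), ← mul_div_assoc, ← Real.rpow_add hx.1]
  refine le_of_eq (congrArg _ ?_)
  ring_nf

theorem lintegral_hardyKernel_rpow_right {κ s y : ℝ} (hs : 0 < κ - 1 + s)
    (hy : y ∈ Ioo (0 : ℝ) 1) :
    ∫⁻ x in Ioo 0 1, hardyKernel κ x y * ENNReal.ofReal (x ^ (-s)) ≤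
      ENNReal.ofReal (1 / (κ - 1 + s)) * ENNReal.ofReal (y ^ (-s)) := by
  rw [lintegral_hardyKernel_right hy]
  have e : ∫⁻ x in Ioo y 1, ENNReal.ofReal (x ^ (-κ) * y ^ (κ - 1)) * ENNReal.ofReal (x ^ (-s)) =
      ∫⁻ x in Ioo y 1, ENNReal.ofReal (y ^ (κ - 1)) *
        ENNReal.ofReal (x ^ (-(κ - 1 + s) - 1)) := by
    refine setLIntegral_congr_fun measurableSet_Ioo fun x hx => ?_
    have hx0 : 0 < x := hy.1.trans hx.1
    have hxp := Real.rpow_nonneg hx0.le (-κ)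
    have hyp := Real.rpow_nonneg hy.1.le (κ - 1)
    rw [← ENNReal.ofReal_mul (mul_nonneg hxp hyp), ← ENNReal.ofReal_mul hyp, mul_comm (x ^ _),
      mul_assoc, ← Real.rpow_add hx0]
    ring_nf
  rw [e, lintegral_const_mul _ (by fun_prop)]
  calc ENNReal.ofReal (y ^ (κ - 1)) * ∫⁻ x in Ioo y 1, ENNReal.ofReal (x ^ (-(κ - 1 + s) - 1))
      ≤ ENNReal.ofReal (y ^ (κ - 1)) * ∫⁻ x in Ioi y, ENNReal.ofReal (x ^ (-(κ - 1 + s) - 1)) := by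
        gcongr
        exact Ioo_subset_Ioi_self
    _ = _ := by
        rw [lintegral_Ioi_rpow hs hy.1, ← ENNReal.ofReal_mul (Real.rpow_nonneg hy.1.le _),
          ← ENNReal.ofReal_mul (by rw [one_div_nonneg]; linarith), ← mul_div_assoc,
          ← Real.rpow_add hy.1]
        refine congrArg _ ?_
        ring_nf

theorem ofReal_rpow_neg_rpow {x δ t : ℝ} (hx : 0 < x) (ht : 0 ≤ t) :
    ENNReal.ofReal (x ^ (-δ)) ^ t = ENNReal.ofReal (x ^ (-(δ * t))) := by
  rw [ENNReal.ofReal_rpow_of_nonneg (Real.rpow_nonneg hx.le _) ht, ← Real.rpow_mul hx.le, neg_mul]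

theorem lintegral_hardy_left {κ p δ : ℝ} (hp : 1 ≤ p) (h₁ : δ < κ) (h₂ : 0 < κ - 1 + δ * (p - 1))
    {f : ℝ → ℝ≥0∞} (hf : Measurable f) (hft : ∫⁻ y in Ioo (0 : ℝ) 1, f y ^ p ≠ ∞) :
    ∫⁻ x in Ioo (0 : ℝ) 1, (∫⁻ y in Ioo (0 : ℝ) 1, hardyKernel κ x y * f y) ^ p ≠ ∞ := by
  have := lintegral_schur (μ := volume.restrict (Ioo (0 : ℝ) 1)) hp (measurable_hardyKernel κ) hf
    (g := fun y => ENNReal.ofReal (y ^ (-δ))) (by fun_prop)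
    (by
      filter_upwards [ae_restrict_mem measurableSet_Ioo] with y hy
      simpa using Real.rpow_pos_of_pos hy.1 _)
    (by simp) (A := ENNReal.ofReal (1 / (κ - δ)))
    (B := ENNReal.ofReal (1 / (κ - 1 + δ * (p - 1))))
    (by
      filter_upwards [ae_restrict_mem measurableSet_Ioo] with x hx
      exact lintegral_hardyKernel_rpow_left h₁ hx)
    (by
      filter_upwards [ae_restrict_mem measurableSet_Ioo] with y hy
      rw [ofReal_rpow_neg_rpow hy.1 (by linarith)]
      refine le_trans (le_of_eq ?_) (lintegral_hardyKernel_rpow_right h₂ hy)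
      refine setLIntegral_congr_fun measurableSet_Ioo fun x hx => ?_
      simp only [ofReal_rpow_neg_rpow hx.1 (by linarith : 0 ≤ p - 1)])
  refine ne_top_of_le_ne_top ?_ this
  refine ENNReal.mul_ne_top (ENNReal.mul_ne_top ?_ ENNReal.ofReal_ne_top) hft
  exact ENNReal.rpow_ne_top_of_nonneg (by linarith) ENNReal.ofReal_ne_top

theorem lintegral_hardy_right {κ p δ : ℝ} (hp : 1 ≤ p) (h₁ : 0 < κ - 1 + δ)
    (h₂ : δ * (p - 1) < κ)
    {f : ℝ → ℝ≥0∞} (hf : Measurable f) (hft : ∫⁻ y in Ioo (0 : ℝ) 1, f y ^ p ≠ ∞) :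
    ∫⁻ x in Ioo (0 : ℝ) 1, (∫⁻ y in Ioo (0 : ℝ) 1, hardyKernel κ y x * f y) ^ p ≠ ∞ := by
  have := lintegral_schur (μ := volume.restrict (Ioo (0 : ℝ) 1)) hp
    (K := fun x y => hardyKernel κ y x) ((measurable_hardyKernel κ).comp measurable_swap) hf
    (g := fun y => ENNReal.ofReal (y ^ (-δ))) (by fun_prop)
    (by
      filter_upwards [ae_restrict_mem measurableSet_Ioo] with y hy
      simpa using Real.rpow_pos_of_pos hy.1 _)
    (by simp) (A := ENNReal.ofReal (1 / (κ - 1 + δ)))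
    (B := ENNReal.ofReal (1 / (κ - δ * (p - 1))))
    (by
      filter_upwards [ae_restrict_mem measurableSet_Ioo] with x hx
      exact lintegral_hardyKernel_rpow_right h₁ hx)
    (by
      filter_upwards [ae_restrict_mem measurableSet_Ioo] with y hy
      rw [ofReal_rpow_neg_rpow hy.1 (by linarith)]
      refine le_trans (le_of_eq ?_) (lintegral_hardyKernel_rpow_left h₂ hy)
      refine setLIntegral_congr_fun measurableSet_Ioo fun x hx => ?_
      simp only [ofReal_rpow_neg_rpow hx.1 (by linarith : 0 ≤ p - 1)])
  refine ne_top_of_le_ne_top ?_ this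
  refine ENNReal.mul_ne_top (ENNReal.mul_ne_top ?_ ENNReal.ofReal_ne_top) hft
  exact ENNReal.rpow_ne_top_of_nonneg (by linarith) ENNReal.ofReal_ne_top

/-- Schur's test is available for genuinely measurable functions only; here a measurable
representative of |h| is inserted, which changes none of the integrals. -/
theorem memLp_of_enorm_le_lintegral_kernel {μ : Measure ℝ} {p : ℝ≥0∞} (hp : 1 ≤ p) (hpt : p ≠ ∞)
    {h F : ℝ → ℝ} {K : ℝ → ℝ → ℝ≥0∞} (hh : MemLp h p μ) (hF : AEStronglyMeasurable F μ)
    (hle : ∀ᵐ x ∂μ, ‖F x‖ₑ ≤ ∫⁻ y, K x y * ‖h y‖ₑ ∂μ)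
    (H : ∀ f : ℝ → ℝ≥0∞, Measurable f → ∫⁻ y, f y ^ p.toReal ∂μ ≠ ∞ →
      ∫⁻ x, (∫⁻ y, K x y * f y ∂μ) ^ p.toReal ∂μ ≠ ∞) : MemLp F p μ := by
  have hp0 : p ≠ 0 := (zero_lt_one.trans_le hp).ne'
  refine ⟨hF, ?_⟩
  rw [eLpNorm_lt_top_iff_lintegral_rpow_enorm_lt_top hp0 hpt]
  have hm : AEMeasurable (fun y => ‖h y‖ₑ) μ := hh.1.enorm
  have hmk := hm.ae_eq_mk
  have h1 := (eLpNorm_lt_top_iff_lintegral_rpow_enorm_lt_top hp0 hpt).1 hh.2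
  have h2 : ∫⁻ y, hm.mk _ y ^ p.toReal ∂μ ≠ ∞ := by
    refine ne_of_lt (lt_of_eq_of_lt (lintegral_congr_ae ?_) h1)
    filter_upwards [hmk] with y hy
    rw [hy]
  refine lt_of_le_of_lt (lintegral_mono_ae ?_) (H _ hm.measurable_mk h2).lt_top
  filter_upwards [hle] with x hx
  refine ENNReal.rpow_le_rpow (hx.trans (le_of_eq (lintegral_congr_ae ?_))) ENNReal.toReal_nonneg
  filter_upwards [hmk] with y hy
  rw [hy]

theorem memLp_top_of_enorm_le_lintegral_kernel {μ : Measure ℝ} {h F : ℝ → ℝ} {K : ℝ → ℝ → ℝ≥0∞}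
    (hh : MemLp h ∞ μ) (hF : AEStronglyMeasurable F μ)
    (hle : ∀ᵐ x ∂μ, ‖F x‖ₑ ≤ ∫⁻ y, K x y * ‖h y‖ₑ ∂μ)
    (hK : ∀ x, Measurable (K x)) {A : ℝ≥0∞} (hA : A ≠ ∞)
    (H : ∀ᵐ x ∂μ, ∫⁻ y, K x y ∂μ ≤ A) : MemLp F ∞ μ := by
  refine ⟨hF, ?_⟩
  have hC := hh.2
  rw [eLpNorm_exponent_top] at hC ⊢
  refine lt_of_le_of_lt (eLpNormEssSup_le_of_ae_enorm_bound (C := A * eLpNormEssSup h μ) ?_)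
    (ENNReal.mul_lt_top hA.lt_top hC)
  filter_upwards [hle, H] with x hx hA
  refine hx.trans ?_
  calc ∫⁻ y, K x y * ‖h y‖ₑ ∂μ ≤ ∫⁻ y, K x y * eLpNormEssSup h μ ∂μ := by
        refine lintegral_mono_ae ?_
        filter_upwards [enorm_ae_le_eLpNormEssSup h μ] with y hy
        gcongr
    _ ≤ _ := by
        rw [lintegral_mul_const _ (hK x)]
        gcongr

theorem enorm_hardy_left_le {κ x : ℝ} (h : ℝ → ℝ) (hx : x ∈ Ioo (0 : ℝ) 1) :
    ‖x ^ (-κ) * ∫ y in (0 : ℝ)..x, y ^ (κ - 1) * |h y|‖ₑ ≤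
      ∫⁻ y in Ioo 0 1, hardyKernel κ x y * ‖h y‖ₑ := by
  rw [lintegral_hardyKernel_left hx, enorm_mul, intervalIntegral.integral_of_le hx.1.le,
    integral_Ioc_eq_integral_Ioo]
  have h0 := Real.rpow_nonneg hx.1.le (-κ)
  calc ‖x ^ (-κ)‖ₑ * ‖∫ y in Ioo 0 x, y ^ (κ - 1) * |h y|‖ₑ
      ≤ ‖x ^ (-κ)‖ₑ * ∫⁻ y in Ioo 0 x, ‖y ^ (κ - 1) * |h y|‖ₑ := by
        gcongr
        exact enorm_integral_le_lintegral_enorm _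
    _ = ∫⁻ y in Ioo 0 x, ‖x ^ (-κ)‖ₑ * ‖y ^ (κ - 1) * |h y|‖ₑ :=
        (lintegral_const_mul' _ _ (by simp)).symm
    _ = _ := by
        refine setLIntegral_congr_fun measurableSet_Ioo fun y hy => ?_
        simp only [enorm_mul, Real.enorm_abs]
        rw [ENNReal.ofReal_mul h0, Real.enorm_of_nonneg h0,
          Real.enorm_of_nonneg (Real.rpow_nonneg hy.1.le _), mul_assoc]

theorem enorm_hardy_right_le {κ x : ℝ} (h : ℝ → ℝ) (hx : x ∈ Ioo (0 : ℝ) 1) :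
    ‖x ^ (κ - 1) * ∫ y in x..1, y ^ (-κ) * |h y|‖ₑ ≤
      ∫⁻ y in Ioo 0 1, hardyKernel κ y x * ‖h y‖ₑ := by
  rw [lintegral_hardyKernel_right hx, enorm_mul, intervalIntegral.integral_of_le hx.2.le,
    integral_Ioc_eq_integral_Ioo]
  have h0 := Real.rpow_nonneg hx.1.le (κ - 1)
  calc ‖x ^ (κ - 1)‖ₑ * ‖∫ y in Ioo x 1, y ^ (-κ) * |h y|‖ₑ
      ≤ ‖x ^ (κ - 1)‖ₑ * ∫⁻ y in Ioo x 1, ‖y ^ (-κ) * |h y|‖ₑ := by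
        gcongr
        exact enorm_integral_le_lintegral_enorm _
    _ = ∫⁻ y in Ioo x 1, ‖x ^ (κ - 1)‖ₑ * ‖y ^ (-κ) * |h y|‖ₑ :=
        (lintegral_const_mul' _ _ (by simp)).symm
    _ = _ := by
        refine setLIntegral_congr_fun measurableSet_Ioo fun y hy => ?_
        simp only [enorm_mul, Real.enorm_abs]
        rw [mul_comm (y ^ _), ENNReal.ofReal_mul h0, Real.enorm_of_nonneg h0,
          Real.enorm_of_nonneg (Real.rpow_nonneg (hx.1.trans hy.1).le _), mul_assoc]

theorem aestronglyMeasurable_mul_integral {c G : ℝ → ℝ} (hc : ContinuousOn c (Ioo 0 1))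
    (hG : ContinuousOn G (Ioo 0 1)) :
    AEStronglyMeasurable (fun x => c x * G x) (volume.restrict (Ioo (0 : ℝ) 1)) :=
  (hc.mul hG).aestronglyMeasurable measurableSet_Ioo

theorem integrableOn_rpow_mul_abs {κ : ℝ} (hκ : 1 ≤ κ) {h : ℝ → ℝ}
    (hh : IntegrableOn h (Ioo 0 1)) : IntegrableOn (fun y => y ^ (κ - 1) * |h y|) (Ioo 0 1) := by
  refine Integrable.bdd_mul (c := 1) hh.abs ?_ ?_
  · exact (by fun_prop : Measurable fun y : ℝ => y ^ (κ - 1)).aestronglyMeasurable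
  · filter_upwards [ae_restrict_mem measurableSet_Ioo] with y hy
    rw [Real.norm_of_nonneg (Real.rpow_nonneg hy.1.le _)]
    exact Real.rpow_le_one hy.1.le hy.2.le (by linarith)

theorem continuousOn_rpow_const_Ioi (a : ℝ) : ContinuousOn (fun x : ℝ => x ^ a) (Ioi 0) :=
  fun x hx => (Real.continuousAt_rpow_const x a (Or.inl (ne_of_gt hx))).continuousWithinAt

theorem aestronglyMeasurable_hardy_left {κ : ℝ} (hκ : 1 ≤ κ) {h : ℝ → ℝ}
    (hh : IntegrableOn h (Ioo 0 1)) :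
    AEStronglyMeasurable (fun x => x ^ (-κ) * ∫ y in (0 : ℝ)..x, y ^ (κ - 1) * |h y|)
      (volume.restrict (Ioo (0 : ℝ) 1)) := by
  refine aestronglyMeasurable_mul_integral
    ((continuousOn_rpow_const_Ioi _).mono Ioo_subset_Ioi_self) ?_
  have : IntegrableOn (fun y => y ^ (κ - 1) * |h y|) (uIcc 0 1) := by
    rw [uIcc_of_le zero_le_one, integrableOn_Icc_iff_integrableOn_Ioo]
    exact integrableOn_rpow_mul_abs hκ hh
  have h2 := intervalIntegral.continuousOn_primitive_interval this
  rw [uIcc_of_le zero_le_one] at h2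
  exact h2.mono Ioo_subset_Icc_self

theorem intervalIntegrable_rpow_mul_abs {a x : ℝ} {h : ℝ → ℝ} (hx : x ∈ Ioc (0 : ℝ) 1)
    (hh : IntegrableOn h (Ioo 0 1)) :
    IntervalIntegrable (fun y => y ^ a * |h y|) volume x 1 := by
  refine IntervalIntegrable.continuousOn_mul ?_ ?_
  · rw [intervalIntegrable_iff_integrableOn_Ioo_of_le hx.2]
    exact (hh.mono_set (Ioo_subset_Ioo hx.1.le le_rfl)).abs
  · rw [uIcc_of_le hx.2]
    exact (continuousOn_rpow_const_Ioi _).mono fun y hy => hx.1.trans_le hy.1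

theorem continuousOn_integral_to_one {F : ℝ → ℝ}
    (hF : ∀ x ∈ Ioc (0 : ℝ) 1, IntervalIntegrable F volume x 1) :
    ContinuousOn (fun x => ∫ y in x..1, F y) (Ioo 0 1) := by
  intro x hx
  have hx2 : x / 2 ∈ Ioc (0 : ℝ) 1 := ⟨by linarith [hx.1], by linarith [hx.2]⟩
  have h1 := hF _ hx2
  have h2 := intervalIntegral.continuousOn_primitive_interval'  h1 (b₁ := x / 2) (b₂ := 1)
    (a := 1) (by simp)
  rw [uIcc_of_le hx2.2] at h2
  have e : (fun x => ∫ y in x..1, F y) = fun x => -∫ y in (1 : ℝ)..x, F y :=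
    funext fun x => intervalIntegral.integral_symm _ _
  rw [e]
  exact (h2.continuousAt (Icc_mem_nhds (by linarith [hx.1]) hx.2)).neg.continuousWithinAt

theorem aestronglyMeasurable_hardy_right {κ : ℝ} {h : ℝ → ℝ}
    (hh : IntegrableOn h (Ioo 0 1)) :
    AEStronglyMeasurable (fun x => x ^ (κ - 1) * ∫ y in x..1, y ^ (-κ) * |h y|)
      (volume.restrict (Ioo (0 : ℝ) 1)) := by
  refine aestronglyMeasurable_mul_integral
    ((continuousOn_rpow_const_Ioi _).mono Ioo_subset_Ioi_self) ?_
  exact continuousOn_integral_to_one fun x hx => intervalIntegrable_rpow_mul_abs hx hh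

theorem integrableOn_of_memLp {p : ℝ≥0∞} (hp : 1 ≤ p) {h : ℝ → ℝ}
    (hh : MemLp h p (volume.restrict (Ioo (0 : ℝ) 1))) : IntegrableOn h (Ioo 0 1) :=
  memLp_one_iff_integrable.1 (hh.mono_exponent hp)

/-- Hardy's inequality for the operator integrating from the left endpoint. -/
theorem memLp_hardy_left {κ : ℝ} {p : ℝ≥0∞} {h : ℝ → ℝ} (hκ : 1 ≤ κ) (hp : 1 ≤ p)
    (hc : 1 < κ ∨ 1 < p) (hh : MemLp h p (volume.restrict (Ioo (0 : ℝ) 1))) :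
    MemLp (fun x => x ^ (-κ) * ∫ y in (0 : ℝ)..x, y ^ (κ - 1) * |h y|) p
      (volume.restrict (Ioo (0 : ℝ) 1)) := by
  have hm := aestronglyMeasurable_hardy_left hκ (integrableOn_of_memLp hp hh)
  have hle : ∀ᵐ x ∂(volume.restrict (Ioo (0 : ℝ) 1)),
      ‖x ^ (-κ) * ∫ y in (0 : ℝ)..x, y ^ (κ - 1) * |h y|‖ₑ ≤
      ∫⁻ y in Ioo 0 1, hardyKernel κ x y * ‖h y‖ₑ := by
    filter_upwards [ae_restrict_mem measurableSet_Ioo] with x hx using enorm_hardy_left_le h hx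
  by_cases hpt : p = ∞
  · subst hpt
    refine memLp_top_of_enorm_le_lintegral_kernel hh hm hle
      (fun x => (measurable_hardyKernel κ).of_uncurry_left) (A := ENNReal.ofReal (1 / (κ - 0)))
      ENNReal.ofReal_ne_top ?_
    filter_upwards [ae_restrict_mem measurableSet_Ioo] with x hx
    simpa using lintegral_hardyKernel_rpow_left (κ := κ) (s := 0) (by linarith) hx
  · have ht : 1 ≤ p.toReal := by
      rw [← ENNReal.toReal_one]; exact ENNReal.toReal_mono hpt hp
    refine memLp_of_enorm_le_lintegral_kernel hp hpt hh hm hle fun f hf hft => ?_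
    rcases hc with hc | hc
    -- For κ > 1 the constant test function suffices. In the other case κ may equal 1, and δ = 1/2
    -- satisfies both δ < κ and 0 < κ - 1 + δ (p - 1) because p > 1.
    · exact lintegral_hardy_left (δ := 0) ht (by linarith) (by linarith) hf hft
    · have ht' : 1 < p.toReal := by
        rw [← ENNReal.toReal_one]; exact (ENNReal.toReal_lt_toReal (by simp) hpt).2 hc
      exact lintegral_hardy_left (δ := 1 / 2) ht (by linarith) (by linarith) hf hft

/-- Hardy's inequality for the operator integrating from the right endpoint. -/
theorem memLp_hardy_right {a : ℝ} {p : ℝ≥0∞} {h : ℝ → ℝ} (hp : 1 ≤ p)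
    (hc : 0 < a ∨ (-1 < a ∧ a ≤ 0 ∧ p < (ENNReal.ofReal (-a))⁻¹))
    (hh : MemLp h p (volume.restrict (Ioo (0 : ℝ) 1))) :
    MemLp (fun x => x ^ a * ∫ y in x..1, y ^ (-a - 1) * |h y|) p
      (volume.restrict (Ioo (0 : ℝ) 1)) := by
  obtain ⟨κ, rfl⟩ : ∃ κ, a = κ - 1 := ⟨a + 1, by ring⟩
  simp_rw [show -(κ - 1) - 1 = -κ by ring]
  have hm := aestronglyMeasurable_hardy_right (κ := κ) (integrableOn_of_memLp hp hh)
  have hle : ∀ᵐ x ∂(volume.restrict (Ioo (0 : ℝ) 1)),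
      ‖x ^ (κ - 1) * ∫ y in x..1, y ^ (-κ) * |h y|‖ₑ ≤
      ∫⁻ y in Ioo 0 1, hardyKernel κ y x * ‖h y‖ₑ := by
    filter_upwards [ae_restrict_mem measurableSet_Ioo] with x hx using enorm_hardy_right_le h hx
  by_cases hpt : p = ∞
  · subst hpt
    have hc' : 0 < κ - 1 := by
      rcases hc with hc | ⟨-, -, hc⟩
      · exact hc
      · exact absurd hc (by simp)
    refine memLp_top_of_enorm_le_lintegral_kernel (K := fun x y => hardyKernel κ y x) hh hm hle
      (fun x => (measurable_hardyKernel κ).of_uncurry_right)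
      (A := ENNReal.ofReal (1 / (κ - 1 + 0))) ENNReal.ofReal_ne_top ?_
    filter_upwards [ae_restrict_mem measurableSet_Ioo] with x hx
    simpa using lintegral_hardyKernel_rpow_right (κ := κ) (s := 0) (by linarith) hx
  · have ht : 1 ≤ p.toReal := by
      rw [← ENNReal.toReal_one]; exact ENNReal.toReal_mono hpt hp
    refine memLp_of_enorm_le_lintegral_kernel (K := fun x y => hardyKernel κ y x) hp hpt hh hm hle
      fun f hf hft => ?_
    rcases hc with hc | ⟨hc1, hc2, hc3⟩
    · exact lintegral_hardy_right (δ := 0) ht (by linarith) (by linarith) hf hft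
    · have hlt : 0 < 1 + (κ - 1) * p.toReal := by
        rcases hc2.eq_or_lt with h0 | h0
        · rw [h0]; norm_num
        · have h1 : p * ENNReal.ofReal (-(κ - 1)) < 1 := by
            rw [← inv_inv (ENNReal.ofReal (-(κ - 1))), ← div_eq_mul_inv]
            refine ENNReal.div_lt_of_lt_mul ?_
            simpa using hc3
          rw [← ENNReal.ofReal_toReal hpt, ← ENNReal.ofReal_mul (by linarith),
            ← ENNReal.ofReal_one, ENNReal.ofReal_lt_ofReal_iff one_pos] at h1
          linarith
      have hε : 0 < (1 + (κ - 1) * p.toReal) / p.toReal := by positivity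
      have hε' : (1 + (κ - 1) * p.toReal) / p.toReal * p.toReal = 1 + (κ - 1) * p.toReal :=
        div_mul_cancel₀ _ (by linarith)
      -- This δ simplifies to 1/p. Both Schur conditions then say κ - 1 + 1/p > 0, which is the
      -- assumption p < 1/(-a) with a = κ - 1.
      refine lintegral_hardy_right (δ := -(κ - 1) + (1 + (κ - 1) * p.toReal) / p.toReal) ht
        (by linarith) ?_ hf hft
      nlinarith

/-- The borderline case of Hardy's inequality requires a logarithmic weight. -/
theorem memLp_hardy_log {h : ℝ → ℝ}
    (hh : MemLp (fun x => (1 - Real.log x) * h x) 1 (volume.restrict (Ioo (0 : ℝ) 1)))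
    (hi : IntegrableOn h (Ioo 0 1)) :
    MemLp (fun x => x ^ (-1 : ℝ) * ∫ y in (0 : ℝ)..x, y ^ ((1 : ℝ) - 1) * |h y|) 1
      (volume.restrict (Ioo (0 : ℝ) 1)) := by
  have hm := aestronglyMeasurable_hardy_left le_rfl hi
  refine ⟨hm, ?_⟩
  rw [eLpNorm_one_eq_lintegral_enorm]
  have h1 := hh.2
  rw [eLpNorm_one_eq_lintegral_enorm] at h1
  have hf : AEMeasurable (fun y => ‖h y‖ₑ) (volume.restrict (Ioo (0 : ℝ) 1)) := hi.1.enorm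
  -- After Tonelli the kernel is integrated in x first, and the integral of 1/x from y to 1 is -log
  -- y: this is where the logarithmic weight comes from.
  have hlog : ∀ y ∈ Ioo (0 : ℝ) 1, ∫⁻ x in Ioo 0 1, hardyKernel 1 x y ≤ ‖1 - Real.log y‖ₑ := by
    intro y hy
    have := lintegral_hardyKernel_right (κ := 1) hy (fun _ => 1)
    simp only [mul_one, sub_self, Real.rpow_zero] at this
    have hl : Real.log y ≤ 0 := Real.log_nonpos hy.1.le hy.2.le
    have hi : IntervalIntegrable (fun x : ℝ => x ^ (-1 : ℝ)) volume y 1 := by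
      refine ContinuousOn.intervalIntegrable ?_
      rw [uIcc_of_le hy.2.le]
      exact (continuousOn_rpow_const_Ioi _).mono fun x hx => hy.1.trans_le hx.1
    rw [this, ← ofReal_integral_eq_lintegral_ofReal, ← integral_Ioc_eq_integral_Ioo,
      ← intervalIntegral.integral_of_le hy.2.le, Real.enorm_of_nonneg (by linarith)]
    · refine ENNReal.ofReal_le_ofReal ?_
      simp_rw [Real.rpow_neg_one]
      rw [integral_inv_of_pos hy.1 one_pos, one_div, Real.log_inv]
      linarith
    · exact (intervalIntegrable_iff_integrableOn_Ioo_of_le hy.2.le).1 hi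
    · filter_upwards [ae_restrict_mem measurableSet_Ioo] with x hx
      exact Real.rpow_nonneg (hy.1.trans hx.1).le _
  refine lt_of_le_of_lt ?_ h1
  calc ∫⁻ x in Ioo 0 1, ‖x ^ (-1 : ℝ) * ∫ y in (0 : ℝ)..x, y ^ ((1 : ℝ) - 1) * |h y|‖ₑ
      ≤ ∫⁻ x in Ioo 0 1, ∫⁻ y in Ioo 0 1, hardyKernel 1 x y * ‖h y‖ₑ :=
        setLIntegral_mono' measurableSet_Ioo fun x hx => enorm_hardy_left_le h hx
    _ = ∫⁻ y in Ioo 0 1, ∫⁻ x in Ioo 0 1, hardyKernel 1 x y * ‖h y‖ₑ :=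
        lintegral_lintegral_swap ((measurable_hardyKernel 1).aemeasurable.mul hf.comp_snd)
    _ ≤ ∫⁻ y in Ioo 0 1, ‖(1 - Real.log y) * h y‖ₑ := by
        refine setLIntegral_mono' measurableSet_Ioo fun y hy => ?_
        rw [lintegral_mul_const _ (measurable_hardyKernel 1).of_uncurry_right, enorm_mul]
        gcongr
        exact hlog y hy

/-! ### Volterra integral equations with an integrable weight -/

/-- The weight `ρ` and the function `F` for which the iterated integral
`∫₀ˣ ρ s ∫₀ˢ F y dy ds` converges absolutely. -/
structure VolterraAdmissible (ρ : ℝ → ℝ) (F : ℝ → ℂ) : Prop where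
  cont : ContinuousOn ρ (Ioi 0)
  nonneg : ∀ x, 0 < x → 0 ≤ ρ x
  integrable : ∀ X : ℝ, 0 < X → IntervalIntegrable F volume 0 X
  integrable_weight : ∀ X : ℝ, 0 < X →
    IntervalIntegrable (fun s => ρ s * ∫ y in (0 : ℝ)..s, ‖F y‖) volume 0 X

/-- The iterated integral `∫₀ˣ ρ s ∫₀ˢ F y dy ds`. -/
noncomputable def volterraInt (ρ : ℝ → ℝ) (F : ℝ → ℂ) (x : ℝ) : ℂ :=
  ∫ s in (0 : ℝ)..x, (ρ s : ℂ) * ∫ y in (0 : ℝ)..s, F y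

/-- The total weight `∫₀ˣ ρ s ∫₀ˢ ‖F y‖ dy ds`. -/
noncomputable def volterraWeight (ρ : ℝ → ℝ) (F : ℝ → ℂ) (x : ℝ) : ℝ :=
  ∫ s in (0 : ℝ)..x, ρ s * ∫ y in (0 : ℝ)..s, ‖F y‖

theorem continuousOn_primitive_Ici {E : Type*} [NormedAddCommGroup E] [NormedSpace ℝ E]
    {F : ℝ → E} (hF : ∀ X : ℝ, 0 < X → IntervalIntegrable F volume 0 X) :
    ContinuousOn (fun x => ∫ y in (0 : ℝ)..x, F y) (Ici 0) := by
  intro x hx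
  have hx' : (0 : ℝ) ≤ x := hx
  have h := intervalIntegral.continuousOn_primitive_interval' (hF (x + 1) (by linarith))
    (a := 0) (by simp)
  rw [uIcc_of_le (by linarith)] at h
  refine (h x ⟨hx', by linarith⟩).mono_of_mem_nhdsWithin ?_
  exact mem_nhdsWithin.2 ⟨Iio (x + 1), isOpen_Iio, by simp, fun y hy => ⟨hy.2, hy.1.le⟩⟩

theorem hasDerivAt_primitive_of_continuousOn {E : Type*} [NormedAddCommGroup E] [NormedSpace ℝ E]
    [CompleteSpace E] {F : ℝ → E} {x : ℝ} (hx : 0 < x) (hF : IntervalIntegrable F volume 0 x)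
    (hc : ContinuousOn F (Ioi 0)) : HasDerivAt (fun x => ∫ y in (0 : ℝ)..x, F y) (F x) x :=
  intervalIntegral.integral_hasDerivAt_right hF
    (hc.stronglyMeasurableAtFilter isOpen_Ioi x hx) (hc.continuousAt (Ioi_mem_nhds hx))

theorem IntervalIntegrable.of_continuousOn_of_le {E : Type*} [NormedAddCommGroup E]
    {F : ℝ → E} {D : ℝ → ℝ} {X : ℝ} (hX : 0 < X) (hc : ContinuousOn F (Ioi 0))
    (hD : IntervalIntegrable D volume 0 X) (h : ∀ s ∈ Ioc 0 X, ‖F s‖ ≤ D s) :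
    IntervalIntegrable F volume 0 X := by
  refine hD.mono_fun' ?_ ?_
  · rw [uIoc_of_le hX.le]
    exact (hc.mono fun s hs => hs.1).aestronglyMeasurable measurableSet_Ioc
  · rw [uIoc_of_le hX.le]
    filter_upwards [ae_restrict_mem measurableSet_Ioc] with s hs using h s hs

namespace VolterraAdmissible

variable {ρ : ℝ → ℝ} {F G m f : ℝ → ℂ}

theorem continuousOn_inner {E : Type*} [NormedAddCommGroup E] [NormedSpace ℝ E]
    {F : ℝ → E} (hF : ∀ X : ℝ, 0 < X → IntervalIntegrable F volume 0 X) :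
    ContinuousOn (fun x => ∫ y in (0 : ℝ)..x, F y) (Ioi 0) :=
  (continuousOn_primitive_Ici hF).mono Ioi_subset_Ici_self

/-- The weighted inner integral is continuous on (0, ∞), so measurability is free and an integrable
majorant is all that has to be supplied. -/
theorem of_le (hc : ContinuousOn ρ (Ioi 0)) (h0 : ∀ x, 0 < x → 0 ≤ ρ x)
    (hF : ∀ X : ℝ, 0 < X → IntervalIntegrable F volume 0 X)
    (hD : ∀ X : ℝ, 0 < X → ∃ D : ℝ → ℝ, IntervalIntegrable D volume 0 X ∧
      ∀ s ∈ Ioc 0 X, ρ s * ∫ y in (0 : ℝ)..s, ‖F y‖ ≤ D s) : VolterraAdmissible ρ F := by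
  refine ⟨hc, h0, hF, fun X hX => ?_⟩
  obtain ⟨D, hD, hle⟩ := hD X hX
  refine IntervalIntegrable.of_continuousOn_of_le hX
    (hc.mul (continuousOn_inner fun X hX => (hF X hX).norm)) hD fun s hs => ?_
  rw [Real.norm_of_nonneg (mul_nonneg (h0 s hs.1)
    (intervalIntegral.integral_nonneg hs.1.le fun y _ => norm_nonneg _))]
  exact hle s hs

theorem integrable_inner (h : VolterraAdmissible ρ F) {X : ℝ} (hX : 0 < X) :
    IntervalIntegrable (fun s => (ρ s : ℂ) * ∫ y in (0 : ℝ)..s, F y) volume 0 X := by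
  refine IntervalIntegrable.of_continuousOn_of_le hX ((Complex.continuous_ofReal.comp_continuousOn
    h.cont).mul (continuousOn_inner h.integrable)) (h.integrable_weight X hX) fun s hs => ?_
  rw [norm_mul, Complex.norm_real, Real.norm_of_nonneg (h.nonneg s hs.1)]
  gcongr
  · exact h.nonneg s hs.1
  · exact intervalIntegral.norm_integral_le_integral_norm hs.1.le

theorem add (hF : VolterraAdmissible ρ F) (hG : VolterraAdmissible ρ G) :
    VolterraAdmissible ρ (fun y => F y + G y) := by
  refine of_le hF.cont hF.nonneg (fun X hX => (hF.integrable X hX).add (hG.integrable X hX))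
    fun X hX => ⟨_, (hF.integrable_weight X hX).add (hG.integrable_weight X hX), fun s hs => ?_⟩
  rw [← mul_add, ← intervalIntegral.integral_add (hF.integrable s hs.1).norm
    (hG.integrable s hs.1).norm]
  refine mul_le_mul_of_nonneg_left ?_ (hF.nonneg s hs.1)
  refine intervalIntegral.integral_mono_on hs.1.le
    ((hF.integrable s hs.1).add (hG.integrable s hs.1)).norm
    ((hF.integrable s hs.1).norm.add (hG.integrable s hs.1).norm) fun y _ => norm_add_le _ _

theorem integral_norm_mul_le (hm : VolterraAdmissible ρ m) (hf : ContinuousOn f (Ici 0)) {C s : ℝ}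
    (hs : 0 ≤ s) (hC : ∀ y ∈ Icc 0 s, ‖f y‖ ≤ C) :
    ∫ y in (0 : ℝ)..s, ‖m y * f y‖ ≤ C * ∫ y in (0 : ℝ)..s, ‖m y‖ := by
  rcases hs.eq_or_lt with rfl | hs'
  · simp
  rw [← intervalIntegral.integral_const_mul]
  have hfc : ContinuousOn f (uIcc 0 s) := by
    rw [uIcc_of_le hs]; exact hf.mono fun y hy => hy.1
  refine intervalIntegral.integral_mono_on hs
    ((hm.integrable s hs').mul_continuousOn hfc).norm
    ((hm.integrable s hs').norm.const_mul _) fun y hy => ?_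
  rw [norm_mul, mul_comm]
  exact mul_le_mul_of_nonneg_right (hC y hy) (norm_nonneg _)

theorem mul (hm : VolterraAdmissible ρ m) (hf : ContinuousOn f (Ici 0)) :
    VolterraAdmissible ρ (fun y => m y * f y) := by
  have hfc : ∀ X : ℝ, 0 ≤ X → ContinuousOn f (uIcc 0 X) := by
    intro X hX
    rw [uIcc_of_le hX]
    exact hf.mono fun y hy => hy.1
  refine of_le hm.cont hm.nonneg
    (fun X hX => (hm.integrable X hX).mul_continuousOn (hfc X hX.le)) fun X hX => ?_
  obtain ⟨C, hC⟩ := isCompact_Icc.exists_bound_of_continuousOn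
    (hf.mono (fun y hy => hy.1 : Icc 0 X ⊆ Ici 0))
  refine ⟨_, (hm.integrable_weight X hX).const_mul C, fun s hs => ?_⟩
  calc ρ s * ∫ y in (0 : ℝ)..s, ‖m y * f y‖ ≤ ρ s * (C * ∫ y in (0 : ℝ)..s, ‖m y‖) :=
        mul_le_mul_of_nonneg_left (hm.integral_norm_mul_le hf hs.1.le
          fun y hy => hC y ⟨hy.1, hy.2.trans hs.2⟩) (hm.nonneg s hs.1)
    _ = _ := by ring

theorem const_mul (c : ℂ) (hm : VolterraAdmissible ρ m) :
    VolterraAdmissible ρ (fun y => c * m y) := by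
  simpa [mul_comm] using hm.mul (f := fun _ => c) continuousOn_const

theorem continuousOn_volterraInt (h : VolterraAdmissible ρ F) :
    ContinuousOn (volterraInt ρ F) (Ici 0) :=
  continuousOn_primitive_Ici fun _ hX => h.integrable_inner hX

theorem continuousOn_weight (h : VolterraAdmissible ρ F) :
    ContinuousOn (volterraWeight ρ F) (Ici 0) :=
  continuousOn_primitive_Ici h.integrable_weight

theorem hasDerivAt_volterraInt (h : VolterraAdmissible ρ F) {x : ℝ} (hx : 0 < x) :
    HasDerivAt (volterraInt ρ F) ((ρ x : ℂ) * ∫ y in (0 : ℝ)..x, F y) x :=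
  hasDerivAt_primitive_of_continuousOn hx (h.integrable_inner hx)
    ((Complex.continuous_ofReal.comp_continuousOn h.cont).mul (continuousOn_inner h.integrable))

theorem hasDerivAt_weight (h : VolterraAdmissible ρ F) {x : ℝ} (hx : 0 < x) :
    HasDerivAt (volterraWeight ρ F) (ρ x * ∫ y in (0 : ℝ)..x, ‖F y‖) x :=
  hasDerivAt_primitive_of_continuousOn hx (h.integrable_weight x hx)
    (h.cont.mul (continuousOn_inner fun X hX => (h.integrable X hX).norm))

theorem density_nonneg (h : VolterraAdmissible ρ F) {x : ℝ} (hx : 0 < x) :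
    0 ≤ ρ x * ∫ y in (0 : ℝ)..x, ‖F y‖ :=
  mul_nonneg (h.nonneg x hx) (intervalIntegral.integral_nonneg hx.le fun _ _ => norm_nonneg _)

theorem weight_mono (h : VolterraAdmissible ρ F) : MonotoneOn (volterraWeight ρ F) (Ici 0) := by
  refine monotoneOn_of_deriv_nonneg (convex_Ici 0) h.continuousOn_weight ?_ ?_
  · rw [interior_Ici]
    exact fun x hx => (h.hasDerivAt_weight hx).differentiableAt.differentiableWithinAt
  · rw [interior_Ici]
    intro x hx
    rw [(h.hasDerivAt_weight hx).deriv]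
    exact h.density_nonneg hx

theorem volterraWeight_zero : volterraWeight ρ F 0 = 0 := by simp [volterraWeight]

theorem weight_nonneg (h : VolterraAdmissible ρ F) {x : ℝ} (hx : 0 ≤ x) :
    0 ≤ volterraWeight ρ F x := by
  simpa only [volterraWeight_zero] using h.weight_mono (mem_Ici.2 le_rfl) hx hx

theorem volterraInt_add (hF : VolterraAdmissible ρ F) (hG : VolterraAdmissible ρ G) {x : ℝ}
    (hx : 0 ≤ x) :
    volterraInt ρ (fun y => F y + G y) x = volterraInt ρ F x + volterraInt ρ G x := by
  rcases hx.eq_or_lt with rfl | hx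
  · simp [volterraInt]
  unfold volterraInt
  rw [← intervalIntegral.integral_add (hF.integrable_inner hx) (hG.integrable_inner hx)]
  refine intervalIntegral.integral_congr_ae (Eventually.of_forall fun s hs => ?_)
  rw [uIoc_of_le hx.le] at hs
  rw [intervalIntegral.integral_add (hF.integrable s hs.1) (hG.integrable s hs.1), mul_add]

theorem volterraInt_const_mul (c : ℂ) (x : ℝ) :
    volterraInt ρ (fun y => c * F y) x = c * volterraInt ρ F x := by
  unfold volterraInt
  rw [← intervalIntegral.integral_const_mul]
  congr 1
  ext s
  rw [intervalIntegral.integral_const_mul]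
  ring

theorem volterraInt_congr {x : ℝ} (hx : 0 ≤ x) (h : ∀ y ∈ Ioc 0 x, F y = G y) :
    volterraInt ρ F x = volterraInt ρ G x := by
  unfold volterraInt
  refine intervalIntegral.integral_congr_ae (Eventually.of_forall fun s hs => ?_)
  rw [uIoc_of_le hx] at hs
  congr 1
  refine intervalIntegral.integral_congr_ae (Eventually.of_forall fun y hy => ?_)
  rw [uIoc_of_le hs.1.le] at hy
  exact h y ⟨hy.1, hy.2.trans hs.2⟩

/-- The inductive step in the estimate of the iterates of a Volterra operator. -/
theorem norm_volterraInt_mul_le (hm : VolterraAdmissible ρ m) (hf : ContinuousOn f (Ici 0))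
    {C x : ℝ} {n : ℕ} (hC : 0 ≤ C) (hx : 0 ≤ x)
    (hb : ∀ y ∈ Icc 0 x, ‖f y‖ ≤ C * volterraWeight ρ m y ^ n) :
    ‖volterraInt ρ (fun y => m y * f y) x‖ ≤
      C * (volterraWeight ρ m x ^ (n + 1) / (n + 1)) := by
  rcases hx.eq_or_lt with rfl | hx
  · simp [volterraInt, volterraWeight]
  set W := volterraWeight ρ m with hW
  set D : ℝ → ℝ := fun s => ρ s * ∫ y in (0 : ℝ)..s, ‖m y‖ with hD
  have hWc : ContinuousOn W (uIcc 0 x) := by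
    rw [uIcc_of_le hx.le]
    exact hm.continuousOn_weight.mono fun y hy => hy.1
  have hint : IntervalIntegrable (fun s => W s ^ n * D s) volume 0 x :=
    (hm.integrable_weight x hx).continuousOn_mul (hWc.pow n)
  -- Since W' = D and W(0) = 0, integrating Wⁿ W' gains the factor 1/(n+1) that builds up the
  -- factorial.
  have hFTC : ∫ s in (0 : ℝ)..x, W s ^ n * D s = W x ^ (n + 1) / (n + 1) := by
    have : ∫ s in (0 : ℝ)..x, W s ^ n * D s =
        W x ^ (n + 1) / (n + 1) - W 0 ^ (n + 1) / (n + 1) := by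
      refine intervalIntegral.integral_eq_sub_of_hasDerivAt_of_le hx.le
        (f := fun s => W s ^ (n + 1) / (n + 1)) ?_ (fun s hs => ?_) hint
      · rw [uIcc_of_le hx.le] at hWc
        exact (hWc.pow _).div_const _
      · have h1 : HasDerivAt W (D s) s := hm.hasDerivAt_weight hs.1
        have h2 := (h1.pow (n + 1)).div_const ((n : ℝ) + 1)
        have hn : (n : ℝ) + 1 ≠ 0 := by positivity
        refine h2.congr_deriv ?_
        rw [Nat.add_sub_cancel]
        push_cast
        field_simp
    rw [this, hW, volterraWeight_zero]
    simp
  have hmf := hm.mul hf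
  calc ‖volterraInt ρ (fun y => m y * f y) x‖
      ≤ ∫ s in (0 : ℝ)..x, ‖(ρ s : ℂ) * ∫ y in (0 : ℝ)..s, m y * f y‖ :=
        intervalIntegral.norm_integral_le_integral_norm hx.le
    _ ≤ ∫ s in (0 : ℝ)..x, C * (W s ^ n * D s) := by
        refine intervalIntegral.integral_mono_on_of_le_Ioo hx.le (hmf.integrable_inner hx).norm
          (hint.const_mul C) fun s hs => ?_
        rw [norm_mul, Complex.norm_real, Real.norm_of_nonneg (hm.nonneg s hs.1)]
        have h1 : ∀ y ∈ Icc 0 s, ‖f y‖ ≤ C * W s ^ n := by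
          intro y hy
          refine (hb y ⟨hy.1, hy.2.trans hs.2.le⟩).trans ?_
          have h2 := hm.weight_mono hy.1 hs.1.le hy.2
          have h3 := hm.weight_nonneg hy.1
          gcongr
        calc ρ s * ‖∫ y in (0 : ℝ)..s, m y * f y‖
            ≤ ρ s * (C * W s ^ n * ∫ y in (0 : ℝ)..s, ‖m y‖) := by
              refine mul_le_mul_of_nonneg_left ?_ (hm.nonneg s hs.1)
              exact (intervalIntegral.norm_integral_le_integral_norm hs.1.le).trans
                (hm.integral_norm_mul_le hf hs.1.le h1)
          _ = C * (W s ^ n * D s) := by rw [hD]; ring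
    _ = _ := by rw [intervalIntegral.integral_const_mul, hFTC]

end VolterraAdmissible

/-! ### Inversion of the Volterra operator and entire dependence on the parameter -/

open scoped BoundedContinuousFunction

/-- Projection of the line onto `[0, X]`. -/
noncomputable def clampTo (X x : ℝ) : ℝ := max 0 (min x X)

theorem continuous_clampTo (X : ℝ) : Continuous (clampTo X) := by unfold clampTo; fun_prop

theorem clampTo_nonneg (X x : ℝ) : 0 ≤ clampTo X x := le_max_left _ _

theorem clampTo_le {X : ℝ} (hX : 0 ≤ X) (x : ℝ) : clampTo X x ≤ X := max_le hX (min_le_right _ _)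

theorem clampTo_of_mem {X x : ℝ} (hx : x ∈ Icc 0 X) : clampTo X x = x := by
  unfold clampTo
  rw [min_eq_left hx.2, max_eq_right hx.1]

theorem clampTo_clampTo {X Y x : ℝ} (hX : 0 ≤ X) (hXY : X ≤ Y) :
    clampTo Y (clampTo X x) = clampTo X x :=
  clampTo_of_mem ⟨clampTo_nonneg _ _, (clampTo_le hX x).trans hXY⟩

/-- A function continuous on `[0, ∞)`, frozen outside `[0, X]`, as a bounded continuous function. -/
noncomputable def clampBCF (X : ℝ) (hX : 0 ≤ X) (f : ℝ → ℂ) (hf : ContinuousOn f (Ici 0)) : ℝ →ᵇ ℂ :=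
  BoundedContinuousFunction.ofNormedAddCommGroup (fun x => f (clampTo X x))
    (hf.comp_continuous (continuous_clampTo X) fun x => clampTo_nonneg X x)
    (isCompact_Icc.exists_bound_of_continuousOn
      (hf.mono (fun _ hy => hy.1 : Icc 0 X ⊆ Ici 0))).choose
    fun x => (isCompact_Icc.exists_bound_of_continuousOn
      (hf.mono (fun _ hy => hy.1 : Icc 0 X ⊆ Ici 0))).choose_spec _
      ⟨clampTo_nonneg X x, clampTo_le hX x⟩

@[simp] theorem clampBCF_apply {X : ℝ} (hX : 0 ≤ X) {f : ℝ → ℂ} (hf : ContinuousOn f (Ici 0))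
    (x : ℝ) : clampBCF X hX f hf x = f (clampTo X x) := rfl

/-- 1 - Tⁿ factors as (1 - T) times a finite geometric sum; the factors commute, so invertibility of
the product passes to each of them. No smallness of T itself is needed. -/
theorem isUnit_one_sub_of_norm_pow_lt_one {R : Type*} [NormedRing R] [HasSummableGeomSeries R]
    {T : R} {n : ℕ} (h : ‖T ^ n‖ < 1) : IsUnit (1 - T) := by
  have hu : IsUnit (1 - T ^ n) := isUnit_one_sub_of_norm_lt_one h
  have hc : Commute (1 - T) (∑ i ∈ Finset.range n, T ^ i) := by
    rw [Commute, SemiconjBy, mul_neg_geom_sum, geom_sum_mul_neg]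
  rw [← mul_neg_geom_sum, hc.isUnit_mul_iff] at hu
  exact hu.1

theorem differentiable_inverse_one_sub_pencil {R : Type*} [NormedRing R] [NormedAlgebra ℂ R]
    [HasSummableGeomSeries R] {A B : R} (h : ∀ z : ℂ, IsUnit (1 - (A + z • B))) :
    Differentiable ℂ fun z : ℂ => Ring.inverse (1 - (A + z • B)) := by
  intro z
  have h0 : DifferentiableAt ℂ (fun z : ℂ => 1 - (A + z • B)) z := by fun_prop
  exact (differentiableAt_inverse (𝕜 := ℂ) (h z)).comp z h0

namespace VolterraAdmissible

variable {ρ : ℝ → ℝ} {m m₁ m₂ : ℝ → ℂ} {X : ℝ}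

/-- The Volterra operator on bounded continuous functions, frozen outside `[0, X]`. -/
noncomputable def volterraOp (hm : VolterraAdmissible ρ m) (hX : 0 ≤ X) :
    (ℝ →ᵇ ℂ) →L[ℂ] (ℝ →ᵇ ℂ) :=
  LinearMap.mkContinuous
    { toFun := fun f => clampBCF X hX (volterraInt ρ fun y => m y * f y)
        (hm.mul f.continuous.continuousOn).continuousOn_volterraInt
      map_add' := by
        intro f g
        ext x
        simp only [clampBCF_apply, BoundedContinuousFunction.add_apply, mul_add]
        exact volterraInt_add (hm.mul f.continuous.continuousOn) (hm.mul g.continuous.continuousOn)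
          (clampTo_nonneg X x)
      map_smul' := by
        intro c f
        ext x
        simp only [clampBCF_apply, BoundedContinuousFunction.smul_apply, RingHom.id_apply,
          smul_eq_mul]
        rw [← volterraInt_const_mul]
        congr 1
        ext y
        ring }
    (volterraWeight ρ m X) (by
      intro f
      refine (BoundedContinuousFunction.norm_le
        (mul_nonneg (hm.weight_nonneg hX) (norm_nonneg f))).2 fun x => ?_
      have := hm.norm_volterraInt_mul_le (n := 0) f.continuous.continuousOn (norm_nonneg f)
        (clampTo_nonneg X x) (by simpa using fun y _ _ => f.norm_coe_le_norm y)
      simp only [zero_add, pow_one, Nat.cast_zero, div_one] at this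
      refine this.trans ?_
      rw [mul_comm]
      exact mul_le_mul_of_nonneg_right (hm.weight_mono (clampTo_nonneg X x) hX (clampTo_le hX x))
        (norm_nonneg f))

theorem volterraOp_apply (hm : VolterraAdmissible ρ m) (hX : 0 ≤ X) (f : ℝ →ᵇ ℂ) (x : ℝ) :
    hm.volterraOp hX f x = volterraInt ρ (fun y => m y * f y) (clampTo X x) := rfl

/-- The bound is kept pointwise in x, because the induction integrates the nth power of the weight
up to x; a bound by the supremum norm alone would not produce the factorial. -/
theorem norm_volterraOp_pow_apply_le (hm : VolterraAdmissible ρ m) (hX : 0 ≤ X) (n : ℕ)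
    (f : ℝ →ᵇ ℂ) (x : ℝ) :
    ‖(hm.volterraOp hX ^ n) f x‖ ≤
      ‖f‖ / n.factorial * volterraWeight ρ m (clampTo X x) ^ n := by
  induction n generalizing x with
  | zero => simpa using f.norm_coe_le_norm x
  | succ n ih =>
    rw [pow_succ', mul_apply_eq_comp, volterraOp_apply]
    refine (hm.norm_volterraInt_mul_le (C := ‖f‖ / n.factorial) (n := n)
      (BoundedContinuousFunction.continuous _).continuousOn (by positivity)
      (clampTo_nonneg X x) fun y hy => ?_).trans (le_of_eq ?_)
    · have := ih y
      rwa [clampTo_of_mem ⟨hy.1, hy.2.trans (clampTo_le hX x)⟩] at this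
    · rw [Nat.factorial_succ]
      push_cast
      field_simp

theorem isUnit_one_sub_volterraOp (hm : VolterraAdmissible ρ m) (hX : 0 ≤ X) :
    IsUnit (1 - hm.volterraOp hX) := by
  set T := hm.volterraOp hX
  have hlim := FloorSemiring.tendsto_pow_div_factorial_atTop (volterraWeight ρ m X)
  obtain ⟨n, hn⟩ := (hlim.eventually (gt_mem_nhds one_pos)).exists
  have hnorm : ‖T ^ n‖ < 1 := by
    refine lt_of_le_of_lt (ContinuousLinearMap.opNorm_le_bound _ ?_ fun f => ?_) hn
    · exact div_nonneg (pow_nonneg (hm.weight_nonneg hX) _) (by positivity)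
    · refine (BoundedContinuousFunction.norm_le (mul_nonneg (div_nonneg
        (pow_nonneg (hm.weight_nonneg hX) _) (by positivity)) (norm_nonneg f))).2 fun x => ?_
      refine (hm.norm_volterraOp_pow_apply_le hX n f x).trans ?_
      rw [div_mul_eq_mul_div, mul_comm, ← div_mul_eq_mul_div]
      have h1 := hm.weight_mono (clampTo_nonneg X x) hX (clampTo_le hX x)
      have h2 := hm.weight_nonneg (clampTo_nonneg X x)
      gcongr
  exact isUnit_one_sub_of_norm_pow_lt_one (R := (ℝ →ᵇ ℂ) →L[ℂ] (ℝ →ᵇ ℂ)) hnorm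

theorem pencil (h₁ : VolterraAdmissible ρ m₁) (h₂ : VolterraAdmissible ρ m₂) (z : ℂ) :
    VolterraAdmissible ρ (fun y => m₁ y + z * m₂ y) := h₁.add (h₂.const_mul z)

theorem volterraOp_pencil (h₁ : VolterraAdmissible ρ m₁) (h₂ : VolterraAdmissible ρ m₂) (z : ℂ)
    (hX : 0 ≤ X) :
    (h₁.pencil h₂ z).volterraOp hX = h₁.volterraOp hX + z • h₂.volterraOp hX := by
  ext f x
  simp only [_root_.add_apply, _root_.smul_apply,
    BoundedContinuousFunction.add_apply, BoundedContinuousFunction.smul_apply, volterraOp_apply,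
    smul_eq_mul]
  have hf := f.continuous.continuousOn (s := Ici (0 : ℝ))
  rw [← volterraInt_const_mul, ← volterraInt_add (h₁.mul hf) ((h₂.mul hf).const_mul z)
    (clampTo_nonneg X x)]
  congr 1
  ext y
  ring

/-- The solution of the Volterra equation on `[0, X]`. -/
noncomputable def pencilSol (h₁ : VolterraAdmissible ρ m₁) (h₂ : VolterraAdmissible ρ m₂)
    (hX : 0 ≤ X) (g : ℝ → ℂ) (hg : ContinuousOn g (Ici 0)) (z : ℂ) : ℝ →ᵇ ℂ :=
  Ring.inverse (1 - (h₁.pencil h₂ z).volterraOp hX) (clampBCF X hX g hg)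

section Pencil

variable (h₁ : VolterraAdmissible ρ m₁) (h₂ : VolterraAdmissible ρ m₂) {g : ℝ → ℂ}
  (hg : ContinuousOn g (Ici 0))

theorem differentiable_pencilSol (hX : 0 ≤ X) : Differentiable ℂ (h₁.pencilSol h₂ hX g hg) := by
  intro z
  have h : Differentiable ℂ fun z : ℂ =>
      Ring.inverse (1 - (h₁.volterraOp hX + z • h₂.volterraOp hX)) :=
    differentiable_inverse_one_sub_pencil (R := (ℝ →ᵇ ℂ) →L[ℂ] (ℝ →ᵇ ℂ)) fun z => by
      rw [← volterraOp_pencil]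
      exact (h₁.pencil h₂ z).isUnit_one_sub_volterraOp hX
  have e : h₁.pencilSol h₂ hX g hg = fun z =>
      (Ring.inverse (1 - (h₁.volterraOp hX + z • h₂.volterraOp hX)) :
        (ℝ →ᵇ ℂ) →L[ℂ] (ℝ →ᵇ ℂ)) (clampBCF X hX g hg) := by
    funext z
    rw [pencilSol, volterraOp_pencil h₁ h₂]
  rw [e]
  exact (h z).clm_apply (differentiableAt_const _)

theorem pencilSol_eq (hX : 0 ≤ X) (z : ℂ) (x : ℝ) :
    h₁.pencilSol h₂ hX g hg z x = g (clampTo X x) +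
      volterraInt ρ (fun y => (m₁ y + z * m₂ y) * h₁.pencilSol h₂ hX g hg z y) (clampTo X x) := by
  have h := Ring.mul_inverse_cancel _ ((h₁.pencil h₂ z).isUnit_one_sub_volterraOp hX)
  have h' := congrArg (fun A : (ℝ →ᵇ ℂ) →L[ℂ] (ℝ →ᵇ ℂ) => A (clampBCF X hX g hg) x) h
  simp only [mul_apply_eq_comp, _root_.sub_apply,
    one_apply_eq_self, BoundedContinuousFunction.sub_apply, clampBCF_apply,
    volterraOp_apply] at h'
  rw [← h']
  unfold pencilSol
  ring

theorem pencilSol_unique (hX : 0 ≤ X) (z : ℂ) (f : ℝ →ᵇ ℂ)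
    (hf : ∀ x, f x = g (clampTo X x) +
      volterraInt ρ (fun y => (m₁ y + z * m₂ y) * f y) (clampTo X x)) :
    f = h₁.pencilSol h₂ hX g hg z := by
  have h := Ring.inverse_mul_cancel _ ((h₁.pencil h₂ z).isUnit_one_sub_volterraOp hX)
  have h' := congrArg (fun A : (ℝ →ᵇ ℂ) →L[ℂ] (ℝ →ᵇ ℂ) => A f) h
  simp only [mul_apply_eq_comp, one_apply_eq_self] at h'
  rw [← h']
  unfold pencilSol
  congr 1
  ext x
  simp only [_root_.sub_apply, one_apply_eq_self,
    BoundedContinuousFunction.sub_apply, clampBCF_apply, volterraOp_apply]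
  rw [hf x]
  ring

/-- The Volterra equation at x only sees values on [0, x]. Hence the solution on the larger
interval, frozen beyond X, solves the equation on the smaller one, and uniqueness identifies the
two. -/
theorem pencilSol_eq_of_le {Y : ℝ} (hX : 0 ≤ X) (hXY : X ≤ Y) (z : ℂ) {x : ℝ}
    (hx : x ∈ Icc 0 X) :
    h₁.pencilSol h₂ hX g hg z x = h₁.pencilSol h₂ (hX.trans hXY) g hg z x := by
  have := h₁.pencilSol_unique h₂ hg hX z (clampBCF X hX (h₁.pencilSol h₂ (hX.trans hXY) g hg z)
    (BoundedContinuousFunction.continuous _).continuousOn) fun y => by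
    rw [clampBCF_apply, pencilSol_eq, clampTo_clampTo hX hXY]
    congr 1
    refine volterraInt_congr (clampTo_nonneg _ _) fun t ht => ?_
    rw [clampBCF_apply, clampTo_of_mem ⟨ht.1.le, ht.2.trans (clampTo_le hX y)⟩]
  rw [← this, clampBCF_apply, clampTo_of_mem hx]

/-- Solvability of a pencil of Volterra equations on `[0, ∞)`, with entire dependence on the
parameter. -/
theorem exists_solution (h₁ : VolterraAdmissible ρ m₁) (h₂ : VolterraAdmissible ρ m₂)
    (hg : ContinuousOn g (Ici 0)) :
    ∃ U : ℂ → ℝ → ℂ, ContinuousOn (Function.uncurry U) (univ ×ˢ Ici (0 : ℝ)) ∧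
      (∀ x, 0 ≤ x → Differentiable ℂ fun z => U z x) ∧
      ∀ z x, 0 ≤ x → U z x = g x + volterraInt ρ (fun y => (m₁ y + z * m₂ y) * U z y) x := by
  have hpos : ∀ x : ℝ, 0 ≤ max x 0 + 1 := fun x => by positivity
  -- The interval depends on the evaluation point; `key` replaces it by any interval [0, X]
  -- containing the point, so that X may be held fixed locally.
  refine ⟨fun z x => h₁.pencilSol h₂ (hpos x) g hg z x, ?_, ?_, ?_⟩
  all_goals
    have key : ∀ (X : ℝ) (hX : 0 ≤ X) (z : ℂ) (x : ℝ), x ∈ Icc 0 X →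
        h₁.pencilSol h₂ (hpos x) g hg z x = h₁.pencilSol h₂ hX g hg z x := by
      intro X hX z x hx
      have hx' : x ∈ Icc 0 (max x 0 + 1) := ⟨hx.1, by linarith [le_max_left x 0]⟩
      rcases le_total (max x 0 + 1) X with h | h
      · exact h₁.pencilSol_eq_of_le h₂ hg (hpos x) h z hx'
      · exact (h₁.pencilSol_eq_of_le h₂ hg hX h z hx).symm
  · rintro ⟨z, x⟩ ⟨-, hx⟩
    have hx0 : (0 : ℝ) ≤ x := hx
    have hX : (0 : ℝ) ≤ x + 1 := by linarith
    -- With X fixed, the solution is continuous in z for the supremum norm, so joint continuity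
    -- follows from joint continuity of evaluation.
    have hc : Continuous fun w : ℂ × ℝ => h₁.pencilSol h₂ hX g hg w.1 w.2 :=
      continuous_eval.comp
        (((h₁.differentiable_pencilSol h₂ hg hX).continuous.comp continuous_fst).prodMk
          continuous_snd)
    refine (hc.continuousWithinAt).congr_of_eventuallyEq ?_ (key _ hX z x ⟨hx0, by linarith⟩)
    have : univ ×ˢ Iio (x + 1) ∈ 𝓝 (z, x) :=
      prod_mem_nhds univ_mem (Iio_mem_nhds (by linarith))
    filter_upwards [self_mem_nhdsWithin, mem_nhdsWithin_of_mem_nhds this] with w hw hw'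
    exact key _ hX w.1 w.2 ⟨hw.2, hw'.2.le⟩
  · intro x hx z
    have h := h₁.differentiable_pencilSol h₂ hg (hpos x) z
    exact (BoundedContinuousFunction.evalCLM ℂ x).differentiableAt.comp z h
  · intro z x hx
    have hx' : x ∈ Icc 0 (max x 0 + 1) := ⟨hx, by linarith [le_max_left x 0]⟩
    simp only
    rw [pencilSol_eq, clampTo_of_mem hx']
    congr 1
    refine volterraInt_congr hx fun y hy => ?_
    rw [key (max x 0 + 1) (hpos x) z y ⟨hy.1.le, hy.2.trans hx'.2⟩]

end Pencil

end VolterraAdmissible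

/-! ### The regular solution -/

theorem IntervalIntegrable.of_unit_of_continuousOn {E : Type*} [NormedAddCommGroup E]
    {F : ℝ → E} (h : IntervalIntegrable F volume 0 1)
    (hF : ∀ X : ℝ, 0 < X → IntervalIntegrable F volume 1 X) {X : ℝ} (hX : 0 < X) :
    IntervalIntegrable F volume 0 X := h.trans (hF X hX)

theorem intervalIntegrable_one_of_continuousOn {E : Type*} [NormedAddCommGroup E] {F : ℝ → E}
    (hF : ContinuousOn F (Ioi 0)) (X : ℝ) (hX : 0 < X) : IntervalIntegrable F volume 1 X :=
  (hF.mono fun _ hy => lt_of_lt_of_le (lt_min one_pos hX) hy.1).intervalIntegrable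

theorem continuousOn_ofReal_rpow (a : ℝ) :
    ContinuousOn (fun x : ℝ => ((x ^ a : ℝ) : ℂ)) (Ioi 0) :=
  Complex.continuous_ofReal.comp_continuousOn (continuousOn_rpow_const_Ioi a)

/-- The inner integral is O(s^(e+1)), so near 0 the weighted integrand is O(s^(e+1-κ)), integrable
precisely because κ < e + 2. Away from 0 continuity suffices. -/
theorem VolterraAdmissible.of_rpow_bound {κ e C : ℝ} {F : ℝ → ℂ} (hF : ContinuousOn F (Ioi 0))
    (hb : ∀ y ∈ Ioc (0 : ℝ) 1, ‖F y‖ ≤ C * y ^ e) (he : 0 ≤ e) (hκ : κ < e + 2) :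
    VolterraAdmissible (fun s => s ^ (-κ)) F := by
  have hC : 0 ≤ C := by
    have := (norm_nonneg _).trans (hb 1 ⟨one_pos, le_rfl⟩)
    simpa using this
  have hFi : ∀ X : ℝ, 0 < X → IntervalIntegrable F volume 0 X := by
    intro X hX
    refine IntervalIntegrable.of_unit_of_continuousOn ?_
      (intervalIntegrable_one_of_continuousOn hF) hX
    exact IntervalIntegrable.of_continuousOn_of_le one_pos hF
      ((intervalIntegral.intervalIntegrable_rpow' (by linarith)).const_mul C) hb
  have hc := continuousOn_rpow_const_Ioi (-κ)
  have h0 : ∀ s : ℝ, 0 < s → 0 ≤ s ^ (-κ) := fun s hs => Real.rpow_nonneg hs.le _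
  refine ⟨hc, h0, hFi, fun X hX => ?_⟩
  have hcW : ContinuousOn (fun s => s ^ (-κ) * ∫ y in (0 : ℝ)..s, ‖F y‖) (Ioi 0) :=
    hc.mul (VolterraAdmissible.continuousOn_inner fun X hX => (hFi X hX).norm)
  refine IntervalIntegrable.of_unit_of_continuousOn ?_
    (intervalIntegrable_one_of_continuousOn hcW) hX
  refine IntervalIntegrable.of_continuousOn_of_le one_pos hcW
    ((intervalIntegral.intervalIntegrable_rpow' (r := e + 1 - κ) (by linarith)).const_mul C)
    fun s hs => ?_
  have hs0 := Real.rpow_nonneg hs.1.le e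
  have hI : ‖∫ y in (0 : ℝ)..s, ‖F y‖‖ ≤ C * s ^ e * |s - 0| := by
    refine intervalIntegral.norm_integral_le_of_norm_le_const fun y hy => ?_
    rw [uIoc_of_le hs.1.le] at hy
    rw [norm_norm]
    refine (hb y ⟨hy.1, hy.2.trans hs.2⟩).trans ?_
    exact mul_le_mul_of_nonneg_left (Real.rpow_le_rpow hy.1.le hy.2 he) hC
  rw [sub_zero, abs_of_pos hs.1] at hI
  rw [norm_mul, Real.norm_of_nonneg (h0 s hs.1)]
  calc s ^ (-κ) * ‖∫ y in (0 : ℝ)..s, ‖F y‖‖ ≤ s ^ (-κ) * (C * s ^ e * s) := by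
        gcongr
        exact h0 s hs.1
    _ = C * s ^ (e + 1 - κ) := by
        rw [show e + 1 - κ = -κ + (e + 1) by ring, Real.rpow_add hs.1, Real.rpow_add_one hs.1.ne']
        ring

theorem ofReal_rpow_mul_potential_norm {κ y : ℝ} (q : ℝ → ℝ) (hy : 0 < y) :
    ‖((y ^ κ * q y : ℝ) : ℂ)‖ = y ^ (κ - 1) * |y * q y| := by
  rw [Complex.norm_real, norm_mul, Real.norm_of_nonneg (Real.rpow_nonneg hy.le _),
    Real.norm_eq_abs, abs_mul, abs_of_pos hy, Real.rpow_sub_one hy.ne']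
  field_simp

/-- Near 0 the weighted integrand is exactly the Hardy transform of |yq|, whose integrability is
`hD`. On compact subsets of (0, ∞) local integrability of q is enough. -/
theorem VolterraAdmissible.potential {κ : ℝ} {q : ℝ → ℝ} (hκ : 1 ≤ κ)
    (hq : LocallyIntegrableOn q (Ioi (0 : ℝ)) volume)
    (hi : IntegrableOn (fun y => y * q y) (Ioo 0 1))
    (hD : IntegrableOn (fun x => x ^ (-κ) * ∫ y in (0 : ℝ)..x, y ^ (κ - 1) * |y * q y|)
      (Ioo 0 1)) :
    VolterraAdmissible (fun s => s ^ (-κ)) (fun y => ((y ^ κ * q y : ℝ) : ℂ)) := by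
  have hqX : ∀ X : ℝ, 0 < X → IntervalIntegrable q volume 1 X := by
    intro X hX
    rw [intervalIntegrable_iff']
    exact hq.integrableOn_compact_subset (fun y hy => lt_of_lt_of_le (lt_min one_pos hX) hy.1)
      isCompact_uIcc
  have hreal : ∀ X : ℝ, 0 < X → IntervalIntegrable (fun y => y ^ κ * q y) volume 0 X := by
    intro X hX
    refine IntervalIntegrable.of_unit_of_continuousOn ?_ (fun X hX => ?_) hX
    · have h1 : IntervalIntegrable (fun y => y * q y) volume 0 1 := by
        rw [intervalIntegrable_iff_integrableOn_Ioo_of_le zero_le_one]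
        exact hi
      have h2 := h1.continuousOn_mul (f := fun y : ℝ => y * q y) (g := fun y : ℝ => y ^ (κ - 1))
        (fun y _ => (Real.continuousAt_rpow_const y _
          (Or.inr (by linarith))).continuousWithinAt)
      refine h2.congr fun y hy => ?_
      rw [uIoc_of_le zero_le_one] at hy
      rw [Real.rpow_sub_one hy.1.ne']
      have := hy.1.ne'
      field_simp
    · exact (hqX X hX).continuousOn_mul ((continuousOn_rpow_const_Ioi κ).mono
        fun y hy => lt_of_lt_of_le (lt_min one_pos hX) hy.1)
  have hF : ∀ X : ℝ, 0 < X →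
      IntervalIntegrable (fun y => ((y ^ κ * q y : ℝ) : ℂ)) volume 0 X :=
    fun X hX => ⟨(hreal X hX).1.ofReal, (hreal X hX).2.ofReal⟩
  refine ⟨continuousOn_rpow_const_Ioi _, fun x hx => Real.rpow_nonneg hx.le _, hF, fun X hX => ?_⟩
  refine IntervalIntegrable.of_unit_of_continuousOn ?_ (intervalIntegrable_one_of_continuousOn
    ((continuousOn_rpow_const_Ioi _).mul
    (VolterraAdmissible.continuousOn_inner fun X hX => (hF X hX).norm))) hX
  rw [intervalIntegrable_iff_integrableOn_Ioo_of_le zero_le_one]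
  refine hD.congr_fun (fun s hs => ?_) measurableSet_Ioo
  simp only
  congr 1
  refine intervalIntegral.integral_congr_ae (Eventually.of_forall fun y hy => ?_)
  rw [uIoc_of_le hs.1.le] at hy
  exact (ofReal_rpow_mul_potential_norm q hy.1).symm

theorem hasDerivAt_ofReal_rpow (a : ℝ) {x : ℝ} (hx : 0 < x) :
    HasDerivAt (fun x : ℝ => ((x ^ a : ℝ) : ℂ)) ((a * x ^ (a - 1) : ℝ) : ℂ) x :=
  (Real.hasDerivAt_rpow_const (Or.inl hx.ne')).ofReal_comp

theorem hasLocACDeriv_ofReal_rpow (a : ℝ) :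
    HasLocACDeriv (fun x : ℝ => ((x ^ a : ℝ) : ℂ)) (fun x => ((a * x ^ (a - 1) : ℝ) : ℂ)) := by
  refine HasLocACDeriv.of_hasDerivAt (fun x hx => hasDerivAt_ofReal_rpow a hx) ?_
  exact Complex.continuous_ofReal.comp_continuousOn
    (continuousOn_const.mul (continuousOn_rpow_const_Ioi _))

/-- Solutions of the Volterra equation yield solutions of the differential equation. -/
theorem VolterraAdmissible.solvesBessel {l : ℝ} {q : ℝ → ℝ} {z c : ℂ} {f U F : ℝ → ℂ}
    (hF : VolterraAdmissible (fun s => s ^ (-(2 * l + 2))) F)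
    (hU : ∀ x, 0 ≤ x → U x = c + volterraInt (fun s => s ^ (-(2 * l + 2))) F x)
    (hf : ∀ y, 0 < y → F y = ((y ^ (2 * l + 2) * q y : ℝ) : ℂ) * U y
      - z * ((y ^ (2 * l + 2) : ℝ) : ℂ) * U y - ((y ^ (l + 1) : ℝ) : ℂ) * f y) :
    SolvesBessel l q z f (fun x => ((x ^ (l + 1) : ℝ) : ℂ) * U x)
      (fun x => (((l + 1) * x ^ l : ℝ) : ℂ) * U x +
        ((x ^ (-l - 1) : ℝ) : ℂ) * ∫ y in (0 : ℝ)..x, F y) := by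
  have hUd : ∀ x, 0 < x → HasDerivAt U
      (((x ^ (-(2 * l + 2)) : ℝ) : ℂ) * ∫ y in (0 : ℝ)..x, F y) x := by
    intro x hx
    refine ((hF.hasDerivAt_volterraInt hx).const_add c).congr_of_eventuallyEq ?_
    filter_upwards [Ioi_mem_nhds hx] with y hy using hU y (le_of_lt hy)
  have hpow : ∀ x : ℝ, 0 < x → x ^ (2 * l + 2) = x ^ l * x ^ l * (x * x) := by
    intro x hx
    rw [show (2 : ℝ) * l + 2 = l + l + 1 + 1 by ring, Real.rpow_add_one hx.ne',
      Real.rpow_add_one hx.ne', Real.rpow_add hx]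
    ring
  have hpow' : ∀ x : ℝ, 0 < x → x ^ (-l - 1) = (x ^ l * x)⁻¹ := by
    intro x hx
    rw [show -l - 1 = -(l + 1) by ring, Real.rpow_neg hx.le, Real.rpow_add_one hx.ne']
  constructor
  · intro x hx
    refine ((hasDerivAt_ofReal_rpow (l + 1) hx).mul (hUd x hx)).congr_deriv ?_
    have hA : (x ^ l : ℝ) ≠ 0 := (Real.rpow_pos_of_pos hx l).ne'
    have hA' : ((x ^ l : ℝ) : ℂ) ≠ 0 := by exact_mod_cast hA
    have hx' : (x : ℂ) ≠ 0 := by exact_mod_cast hx.ne'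
    simp only
    rw [Real.rpow_neg hx.le, hpow x hx, hpow' x hx, Real.rpow_add_one hx.ne', add_sub_cancel_right]
    push_cast
    field_simp
  · have hUl : HasLocACDeriv U
        (fun x => ((x ^ (-(2 * l + 2)) : ℝ) : ℂ) * ∫ y in (0 : ℝ)..x, F y) :=
      HasLocACDeriv.of_hasDerivAt hUd ((continuousOn_ofReal_rpow _).mul
        (VolterraAdmissible.continuousOn_inner hF.integrable))
    have h1 := ((hasLocACDeriv_ofReal_rpow l).mul hUl).const_mul ((l + 1 : ℝ) : ℂ)
    -- The derivative is expressed through the primitive G = x^κ U' of F, so only G', known almost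
    -- everywhere, is needed for the second derivative.
    have h2 := (hasLocACDeriv_ofReal_rpow (-l - 1)).mul (HasLocACDeriv.primitive hF.integrable)
    refine (h1.add h2).congr (fun x _ => ?_) fun x hx => ?_
    · push_cast
      ring
    · have hx0 : (0 : ℝ) < x := hx
      have hA : (x ^ l : ℝ) ≠ 0 := (Real.rpow_pos_of_pos hx l).ne'
      have hA' : ((x ^ l : ℝ) : ℂ) ≠ 0 := by exact_mod_cast hA
      have hx' : (x : ℂ) ≠ 0 := by exact_mod_cast hx0.ne'
      simp only
      rw [hf x hx, Real.rpow_neg hx0.le, Real.rpow_sub_one hx0.ne', Real.rpow_sub_one hx0.ne',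
        hpow x hx, hpow' x hx, Real.rpow_add_one hx0.ne']
      push_cast
      field_simp
      ring

/-! ### Absence of zeros at the spectral parameter `I` -/

theorem AbsolutelyContinuousOnInterval.star {f : ℝ → ℂ} {a b : ℝ}
    (hf : AbsolutelyContinuousOnInterval f a b) :
    AbsolutelyContinuousOnInterval (fun x => star (f x)) a b := by
  rw [absolutelyContinuousOnInterval_iff] at hf ⊢
  simpa only [Complex.star_def, Complex.dist_conj_conj] using hf

theorem IntervalIntegrable.star_complex {f : ℝ → ℂ} {a b : ℝ}
    (hf : IntervalIntegrable f volume a b) :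
    IntervalIntegrable (fun x => star (f x)) volume a b :=
  ⟨(Complex.conjCLE : ℂ ≃L[ℝ] ℂ).toContinuousLinearMap.integrable_comp hf.1,
    (Complex.conjCLE : ℂ ≃L[ℝ] ℂ).toContinuousLinearMap.integrable_comp hf.2⟩

/-- The regular solution has no zeros when the spectral parameter is the imaginary unit. -/
theorem VolterraAdmissible.ne_zero_of_eq {κ : ℝ} {q : ℝ → ℝ} {U F : ℝ → ℂ} (hκ : 0 < κ)
    (hF : VolterraAdmissible (fun s => s ^ (-κ)) F)
    (hU : ∀ x, 0 ≤ x → U x = 1 + volterraInt (fun s => s ^ (-κ)) F x)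
    (hf : ∀ y, 0 < y → F y = ((y ^ κ * q y : ℝ) : ℂ) * U y
      - Complex.I * ((y ^ κ : ℝ) : ℂ) * U y) {X : ℝ} (hX : 0 < X) : U X ≠ 0 := by
  intro hUX
  set G : ℝ → ℂ := fun x => ∫ y in (0 : ℝ)..x, F y with hG
  set P : ℝ → ℂ := fun x => ((x ^ (-κ) : ℝ) : ℂ) * G x with hP
  have hUc : ContinuousOn U (Ici 0) :=
    (continuousOn_const.add hF.continuousOn_volterraInt).congr fun x hx => hU x hx
  have hPi : IntervalIntegrable P volume 0 X := hF.integrable_inner hX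
  have hFi := hF.integrable X hX
  have hIcc : uIcc 0 X ⊆ Ici 0 := by
    rw [uIcc_of_le hX.le]
    exact fun _ hy => hy.1
  have hUac : AbsolutelyContinuousOnInterval U 0 X := by
    have hc : AbsolutelyContinuousOnInterval (fun _ : ℝ => (1 : ℂ)) 0 X :=
      (LipschitzWith.const (1 : ℂ)).lipschitzOnWith.absolutelyContinuousOnInterval
    refine (hc.add (hPi.absolutelyContinuousOnInterval_primitive (c := 0) (by simp))).congr_on
      fun x hx => ?_
    rw [hU x (hIcc hx)]
    rfl
  have hGac : AbsolutelyContinuousOnInterval G 0 X :=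
    hFi.absolutelyContinuousOnInterval_primitive (by simp)
  -- Green's identity: with G = x^κ U', the product Ū G vanishes at 0 because G does and at X by the
  -- assumed zero.
  have hac : AbsolutelyContinuousOnInterval (fun x => star (U x) * G x) 0 X := hUac.star.smul hGac
  have hGc : ContinuousOn G (uIcc 0 X) := hGac.continuousOn
  have hr : IntervalIntegrable (fun y => star (P y) * G y + star (U y) * F y) volume 0 X :=
    (hPi.star_complex.mul_continuousOn hGc).add
      (hFi.continuousOn_mul (hUc.mono hIcc).star)
  have hae : ∀ᵐ x, x ∈ uIcc 0 X → HasDerivAt (fun x => star (U x) * G x)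
      (star (P x) * G x + star (U x) * F x) x := by
    have h0 : ∀ᵐ x : ℝ, x ≠ 0 := by simp [ae_iff, measure_singleton]
    filter_upwards [(HasLocACDeriv.primitive hF.integrable).2, h0] with x h1 h0 hx
    have hx0 : 0 < x := lt_of_le_of_ne (hIcc hx) (Ne.symm h0)
    have h2 : HasDerivAt U (P x) x := by
      refine ((hF.hasDerivAt_volterraInt hx0).const_add 1).congr_of_eventuallyEq ?_
      filter_upwards [Ioi_mem_nhds hx0] with y hy using hU y (le_of_lt hy)
    exact h2.star.mul (h1 hx0)
  have hFTC := hac.integral_eq_sub_of_ae_hasDerivAt hr hae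
  have him : ∫ x in (0 : ℝ)..X, (star (P x) * G x + star (U x) * F x).im = 0 := by
    have := Complex.imCLM.intervalIntegral_comp_comm hr
    simp only [Complex.imCLM_apply] at this
    rw [this, hFTC]
    simp [hUX, hG]
  -- The derivative is x^(-κ)|G|² + x^κ (q - i)|U|². As q is real, only the spectral parameter
  -- contributes to the imaginary part, and ∫ x^κ |U|² would have to vanish although U(0) = 1.
  have heq : ∫ x in (0 : ℝ)..X, (star (P x) * G x + star (U x) * F x).im =
      -∫ x in (0 : ℝ)..X, x ^ κ * Complex.normSq (U x) := by
    rw [← intervalIntegral.integral_neg]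
    refine intervalIntegral.integral_congr_ae (Eventually.of_forall fun x hx => ?_)
    rw [uIoc_of_le hX.le] at hx
    rw [hf x hx.1]
    simp only [hP, Complex.star_def, map_mul, Complex.conj_ofReal, Complex.add_im, Complex.mul_im,
      Complex.mul_re, Complex.sub_re, Complex.sub_im, Complex.conj_re, Complex.conj_im,
      Complex.ofReal_re, Complex.ofReal_im, Complex.I_re, Complex.I_im, Complex.normSq_apply]
    ring
  have hpos : 0 < ∫ x in (0 : ℝ)..X, x ^ κ * Complex.normSq (U x) := by
    have hU0 : U 0 = 1 := by rw [hU 0 le_rfl]; simp [volterraInt]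
    have hne : ∀ᶠ x in 𝓝[>] (0 : ℝ), U x ≠ 0 := by
      have := (hUc 0 (mem_Ici.2 le_rfl)).mono Ioi_subset_Ici_self
      exact this.eventually_ne (by rw [hU0]; exact one_ne_zero)
    obtain ⟨c, hc0, hc⟩ := (hne.and (Ioo_mem_nhdsGT hX)).exists
    refine intervalIntegral.integral_pos hX ?_ (fun x hx => mul_nonneg (Real.rpow_nonneg hx.1.le _)
      (Complex.normSq_nonneg _)) ⟨c, ⟨hc.1.le, hc.2.le⟩, mul_pos (Real.rpow_pos_of_pos hc.1 _)
        (Complex.normSq_pos.2 hc0)⟩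
    refine ContinuousOn.mul (fun x _ => (Real.continuousAt_rpow_const x _
      (Or.inr hκ.le)).continuousWithinAt) ?_
    exact Complex.continuous_normSq.comp_continuousOn (hUc.mono fun _ hy => hy.1)
  linarith [heq ▸ him]

/-! ### Reduction of order -/

/-- The solution obtained from a nowhere vanishing solution `φ` by reduction of order. -/
noncomputable def reduceOrder (φ K : ℝ → ℂ) (x : ℝ) : ℂ := φ x * ∫ s in x..1, K s / φ s ^ 2

theorem hasDerivAt_integral_to_one {g : ℝ → ℂ} (hg : ContinuousOn g (Ioi 0)) {x : ℝ} (hx : 0 < x) :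
    HasDerivAt (fun x => ∫ s in x..1, g s) (-g x) x :=
  intervalIntegral.integral_hasDerivAt_left
    (intervalIntegrable_one_of_continuousOn hg x hx).symm
    (hg.stronglyMeasurableAtFilter isOpen_Ioi x hx) (hg.continuousAt (Ioi_mem_nhds hx))

theorem continuousOn_of_forall_hasDerivAt {f f' : ℝ → ℂ} (h : ∀ x, 0 < x → HasDerivAt f (f' x) x) :
    ContinuousOn f (Ioi 0) := fun x hx => (h x hx).continuousAt.continuousWithinAt

/-- For u = φ ∫ₓ¹ K/φ² the Wronskian φu' - φ'u equals -K, and K' = φf is exactly the Wronskian form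
of the inhomogeneous equation. A constant K gives a homogeneous solution. -/
theorem SolvesBessel.reduceOrder {l : ℝ} {q : ℝ → ℝ} {z : ℂ} {φ w K f : ℝ → ℂ}
    (hφ : SolvesBessel l q z (fun _ => 0) φ w) (hne : ∀ x, 0 < x → φ x ≠ 0)
    (hK : ∀ x, 0 < x → HasDerivAt K (φ x * f x) x) (hf : ContinuousOn f (Ioi 0)) :
    SolvesBessel l q z f (reduceOrder φ K)
      (fun x => w x * (∫ s in x..1, K s / φ s ^ 2) + -1 * (K x * (φ x)⁻¹)) := by
  have hφc := hφ.continuousOn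
  have hKc := continuousOn_of_forall_hasDerivAt hK
  have hwc := hφ.2.continuousOn
  have hg : ContinuousOn (fun s => K s / φ s ^ 2) (Ioi 0) :=
    hKc.div (hφc.pow 2) fun x hx => pow_ne_zero 2 (hne x hx)
  have hJ : ∀ x, 0 < x → HasDerivAt (fun x => ∫ s in x..1, K s / φ s ^ 2) (-(K x / φ x ^ 2)) x :=
    fun x hx => hasDerivAt_integral_to_one hg hx
  have hKφ : ∀ x, 0 < x → HasDerivAt (fun x => K x * (φ x)⁻¹)
      (φ x * f x * (φ x)⁻¹ + K x * (-w x / φ x ^ 2)) x := fun x hx =>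
    (hK x hx).mul ((hφ.1 x hx).inv (hne x hx))
  constructor
  · intro x hx
    refine ((hφ.1 x hx).mul (hJ x hx)).congr_deriv ?_
    have := hne x hx
    field_simp
  · have h1 := hφ.2.mul (HasLocACDeriv.of_hasDerivAt hJ hg.neg)
    have h2 := (HasLocACDeriv.of_hasDerivAt hKφ (((hφc.mul hf).mul (hφc.inv₀ hne)).add
      (hKc.mul (hwc.neg.div (hφc.pow 2) fun x hx => pow_ne_zero 2 (hne x hx))))).const_mul (-1)
    refine (h1.add h2).congr (fun _ _ => rfl) fun x hx => ?_
    have := hne x hx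
    simp only [_root_.reduceOrder]
    field_simp
    ring

/-- The integrand is O(s^(β-2l-2)). A factor s^(-1/2) is set aside, with integral at most 2; by `hβ`
the rest is nonincreasing and is bounded by its value at x. This wastes half a power but avoids a
logarithmic case distinction. -/
theorem norm_reduceOrder_le {l c M C β : ℝ} {φ K : ℝ → ℂ} (hc : 0 < c)
    (hlow : ∀ x ∈ Ioc (0 : ℝ) 1, c * x ^ (l + 1) ≤ ‖φ x‖)
    (hup : ∀ x ∈ Ioc (0 : ℝ) 1, ‖φ x‖ ≤ M * x ^ (l + 1))
    (hK : ∀ x ∈ Ioc (0 : ℝ) 1, ‖K x‖ ≤ C * x ^ β) (hβ : β ≤ 2 * l + 3 / 2) :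
    ∀ x ∈ Ioc (0 : ℝ) 1, ‖reduceOrder φ K x‖ ≤ M * (C / c ^ 2 * 2) * x ^ (β - l - 1 / 2) := by
  have hC : 0 ≤ C := by simpa using (norm_nonneg _).trans (hK 1 ⟨one_pos, le_rfl⟩)
  have hM : 0 ≤ M := by simpa using (norm_nonneg _).trans (hup 1 ⟨one_pos, le_rfl⟩)
  intro x hx
  set B := C / c ^ 2 * x ^ (β - 2 * l - 3 / 2) with hB
  have hB0 : 0 ≤ B := by
    have := Real.rpow_nonneg hx.1.le (β - 2 * l - 3 / 2)
    positivity
  have hint : IntervalIntegrable (fun s : ℝ => B * s ^ (-(1 / 2) : ℝ)) volume x 1 := by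
    refine (ContinuousOn.intervalIntegrable ?_).const_mul B
    rw [uIcc_of_le hx.2]
    exact (continuousOn_rpow_const_Ioi _).mono fun y hy => hx.1.trans_le hy.1
  have h1 : ‖∫ s in x..1, K s / φ s ^ 2‖ ≤ ∫ s in x..1, B * s ^ (-(1 / 2) : ℝ) := by
    refine intervalIntegral.norm_integral_le_of_norm_le hx.2 (Eventually.of_forall fun s hs => ?_)
      hint
    have hs0 : 0 < s := hx.1.trans hs.1
    have hs1 : s ∈ Ioc (0 : ℝ) 1 := ⟨hs0, hs.2⟩
    have hp := Real.rpow_pos_of_pos hs0 (l + 1)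
    rw [norm_div, norm_pow]
    calc ‖K s‖ / ‖φ s‖ ^ 2 ≤ C * s ^ β / (c * s ^ (l + 1)) ^ 2 := by
          have := hlow s hs1
          have := hK s hs1
          have := Real.rpow_nonneg hs0.le β
          gcongr
      _ = C / c ^ 2 * (s ^ (β - 2 * l - 3 / 2) * s ^ (-(1 / 2) : ℝ)) := by
          have e : s ^ β = s ^ (β - 2 * l - 3 / 2) * s ^ (-(1 / 2) : ℝ) * (s ^ (l + 1)) ^ 2 := by
            rw [← Real.rpow_natCast, ← Real.rpow_mul hs0.le, ← Real.rpow_add hs0,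
              ← Real.rpow_add hs0]
            congr 1
            push_cast
            ring
          rw [e]
          field_simp
      _ ≤ C / c ^ 2 * (x ^ (β - 2 * l - 3 / 2) * s ^ (-(1 / 2) : ℝ)) := by
          have h := Real.rpow_le_rpow_of_nonpos hx.1 hs.1.le
            (by linarith : β - 2 * l - 3 / 2 ≤ 0)
          have := Real.rpow_nonneg hs0.le (-(1 / 2) : ℝ)
          gcongr
      _ = B * s ^ (-(1 / 2) : ℝ) := by rw [hB]; ring
  have h2 : ∫ s in x..1, B * s ^ (-(1 / 2) : ℝ) ≤ B * 2 := by
    rw [intervalIntegral.integral_const_mul, integral_rpow (Or.inl (by norm_num))]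
    refine mul_le_mul_of_nonneg_left ?_ hB0
    have := Real.rpow_nonneg hx.1.le (1 / 2 : ℝ)
    norm_num
    linarith
  rw [_root_.reduceOrder, norm_mul]
  calc ‖φ x‖ * ‖∫ s in x..1, K s / φ s ^ 2‖ ≤ (M * x ^ (l + 1)) * (B * 2) := by
        have := Real.rpow_nonneg hx.1.le (l + 1)
        gcongr
        · exact hup x hx
        · exact h1.trans h2
    _ = M * (C / c ^ 2 * 2) * (x ^ (l + 1) * x ^ (β - 2 * l - 3 / 2)) := by rw [hB]; ring
    _ = _ := by
        rw [← Real.rpow_add hx.1]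
        congr 2
        ring

/-- The chain of solutions `τ θ₀ = z θ₀`, `τ θₖ₊₁ = z θₖ₊₁ + θₖ` generated from `φ`. -/
noncomputable def besselChain (φ : ℝ → ℂ) : ℕ → ℝ → ℂ
  | 0 => reduceOrder φ fun _ => 1
  | k + 1 => reduceOrder φ fun s => ∫ y in (0 : ℝ)..s, φ y * besselChain φ k y

/-- The right-hand sides of the equations solved by `besselChain`. -/
noncomputable def besselChainRHS (φ : ℝ → ℂ) : ℕ → ℝ → ℂ
  | 0 => fun _ => 0
  | k + 1 => besselChain φ k

/-- Each step multiplies by φ, integrates from 0 and reduces the order; with the lossy bound above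
this gains at least one power of x. The restriction on k keeps the exponent β = (k - 1) + 3/2 of the
inner integral within the range 2l + 3/2 allowed there. -/
theorem besselChain_spec {l c M : ℝ} {q : ℝ → ℝ} {z : ℂ} {φ w : ℝ → ℂ} (hl : -(1 / 2) ≤ l)
    (hφ : SolvesBessel l q z (fun _ => 0) φ w) (hne : ∀ x, 0 < x → φ x ≠ 0) (hc : 0 < c)
    (hlow : ∀ x ∈ Ioc (0 : ℝ) 1, c * x ^ (l + 1) ≤ ‖φ x‖)
    (hup : ∀ x ∈ Ioc (0 : ℝ) 1, ‖φ x‖ ≤ M * x ^ (l + 1)) (k : ℕ) (hk : (k : ℝ) ≤ 2 * l + 1) :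
    (∃ w', SolvesBessel l q z (besselChainRHS φ k) (besselChain φ k) w') ∧
      ∃ C, ∀ x ∈ Ioc (0 : ℝ) 1, ‖besselChain φ k x‖ ≤ C * x ^ ((k : ℝ) - l - 1 / 2) := by
  have hM : 0 ≤ M := by simpa using (norm_nonneg _).trans (hup 1 ⟨one_pos, le_rfl⟩)
  induction k with
  | zero =>
    refine ⟨⟨_, hφ.reduceOrder hne (fun x _ => ?_) continuousOn_const⟩, M * (1 / c ^ 2 * 2),
      fun x hx => (norm_reduceOrder_le (β := 0) (C := 1) hc hlow hup (by simp)
        (by linarith) x hx).trans (le_of_eq ?_)⟩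
    · simpa [besselChainRHS] using hasDerivAt_const x (1 : ℂ)
    · simp
  | succ k ih =>
    have hk' : (k : ℝ) ≤ 2 * l := by push_cast at hk; linarith
    obtain ⟨⟨w', hw'⟩, C, hC⟩ := ih (by linarith)
    have hC0 : 0 ≤ C := by simpa using (norm_nonneg _).trans (hC 1 ⟨one_pos, le_rfl⟩)
    have hcont : ContinuousOn (fun y => φ y * besselChain φ k y) (Ioi 0) :=
      hφ.continuousOn.mul hw'.continuousOn
    have hbd : ∀ y ∈ Ioc (0 : ℝ) 1, ‖φ y * besselChain φ k y‖ ≤ M * C * y ^ ((k : ℝ) + 1 / 2) := by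
      intro y hy
      have e : y ^ ((k : ℝ) + 1 / 2) = y ^ (l + 1) * y ^ ((k : ℝ) - l - 1 / 2) := by
        rw [← Real.rpow_add hy.1]
        congr 1
        ring
      rw [norm_mul, e]
      have h1 := Real.rpow_nonneg hy.1.le (l + 1)
      calc ‖φ y‖ * ‖besselChain φ k y‖
          ≤ (M * y ^ (l + 1)) * (C * y ^ ((k : ℝ) - l - 1 / 2)) := by
            gcongr
            · exact hup y hy
            · exact hC y hy
        _ = _ := by ring
    have hint : ∀ X : ℝ, 0 < X →
        IntervalIntegrable (fun y => φ y * besselChain φ k y) volume 0 X := fun X hX =>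
      IntervalIntegrable.of_unit_of_continuousOn (IntervalIntegrable.of_continuousOn_of_le one_pos
        hcont ((intervalIntegral.intervalIntegrable_rpow'
          (by linarith [(Nat.cast_nonneg k : (0 : ℝ) ≤ k)])).const_mul _) hbd)
        (intervalIntegrable_one_of_continuousOn hcont) hX
    refine ⟨⟨_, hφ.reduceOrder hne (fun x hx =>
      hasDerivAt_primitive_of_continuousOn hx (hint x hx) hcont) hw'.continuousOn⟩,
      M * (M * C / c ^ 2 * 2),
      fun x hx => (norm_reduceOrder_le (β := (k : ℝ) + 3 / 2) (C := M * C) hc hlow hup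
        (fun s hs => ?_) (by linarith) x hx).trans ?_⟩
    · have hI : ‖∫ y in (0 : ℝ)..s, φ y * besselChain φ k y‖ ≤
          M * C * s ^ ((k : ℝ) + 1 / 2) * |s - 0| := by
        refine intervalIntegral.norm_integral_le_of_norm_le_const fun y hy => ?_
        rw [uIoc_of_le hs.1.le] at hy
        refine (hbd y ⟨hy.1, hy.2.trans hs.2⟩).trans ?_
        exact mul_le_mul_of_nonneg_left (Real.rpow_le_rpow hy.1.le hy.2 (by positivity))
          (by positivity)
      rw [sub_zero, abs_of_pos hs.1, mul_assoc, ← Real.rpow_add_one hs.1.ne'] at hI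
      convert hI using 3
      ring
    · have : x ^ ((k : ℝ) + 3 / 2 - l - 1 / 2) ≤ x ^ (((k + 1 : ℕ) : ℝ) - l - 1 / 2) := by
        refine Real.rpow_le_rpow_of_exponent_ge hx.1 hx.2 ?_
        push_cast
        linarith
      gcongr

/-- Partial sums of the Taylor series at `z₀` of a second solution. -/
noncomputable def besselChainSum (φ : ℝ → ℂ) (z₀ z : ℂ) (n : ℕ) (x : ℝ) : ℂ :=
  ∑ k ∈ Finset.range n, (z - z₀) ^ k * besselChain φ k x

/-- Writing τ - z = (τ - z₀) - (z - z₀), the sum telescopes and only the last term survives as a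
defect. -/
theorem solvesBessel_besselChainSum {l : ℝ} {q : ℝ → ℝ} {z₀ : ℂ} {φ : ℝ → ℂ} {n : ℕ}
    (h : ∀ k ≤ n, ∃ w, SolvesBessel l q z₀ (besselChainRHS φ k) (besselChain φ k) w) (z : ℂ) :
    ∃ w, SolvesBessel l q z (fun x => -(z - z₀) ^ (n + 1) * besselChain φ n x)
      (besselChainSum φ z₀ z (n + 1)) w := by
  induction n with
  | zero =>
    obtain ⟨w, hw⟩ := h 0 le_rfl
    have h1 := (hw.change_parameter z).congr_right
      (f₂ := fun x => -(z - z₀) ^ (0 + 1) * besselChain φ 0 x) fun x _ => by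
        simp only [besselChainRHS]
        ring
    have e : besselChainSum φ z₀ z (0 + 1) = besselChain φ 0 := by
      funext x
      simp [besselChainSum]
    exact ⟨w, by rw [e]; exact h1⟩
  | succ n ih =>
    obtain ⟨w₁, h₁⟩ := ih fun k hk => h k (hk.trans n.le_succ)
    obtain ⟨w₂, h₂⟩ := h (n + 1) le_rfl
    have h3 := (h₁.add ((h₂.change_parameter z).const_mul ((z - z₀) ^ (n + 1)))).congr_right
      (f₂ := fun x => -(z - z₀) ^ (n + 1 + 1) * besselChain φ (n + 1) x) fun x _ => by
        simp only [besselChainRHS]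
        ring
    have e : besselChainSum φ z₀ z (n + 1 + 1) =
        fun x => besselChainSum φ z₀ z (n + 1) x + (z - z₀) ^ (n + 1) * besselChain φ (n + 1) x := by
      funext x
      simp [besselChainSum, Finset.sum_range_succ]
    exact ⟨_, by rw [e]; exact h3⟩

/-! ### Behaviour of the second solution at the origin -/

/-- Weighted averages with a divergent weight converge to the limit of the averaged function. -/
theorem tendsto_integral_mul_div_integral {ω : ℝ → ℝ} {g : ℝ → ℂ} {a : ℂ}
    (hω : ContinuousOn ω (Ioi 0)) (hω0 : ∀ x, 0 < x → 0 ≤ ω x) (hg : ContinuousOn g (Ioi 0))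
    (hlim : Tendsto g (𝓝[>] 0) (𝓝 a))
    (hdiv : Tendsto (fun x => ∫ s in x..1, ω s) (𝓝[>] 0) atTop) :
    Tendsto (fun x => (∫ s in x..1, (ω s : ℂ) * g s) / ((∫ s in x..1, ω s : ℝ) : ℂ))
      (𝓝[>] 0) (𝓝 a) := by
  have hωc : ContinuousOn (fun s => (ω s : ℂ)) (Ioi 0) :=
    Complex.continuous_ofReal.comp_continuousOn hω
  have hi : ∀ {f : ℝ → ℂ}, ContinuousOn f (Ioi 0) → ∀ {x y : ℝ}, 0 < x → 0 < y →
      IntervalIntegrable f volume x y := fun hf x y hx hy =>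
    (hf.mono fun _ ht => lt_of_lt_of_le (lt_min hx hy) ht.1).intervalIntegrable
  have hiω : ∀ {x y : ℝ}, 0 < x → 0 < y → IntervalIntegrable ω volume x y := fun hx hy =>
    (hω.mono fun _ ht => lt_of_lt_of_le (lt_min hx hy) ht.1).intervalIntegrable
  rw [Metric.tendsto_nhds]
  intro ε hε
  have hd : ContinuousOn (fun s => (ω s : ℂ) * (g s - a)) (Ioi 0) :=
    hωc.mul (hg.sub continuousOn_const)
  obtain ⟨δ, ⟨hδ0, hδ1⟩, hδ⟩ : ∃ δ ∈ Ioo (0 : ℝ) 1, ∀ s ∈ Ioc 0 δ, ‖g s - a‖ ≤ ε / 2 := by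
    have h1 : ∀ᶠ s in 𝓝[>] (0 : ℝ), ‖g s - a‖ ≤ ε / 2 := by
      filter_upwards [(Metric.tendsto_nhds.1 hlim) (ε / 2) (by positivity)] with s hs
      rw [← dist_eq_norm]
      exact hs.le
    obtain ⟨u, hu0, hu⟩ := mem_nhdsGT_iff_exists_Ioc_subset.1 h1
    have hu0' : (0 : ℝ) < u := hu0
    refine ⟨min u (1 / 2), ⟨by positivity, (min_le_right _ _).trans_lt (by norm_num)⟩, ?_⟩
    exact fun s hs => hu ⟨hs.1, hs.2.trans (min_le_left _ _)⟩
  -- The part over [δ, 1] is a fixed number, eventually negligible against the divergent total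
  -- weight; on (0, δ] the deviation is at most ε/2.
  set M : ℝ := ‖∫ s in δ..1, (ω s : ℂ) * (g s - a)‖ with hM
  filter_upwards [hdiv.eventually_gt_atTop (2 * M / ε), hdiv.eventually_gt_atTop 0,
    Ioo_mem_nhdsGT hδ0] with x hx1 hx2 hx
  have hx0 : 0 < x := hx.1
  set W : ℝ := ∫ s in x..1, ω s with hW
  have hWc : (W : ℂ) ≠ 0 := by exact_mod_cast hx2.ne'
  have e1 : (∫ s in x..1, (ω s : ℂ) * g s) / (W : ℂ) - a =
      (∫ s in x..1, (ω s : ℂ) * (g s - a)) / (W : ℂ) := by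
    have : ∫ s in x..1, (ω s : ℂ) * (g s - a) = (∫ s in x..1, (ω s : ℂ) * g s) - (W : ℂ) * a := by
      simp_rw [mul_sub]
      rw [intervalIntegral.integral_sub
        (hi (f := fun s => (ω s : ℂ) * g s) (hωc.mul hg) hx0 one_pos)
        (hi (f := fun s => (ω s : ℂ) * a) (hωc.mul continuousOn_const) hx0 one_pos),
        intervalIntegral.integral_mul_const, hW,
        intervalIntegral.integral_ofReal]
    rw [this]
    field_simp
  have h2 : ‖∫ s in x..δ, (ω s : ℂ) * (g s - a)‖ ≤ ε / 2 * W := by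
    calc ‖∫ s in x..δ, (ω s : ℂ) * (g s - a)‖ ≤ ∫ s in x..δ, ε / 2 * ω s := by
          refine intervalIntegral.norm_integral_le_of_norm_le hx.2.le (Eventually.of_forall
            fun s hs => ?_) ((hiω hx0 hδ0).const_mul _)
          have hs0 : 0 < s := hx0.trans hs.1
          rw [norm_mul, Complex.norm_real, Real.norm_of_nonneg (hω0 s hs0), mul_comm]
          exact mul_le_mul_of_nonneg_right (hδ s ⟨hs0, hs.2⟩) (hω0 s hs0)
      _ = ε / 2 * ∫ s in x..δ, ω s := intervalIntegral.integral_const_mul _ _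
      _ ≤ ε / 2 * W := by
          refine mul_le_mul_of_nonneg_left ?_ (by positivity)
          rw [hW, ← intervalIntegral.integral_add_adjacent_intervals (hiω hx0 hδ0)
            (hiω hδ0 one_pos)]
          have := intervalIntegral.integral_nonneg (μ := volume) hδ1.le
            fun s hs => hω0 s (hδ0.trans_le hs.1)
          linarith
  rw [dist_eq_norm, e1, norm_div, Complex.norm_real, Real.norm_of_nonneg hx2.le, div_lt_iff₀ hx2,
    ← intervalIntegral.integral_add_adjacent_intervals (hi hd hx0 hδ0) (hi hd hδ0 one_pos)]
  have h3 : M < ε / 2 * W := by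
    rw [div_lt_iff₀ hε] at hx1
    linarith
  calc _ ≤ ‖∫ s in x..δ, (ω s : ℂ) * (g s - a)‖ + M := norm_add_le _ _
    _ < ε * W := by linarith

/-- The factor by which the second solution is multiplied to normalize it at the origin. -/
noncomputable def besselScale (l x : ℝ) : ℝ :=
  if l = -(1 / 2) then (-Real.log x * x ^ (1 / 2 : ℝ))⁻¹ else (2 * l + 1) * x ^ l

/-- The integral of the weight `x ^ (-2 l - 2)` from `x` to `1`. -/
noncomputable def besselWeight (l x : ℝ) : ℝ := ∫ s in x..1, s ^ (-(2 * l + 2))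

theorem besselWeight_of_eq {l x : ℝ} (hl : l = -(1 / 2)) (hx : 0 < x) :
    besselWeight l x = -Real.log x := by
  unfold besselWeight
  subst hl
  simp_rw [show -(2 * -(1 / 2 : ℝ) + 2) = -1 by norm_num, Real.rpow_neg_one]
  rw [integral_inv_of_pos hx one_pos, one_div, Real.log_inv]

theorem besselWeight_of_lt {l x : ℝ} (hl : -(1 / 2) < l) (hx : 0 < x) :
    besselWeight l x = (x ^ (-(2 * l + 1)) - 1) / (2 * l + 1) := by
  unfold besselWeight
  rw [integral_rpow (Or.inr ⟨by linarith, fun h => ?_⟩)]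
  · rw [show -(2 * l + 2) + 1 = -(2 * l + 1) by ring, Real.one_rpow, div_neg, ← neg_div, neg_sub]
  · exact absurd h.1 (not_le.2 (lt_min hx one_pos))

theorem tendsto_neg_log_nhdsGT_zero : Tendsto (fun x => -Real.log x) (𝓝[>] 0) atTop :=
  tendsto_neg_atBot_atTop.comp Real.tendsto_log_nhdsGT_zero

theorem tendsto_rpow_nhdsGT_zero {a : ℝ} (ha : 0 < a) :
    Tendsto (fun x : ℝ => x ^ a) (𝓝[>] 0) (𝓝 0) := by
  have := (Real.continuousAt_rpow_const 0 a (Or.inr ha.le)).tendsto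
  rw [Real.zero_rpow ha.ne'] at this
  exact this.mono_left nhdsWithin_le_nhds

theorem tendsto_besselWeight {l : ℝ} (hl : -(1 / 2) ≤ l) :
    Tendsto (besselWeight l) (𝓝[>] 0) atTop := by
  rcases hl.eq_or_lt with h | h
  · refine tendsto_neg_log_nhdsGT_zero.congr' ?_
    filter_upwards [self_mem_nhdsWithin] with x hx using (besselWeight_of_eq h.symm hx).symm
  · have h0 : 0 < 2 * l + 1 := by linarith
    have h1 : Tendsto (fun x : ℝ => x ^ (-(2 * l + 1))) (𝓝[>] 0) atTop :=
      tendsto_rpow_neg_nhdsGT_zero (by linarith)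
    refine Tendsto.congr' ?_ ((tendsto_atTop_add_const_right _ (-1) h1).atTop_div_const h0)
    filter_upwards [self_mem_nhdsWithin] with x hx
    rw [besselWeight_of_lt h hx, sub_eq_add_neg]

theorem tendsto_besselScale_mul_rpow {l : ℝ} (hl : -(1 / 2) ≤ l) :
    Tendsto (fun x => besselScale l x * x ^ (l + 1)) (𝓝[>] 0) (𝓝 0) := by
  rcases hl.eq_or_lt with h | h
  · refine Tendsto.congr' ?_ tendsto_neg_log_nhdsGT_zero.inv_tendsto_atTop
    filter_upwards [self_mem_nhdsWithin] with x hx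
    have hx0 : (0 : ℝ) < x := hx
    have := (Real.rpow_pos_of_pos hx0 (1 / 2 : ℝ)).ne'
    rw [besselScale, if_pos h.symm, ← h, mul_inv,
      show -(1 / 2 : ℝ) + 1 = 1 / 2 by norm_num, mul_assoc, inv_mul_cancel₀ this, mul_one]
    rfl
  · have := (tendsto_rpow_nhdsGT_zero (by linarith : 0 < 2 * l + 1)).const_mul (2 * l + 1)
    rw [mul_zero] at this
    refine this.congr' ?_
    filter_upwards [self_mem_nhdsWithin] with x hx
    have hx0 : (0 : ℝ) < x := hx
    rw [besselScale, if_neg h.ne', mul_assoc, ← Real.rpow_add hx0]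
    ring_nf

theorem tendsto_besselScale_mul_weight {l : ℝ} (hl : -(1 / 2) ≤ l) :
    Tendsto (fun x => besselScale l x * x ^ (l + 1) * besselWeight l x) (𝓝[>] 0) (𝓝 1) := by
  rcases hl.eq_or_lt with h | h
  · refine tendsto_const_nhds.congr' ?_
    filter_upwards [Ioo_mem_nhdsGT one_pos] with x hx
    have h1 := (Real.rpow_pos_of_pos hx.1 (1 / 2 : ℝ)).ne'
    have h2 := (Real.log_neg hx.1 hx.2).ne
    rw [besselWeight_of_eq h.symm hx.1, besselScale, if_pos h.symm, ← h,
      show -(1 / 2 : ℝ) + 1 = 1 / 2 by norm_num]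
    field_simp
  · have h0 : 0 < 2 * l + 1 := by linarith
    have := (tendsto_rpow_nhdsGT_zero h0).const_sub 1
    rw [sub_zero] at this
    refine this.congr' ?_
    filter_upwards [self_mem_nhdsWithin] with x hx
    have hx0 : (0 : ℝ) < x := hx
    rw [besselWeight_of_lt h hx0, besselScale, if_neg h.ne', mul_assoc (2 * l + 1),
      ← Real.rpow_add hx0, show l + (l + 1) = 2 * l + 1 by ring, Real.rpow_neg hx0.le]
    have := (Real.rpow_pos_of_pos hx0 (2 * l + 1)).ne'
    field_simp

theorem continuousOn_besselScale_Ioo (l : ℝ) : ContinuousOn (besselScale l) (Ioo 0 1) := by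
  unfold besselScale
  split_ifs with h
  · refine ContinuousOn.inv₀ ((Real.continuousOn_log.mono fun x hx => ne_of_gt hx.1).neg.mul
      ((continuousOn_rpow_const_Ioi _).mono Ioo_subset_Ioi_self)) fun x hx => ?_
    exact mul_ne_zero (neg_ne_zero.2 (Real.log_neg hx.1 hx.2).ne)
      (Real.rpow_pos_of_pos hx.1 _).ne'
  · exact continuousOn_const.mul ((continuousOn_rpow_const_Ioi _).mono Ioo_subset_Ioi_self)

theorem continuousOn_besselScale_Ioi {l : ℝ} (hl : -(1 / 2) < l) :
    ContinuousOn (besselScale l) (Ioi 0) := by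
  have e : besselScale l = fun x => (2 * l + 1) * x ^ l := funext fun x => if_neg hl.ne'
  rw [e]
  exact continuousOn_const.mul (continuousOn_rpow_const_Ioi _)

/-- The normalized leading term of the second solution tends to one. -/
theorem tendsto_besselScale_mul_reduceOrder {l : ℝ} {φ U : ℝ → ℂ} (hl : -(1 / 2) ≤ l)
    (hφ : ∀ x, 0 < x → φ x = ((x ^ (l + 1) : ℝ) : ℂ) * U x) (hU : ContinuousOn U (Ici 0))
    (hU0 : U 0 = 1) (hne : ∀ x, 0 < x → U x ≠ 0) :
    Tendsto (fun x => (besselScale l x : ℂ) * reduceOrder φ (fun _ => 1) x) (𝓝[>] 0) (𝓝 1) := by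
  have hUlim : Tendsto U (𝓝[>] 0) (𝓝 1) := by
    rw [← hU0]
    exact ((hU 0 (mem_Ici.2 le_rfl)).mono Ioi_subset_Ici_self).tendsto
  have hg : ContinuousOn (fun s => (U s ^ 2)⁻¹) (Ioi 0) :=
    ((hU.mono Ioi_subset_Ici_self).pow 2).inv₀ fun x hx => pow_ne_zero 2 (hne x hx)
  have hglim : Tendsto (fun s => (U s ^ 2)⁻¹) (𝓝[>] 0) (𝓝 1) := by
    simpa using (hUlim.pow 2).inv₀ (by simp)
  have h1 := tendsto_integral_mul_div_integral (continuousOn_rpow_const_Ioi (-(2 * l + 2)))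
    (fun x hx => Real.rpow_nonneg hx.le _) hg hglim (tendsto_besselWeight hl)
  have h2 : Tendsto (fun x => ((besselScale l x * x ^ (l + 1) * besselWeight l x : ℝ) : ℂ))
      (𝓝[>] 0) (𝓝 1) := by
    have := (Complex.continuous_ofReal.tendsto 1).comp (tendsto_besselScale_mul_weight hl)
    rw [Complex.ofReal_one] at this
    exact this
  have h3 := (h2.mul hUlim).mul h1
  rw [mul_one, mul_one] at h3
  refine h3.congr' ?_
  filter_upwards [self_mem_nhdsWithin, (tendsto_besselWeight hl).eventually_gt_atTop 0] with x hx hW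
  have hx0 : (0 : ℝ) < x := hx
  have hWc : (besselWeight l x : ℂ) ≠ 0 := by exact_mod_cast hW.ne'
  -- Since φ² = s^(2l+2) U², the integral is an average of U⁻² against the weight s^(-2l-2), so it
  -- is asymptotic to `besselWeight`.
  have e : ∫ s in x..1, 1 / φ s ^ 2 =
      ∫ s in x..1, ((s ^ (-(2 * l + 2)) : ℝ) : ℂ) * (U s ^ 2)⁻¹ := by
    refine intervalIntegral.integral_congr_ae (Eventually.of_forall fun s hs => ?_)
    have hs0 : 0 < s := lt_of_lt_of_le (lt_min hx0 one_pos) hs.1.le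
    have e2 : s ^ (2 * l + 2) = (s ^ (l + 1)) ^ 2 := by
      rw [← Real.rpow_natCast, ← Real.rpow_mul hs0.le]
      congr 1
      push_cast
      ring
    rw [hφ s hs0, Real.rpow_neg hs0.le, e2]
    push_cast
    rw [one_div, mul_pow, mul_inv]
  have eW : ((∫ s in x..1, s ^ (-(2 * l + 2)) : ℝ) : ℂ) = (besselWeight l x : ℂ) := rfl
  rw [reduceOrder, e, hφ x hx0, eW]
  push_cast
  field_simp

theorem continuousWithinAt_ite_zero {f : ℝ → ℂ} {a : ℂ} (h : Tendsto f (𝓝[>] 0) (𝓝 a)) :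
    ContinuousWithinAt (fun x : ℝ => if x = 0 then a else f x) (Ici 0) 0 := by
  rw [← continuousWithinAt_Ioi_iff_Ici, ContinuousWithinAt, if_pos rfl]
  refine h.congr' ?_
  filter_upwards [self_mem_nhdsWithin] with x hx
  rw [if_neg (ne_of_gt hx)]

theorem tendsto_besselScale_mul_of_le {l C e : ℝ} {f : ℝ → ℂ} (hl : -(1 / 2) < l)
    (he : 0 < e + l) (hf : ∀ x ∈ Ioc (0 : ℝ) 1, ‖f x‖ ≤ C * x ^ e) :
    Tendsto (fun x => (besselScale l x : ℂ) * f x) (𝓝[>] 0) (𝓝 0) := by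
  have h := (tendsto_rpow_nhdsGT_zero he).const_mul ((2 * l + 1) * C)
  rw [mul_zero] at h
  refine squeeze_zero_norm' ?_ h
  filter_upwards [Ioc_mem_nhdsGT one_pos] with x hx
  have hl0 : 0 < 2 * l + 1 := by linarith
  have hxl := Real.rpow_nonneg hx.1.le l
  rw [besselScale, if_neg hl.ne', norm_mul, Complex.norm_real,
    Real.norm_of_nonneg (mul_nonneg hl0.le hxl)]
  calc (2 * l + 1) * x ^ l * ‖f x‖ ≤ (2 * l + 1) * x ^ l * (C * x ^ e) := by
        gcongr
        exact hf x hx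
    _ = _ := by
        rw [Real.rpow_add hx.1]
        ring

/-- Compactness of [0,1] bounds both U and 1/U. -/
theorem exists_rpow_bounds {l : ℝ} {φ U : ℝ → ℂ}
    (hφ : ∀ x, φ x = ((x ^ (l + 1) : ℝ) : ℂ) * U x) (hU : ContinuousOn U (Ici 0))
    (hne : ∀ x, 0 ≤ x → U x ≠ 0) :
    ∃ c M : ℝ, 0 < c ∧ (∀ x ∈ Ioc (0 : ℝ) 1, c * x ^ (l + 1) ≤ ‖φ x‖) ∧
      ∀ x ∈ Ioc (0 : ℝ) 1, ‖φ x‖ ≤ M * x ^ (l + 1) := by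
  have hU1 : ContinuousOn U (Icc 0 1) := hU.mono fun _ hx => hx.1
  obtain ⟨M, hM⟩ := isCompact_Icc.exists_bound_of_continuousOn hU1
  obtain ⟨B, hB⟩ := isCompact_Icc.exists_bound_of_continuousOn
    (hU1.inv₀ fun x hx => hne x hx.1)
  have hn : ∀ x ∈ Ioc (0 : ℝ) 1, ‖φ x‖ = x ^ (l + 1) * ‖U x‖ := by
    intro x hx
    rw [hφ, norm_mul, Complex.norm_real, Real.norm_of_nonneg (Real.rpow_nonneg hx.1.le _)]
  have hB0 : 0 < B := by
    have := hB 0 ⟨le_rfl, zero_le_one⟩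
    exact (norm_pos_iff.2 (inv_ne_zero (hne 0 le_rfl))).trans_le this
  refine ⟨B⁻¹, M, inv_pos.2 hB0, fun x hx => ?_, fun x hx => ?_⟩
  · have h1 := hB x ⟨hx.1.le, hx.2⟩
    rw [Pi.inv_apply, norm_inv] at h1
    have h2 : B⁻¹ ≤ ‖U x‖ := inv_le_of_inv_le₀ (norm_pos_iff.2 (hne x hx.1.le)) h1
    rw [hn x hx, mul_comm]
    exact mul_le_mul_of_nonneg_left h2 (Real.rpow_nonneg hx.1.le _)
  · rw [hn x hx, mul_comm]
    exact mul_le_mul_of_nonneg_right (hM x ⟨hx.1.le, hx.2⟩) (Real.rpow_nonneg hx.1.le _)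

/-! ### Construction of the two solutions -/

/-- The admissible pair of coefficients of the Bessel pencil. -/
theorem VolterraAdmissible.neg_rpow {κ : ℝ} (hκ : 1 ≤ κ) :
    VolterraAdmissible (fun s => s ^ (-κ)) (fun y => -((y ^ κ : ℝ) : ℂ)) := by
  refine VolterraAdmissible.of_rpow_bound (e := κ) (C := 1) (continuousOn_ofReal_rpow κ).neg
    (fun y hy => ?_) (by linarith) (by linarith)
  rw [norm_neg, Complex.norm_real, Real.norm_of_nonneg (Real.rpow_nonneg hy.1.le _), one_mul]

/-- The regular solution of the Bessel equation. -/
theorem exists_regular_solution {l : ℝ} {q : ℝ → ℝ} (hl : -(1 / 2) ≤ l)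
    (h₁ : VolterraAdmissible (fun s => s ^ (-(2 * l + 2)))
      (fun y => ((y ^ (2 * l + 2) * q y : ℝ) : ℂ))) :
    ∃ U : ℂ → ℝ → ℂ, ContinuousOn (Function.uncurry U) (univ ×ˢ Ici (0 : ℝ)) ∧
      (∀ x, 0 ≤ x → Differentiable ℂ fun z => U z x) ∧
      ∀ z, ∃ F, VolterraAdmissible (fun s => s ^ (-(2 * l + 2))) F ∧
        (∀ y, 0 < y → F y = ((y ^ (2 * l + 2) * q y : ℝ) : ℂ) * U z y
          - z * ((y ^ (2 * l + 2) : ℝ) : ℂ) * U z y) ∧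
        ∀ x, 0 ≤ x → U z x = 1 + volterraInt (fun s => s ^ (-(2 * l + 2))) F x := by
  have h₂ := VolterraAdmissible.neg_rpow (κ := 2 * l + 2) (by linarith)
  obtain ⟨U, hUc, hUd, hU⟩ := h₁.exists_solution h₂ (g := fun _ => 1) continuousOn_const
  refine ⟨U, hUc, hUd, fun z => ⟨_, (h₁.pencil h₂ z).mul (f := U z) ?_, fun y _ => ?_, hU z⟩⟩
  · exact hUc.comp (f := fun x => (z, x)) (by fun_prop) fun x hx => ⟨mem_univ _, hx⟩
  · ring

/-- A Taylor polynomial at `I`, formed from the chain of reductions of order, is completed by a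
remainder from a Volterra equation. Every term is entire in z, and after scaling only the zeroth
chain element survives at the origin. -/
theorem exists_singular_solution {l : ℝ} {q : ℝ → ℝ} (hl : -(1 / 2) ≤ l)
    (h₁ : VolterraAdmissible (fun s => s ^ (-(2 * l + 2)))
      (fun y => ((y ^ (2 * l + 2) * q y : ℝ) : ℂ))) :
    ∃ θ : ℂ → ℝ → ℂ, (∀ z, ∃ w, SolvesBessel l q z (fun _ => 0) (θ z) w) ∧
      (∀ x, 0 < x → Differentiable ℂ fun z => θ z x) ∧
      ContinuousOn (Function.uncurry θ) (univ ×ˢ Ioi (0 : ℝ)) ∧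
      ∀ z, ContinuousWithinAt (fun w : ℂ × ℝ =>
        if w.2 = 0 then 1 else (besselScale l w.2 : ℂ) * θ w.1 w.2) (univ ×ˢ Ici (0 : ℝ)) (z, 0) := by
  have hκ : 1 ≤ 2 * l + 2 := by linarith
  have h₂ := VolterraAdmissible.neg_rpow hκ
  obtain ⟨U, hUc, -, hUF⟩ := exists_regular_solution hl h₁
  obtain ⟨F, hF, hFU, hU⟩ := hUF Complex.I
  have hU0c : ContinuousOn (U Complex.I) (Ici 0) :=
    hUc.comp (f := fun x => (Complex.I, x)) (by fun_prop) fun x hx => ⟨mem_univ _, hx⟩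
  have hU0 : U Complex.I 0 = 1 := by
    rw [hU 0 le_rfl]
    simp [volterraInt]
  have hne : ∀ x, 0 < x → U Complex.I x ≠ 0 := fun x hx =>
    hF.ne_zero_of_eq (by linarith) hU hFU hx
  set φ : ℝ → ℂ := fun x => ((x ^ (l + 1) : ℝ) : ℂ) * U Complex.I x with hφ
  have hφs := hF.solvesBessel (f := fun _ => 0) (z := Complex.I) hU fun y hy => by
    rw [hFU y hy]
    ring
  have hφne : ∀ x, 0 < x → φ x ≠ 0 := fun x hx => mul_ne_zero
    (Complex.ofReal_ne_zero.2 (Real.rpow_pos_of_pos hx _).ne') (hne x hx)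
  obtain ⟨c, M, hc, hlow, hup⟩ := exists_rpow_bounds (fun x => rfl : ∀ x, φ x = _) hU0c
    fun x hx => by
      rcases hx.eq_or_lt with rfl | hx
      · rw [hU0]
        exact one_ne_zero
      · exact hne x hx
  -- The largest index for which the chain estimate is available; it exceeds 2l, which makes the
  -- last chain element small enough to serve as a Volterra source.
  set N := ⌊2 * l + 1⌋₊ with hN
  have hN1 : (N : ℝ) ≤ 2 * l + 1 := Nat.floor_le (by linarith)
  have hN2 : 2 * l < N := by
    have := Nat.lt_floor_add_one (2 * l + 1)
    linarith
  have hchain : ∀ k ≤ N, (∃ w', SolvesBessel l q Complex.I (besselChainRHS φ k)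
      (besselChain φ k) w') ∧ ∃ C, ∀ x ∈ Ioc (0 : ℝ) 1, ‖besselChain φ k x‖ ≤
        C * x ^ ((k : ℝ) - l - 1 / 2) := fun k hk =>
    besselChain_spec hl hφs hφne hc hlow hup k (le_trans (by exact_mod_cast hk) hN1)
  have hcc : ∀ k ≤ N, ContinuousOn (besselChain φ k) (Ioi 0) := fun k hk =>
    (hchain k hk).1.choose_spec.continuousOn
  obtain ⟨C, hC⟩ := (hchain N le_rfl).2
  -- The source is O(y^(N+1/2)), so admissibility asks for 2l + 2 < N + 5/2, which 2l < N gives.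
  have hFN : VolterraAdmissible (fun s => s ^ (-(2 * l + 2)))
      (fun y => -(((y ^ (l + 1) : ℝ) : ℂ) * besselChain φ N y)) := by
    refine VolterraAdmissible.of_rpow_bound (e := N + 1 / 2) (C := C)
      ((continuousOn_ofReal_rpow _).mul (hcc N le_rfl)).neg (fun y hy => ?_) (by positivity)
      (by linarith)
    have h0 := Real.rpow_nonneg hy.1.le (l + 1)
    rw [norm_neg, norm_mul, Complex.norm_real, Real.norm_of_nonneg h0]
    calc y ^ (l + 1) * ‖besselChain φ N y‖ ≤ y ^ (l + 1) * (C * y ^ ((N : ℝ) - l - 1 / 2)) :=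
          mul_le_mul_of_nonneg_left (hC y hy) h0
      _ = C * (y ^ (l + 1) * y ^ ((N : ℝ) - l - 1 / 2)) := by ring
      _ = _ := by
          rw [← Real.rpow_add hy.1]
          congr 2
          ring
  obtain ⟨V, hVc, hVd, hV⟩ := h₁.exists_solution h₂ hFN.continuousOn_volterraInt
  have hVz : ∀ z, ContinuousOn (V z) (Ici 0) := fun z =>
    hVc.comp (f := fun x => (z, x)) (by fun_prop) fun x hx => ⟨mem_univ _, hx⟩
  have hVs : ∀ z, ∃ w, SolvesBessel l q z (besselChain φ N)
      (fun x => ((x ^ (l + 1) : ℝ) : ℂ) * V z x) w := by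
    intro z
    have hadm := (h₁.pencil h₂ z).mul (hVz z)
    -- The remainder has V(0) = 0: its Volterra equation is driven by the chain element alone.
    refine ⟨_, (hFN.add hadm).solvesBessel (c := 0) (fun x hx => ?_) fun y _ => ?_⟩
    · rw [zero_add, VolterraAdmissible.volterraInt_add hFN hadm hx, hV z x hx]
    · ring
  have hSc : ∀ k ≤ N, ContinuousOn (fun w : ℂ × ℝ => besselChain φ k w.2) (univ ×ˢ Ioi (0 : ℝ)) :=
    fun k hk => (hcc k hk).comp continuousOn_snd fun w hw => hw.2
  refine ⟨fun z x => besselChainSum φ Complex.I z (N + 1) x +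
    (z - Complex.I) ^ (N + 1) * (((x ^ (l + 1) : ℝ) : ℂ) * V z x), fun z => ?_, fun x hx => ?_,
    ?_, fun z => ?_⟩
  -- The defect of the Taylor polynomial is -(z - i)^(N+1) θ_N, cancelled by the remainder times (z
  -- - i)^(N+1).
  · obtain ⟨w₁, hw₁⟩ := solvesBessel_besselChainSum (fun k hk => (hchain k hk).1) z
    obtain ⟨w₂, hw₂⟩ := hVs z
    exact ⟨_, (hw₁.add (hw₂.const_mul ((z - Complex.I) ^ (N + 1)))).congr_right fun x _ => by ring⟩
  · have hVx := hVd x hx.le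
    unfold besselChainSum
    fun_prop
  · unfold Function.uncurry besselChainSum
    refine ContinuousOn.add (continuousOn_finsetSum _ fun k hk => ?_) ?_
    · exact ContinuousOn.mul (by fun_prop) (hSc k (Nat.lt_succ_iff.1 (Finset.mem_range.1 hk)))
    · refine ContinuousOn.mul (by fun_prop) (ContinuousOn.mul ?_ ?_)
      · exact (continuousOn_ofReal_rpow _).comp continuousOn_snd fun w hw => hw.2
      · exact hVc.mono (prod_mono le_rfl Ioi_subset_Ici_self)
  · have hη : ∀ k ≤ N, Tendsto (fun x => (besselScale l x : ℂ) * besselChain φ k x) (𝓝[>] 0)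
        (𝓝 (if k = 0 then 1 else 0)) := by
      intro k hk
      rcases Nat.eq_zero_or_pos k with rfl | hk0
      · exact tendsto_besselScale_mul_reduceOrder hl (fun x _ => rfl) hU0c hU0 hne
      · rw [if_neg hk0.ne']
        obtain ⟨C, hC⟩ := (hchain k hk).2
        -- An index k ≥ 1 occurs only if N ≥ 1, hence l ≥ 0, so the logarithmic case does not arise;
        -- the scaled term is O(x^(k-1/2)).
        have h1 : (1 : ℝ) ≤ k := by exact_mod_cast hk0
        have h2 : (k : ℝ) ≤ N := by exact_mod_cast hk
        exact tendsto_besselScale_mul_of_le (by linarith) (by linarith) hC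
    have hσ : Tendsto (fun x => ((besselScale l x * x ^ (l + 1) : ℝ) : ℂ)) (𝓝[>] 0) (𝓝 0) := by
      have := (Complex.continuous_ofReal.tendsto 0).comp (tendsto_besselScale_mul_rpow hl)
      rwa [Complex.ofReal_zero] at this
    have hsnd : Tendsto (fun w : ℂ × ℝ => w.2) (𝓝[univ ×ˢ Ici (0 : ℝ)] (z, 0)) (𝓝[Ici 0] 0) :=
      continuousWithinAt_snd.tendsto_nhdsWithin fun w hw => hw.2
    have hcomp : ∀ {f : ℝ → ℂ}, ContinuousWithinAt f (Ici 0) 0 →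
        ContinuousWithinAt (fun w : ℂ × ℝ => f w.2) (univ ×ˢ Ici (0 : ℝ)) (z, 0) :=
      fun hf => hf.tendsto.comp hsnd
    -- Each scaled factor is extended to x = 0 by its limit, so joint continuity can be checked term
    -- by term; at x = 0 only k = 0 contributes, with value 1.
    have hmain : ContinuousWithinAt (fun w : ℂ × ℝ =>
        (∑ k ∈ Finset.range (N + 1), (w.1 - Complex.I) ^ k *
          (if w.2 = 0 then (if k = 0 then 1 else 0) else
            (besselScale l w.2 : ℂ) * besselChain φ k w.2)) +
        (w.1 - Complex.I) ^ (N + 1) * ((if w.2 = 0 then 0 else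
          ((besselScale l w.2 * w.2 ^ (l + 1) : ℝ) : ℂ)) * V w.1 w.2))
        (univ ×ˢ Ici (0 : ℝ)) (z, 0) := by
      refine ContinuousWithinAt.add (tendsto_finsetSum _ fun k hk => ?_) ?_
      · exact ContinuousWithinAt.mul (by fun_prop) (hcomp (continuousWithinAt_ite_zero
          (hη k (Nat.lt_succ_iff.1 (Finset.mem_range.1 hk)))))
      · exact ContinuousWithinAt.mul (by fun_prop) ((hcomp (continuousWithinAt_ite_zero hσ)).mul
          (hVc (z, 0) ⟨mem_univ _, mem_Ici.2 le_rfl⟩))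
    refine hmain.congr (fun w _ => ?_) ?_
    · by_cases hw : w.2 = 0
      · simp [hw]
      · simp only [if_neg hw, besselChainSum]
        rw [mul_add, Finset.mul_sum]
        push_cast
        congr 1
        · refine Finset.sum_congr rfl fun k _ => by ring
        · ring
    · simp

/-! ### Sobolev regularity up to the origin -/

theorem memSobolevOne_of_hasDerivAt {p : ℝ≥0∞} {f f' : ℝ → ℂ} (hp : 1 ≤ p)
    (hc : ContinuousOn f (Icc 0 1)) (hd : ∀ x ∈ Ioo (0 : ℝ) 1, HasDerivAt f (f' x) x)
    (hm : MemLp f' p (volume.restrict (Ioo (0 : ℝ) 1))) : MemSobolevOne p f := by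
  have hi : IntervalIntegrable f' volume 0 1 := by
    rw [intervalIntegrable_iff_integrableOn_Ioo_of_le zero_le_one]
    exact memLp_one_iff_integrable.1 (hm.mono_exponent hp)
  constructor
  · have h0 : AbsolutelyContinuousOnInterval (fun _ : ℝ => f 0) 0 1 :=
      (LipschitzWith.const (f 0)).lipschitzOnWith.absolutelyContinuousOnInterval
    refine (h0.add (hi.absolutelyContinuousOnInterval_primitive (c := 0) (by simp))).congr_on
      fun x hx => ?_
    rw [uIcc_of_le zero_le_one] at hx
    have := intervalIntegral.integral_eq_sub_of_hasDerivAt_of_le hx.1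
      (hc.mono (Icc_subset_Icc_right hx.2))
      (fun y hy => hd y ⟨hy.1, hy.2.trans_le hx.2⟩)
      (hi.mono_set (uIcc_subset_uIcc (by simp) (by rw [uIcc_of_le zero_le_one]; exact hx)))
    simp [this]
  · refine (memLp_congr_ae ?_).1 hm
    filter_upwards [ae_restrict_mem measurableSet_Ioo] with x hx using (hd x hx).deriv.symm

theorem memLp_id_unit (p : ℝ≥0∞) :
    MemLp (fun x : ℝ => x) p (volume.restrict (Ioo (0 : ℝ) 1)) := by
  refine MemLp.of_bound measurable_id.aestronglyMeasurable 1 ?_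
  filter_upwards [ae_restrict_mem measurableSet_Ioo] with x hx
  rw [Real.norm_of_nonneg hx.1.le]
  exact hx.2.le

theorem memLp_rpow_unit {a : ℝ} {p : ℝ≥0∞}
    (hc : 0 ≤ a ∨ (a < 0 ∧ p < (ENNReal.ofReal (-a))⁻¹)) :
    MemLp (fun x : ℝ => x ^ a) p (volume.restrict (Ioo (0 : ℝ) 1)) := by
  have hm : AEStronglyMeasurable (fun x : ℝ => x ^ a) (volume.restrict (Ioo (0 : ℝ) 1)) :=
    (by fun_prop : Measurable fun x : ℝ => x ^ a).aestronglyMeasurable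
  rcases hc with ha | ⟨ha, hp⟩
  · refine MemLp.of_bound hm 1 ?_
    filter_upwards [ae_restrict_mem measurableSet_Ioo] with x hx
    rw [Real.norm_of_nonneg (Real.rpow_nonneg hx.1.le _)]
    exact Real.rpow_le_one hx.1.le hx.2.le ha
  · refine ⟨hm, ?_⟩
    have hpt : p ≠ ∞ := hp.ne_top
    rcases eq_or_ne p 0 with rfl | hp0
    · simp
    rw [eLpNorm_lt_top_iff_lintegral_rpow_enorm_lt_top hp0 hpt]
    have hlt : 0 < a * p.toReal + 1 := by
      have h1 : p * ENNReal.ofReal (-a) < 1 := by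
        rw [← inv_inv (ENNReal.ofReal (-a)), ← div_eq_mul_inv]
        refine ENNReal.div_lt_of_lt_mul ?_
        simpa using hp
      rw [← ENNReal.ofReal_toReal hpt, ← ENNReal.ofReal_mul (by positivity),
        ← ENNReal.ofReal_one, ENNReal.ofReal_lt_ofReal_iff one_pos] at h1
      linarith
    have h2 := lintegral_Ioo_zero_rpow hlt one_pos
    refine lt_of_eq_of_lt (setLIntegral_congr_fun measurableSet_Ioo fun x hx => ?_)
      (h2.trans_lt ENNReal.ofReal_lt_top)
    rw [Real.enorm_of_nonneg (Real.rpow_nonneg hx.1.le _), ENNReal.ofReal_rpow_of_nonneg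
      (Real.rpow_nonneg hx.1.le _) ENNReal.toReal_nonneg, ← Real.rpow_mul hx.1.le,
      add_sub_cancel_right]

theorem tendsto_primitive_nhdsGT_zero {g : ℝ → ℝ} (hg : IntegrableOn g (Ioo 0 1)) :
    Tendsto (fun x => ∫ y in (0 : ℝ)..x, g y) (𝓝[>] 0) (𝓝 0) := by
  have : IntegrableOn g (uIcc 0 1) := by
    rw [uIcc_of_le zero_le_one, integrableOn_Icc_iff_integrableOn_Ioo]
    exact hg
  have h2 := intervalIntegral.continuousOn_primitive_interval this 0 (by simp)
  rw [uIcc_of_le zero_le_one, ContinuousWithinAt, intervalIntegral.integral_same] at h2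
  refine h2.mono_left (le_trans (le_of_eq ?_) (nhdsWithin_mono _ Ioo_subset_Icc_self))
  exact (nhdsWithin_Ioo_eq_nhdsGT one_pos).symm

/-- The bound on the derivative of the regular solution. -/
theorem VolterraAdmissible.regular_deriv_le {κ : ℝ} {q : ℝ → ℝ} {z : ℂ} {U F : ℝ → ℂ} (hκ : 1 ≤ κ)
    (hi : IntegrableOn (fun y => y * q y) (Ioo 0 1)) (hUc : ContinuousOn U (Ici 0))
    (hf : ∀ y, 0 < y → F y = ((y ^ κ * q y : ℝ) : ℂ) * U y - z * ((y ^ κ : ℝ) : ℂ) * U y) :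
    ∃ C, 0 ≤ C ∧ ∀ x ∈ Ioo (0 : ℝ) 1, ‖((x ^ (-κ) : ℝ) : ℂ) * ∫ y in (0 : ℝ)..x, F y‖ ≤
      C * (x ^ (-κ) * ∫ y in (0 : ℝ)..x, y ^ (κ - 1) * |y * q y|) + C * ‖z‖ * x := by
  obtain ⟨C, hC⟩ := isCompact_Icc.exists_bound_of_continuousOn
    (hUc.mono (fun y hy => hy.1 : Icc (0 : ℝ) 1 ⊆ Ici 0))
  have hC0 : 0 ≤ C := (norm_nonneg _).trans (hC 0 ⟨le_rfl, zero_le_one⟩)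
  refine ⟨C, hC0, fun x hx => ?_⟩
  have hxκ := Real.rpow_nonneg hx.1.le (-κ)
  have hint : IntervalIntegrable (fun y => y ^ (κ - 1) * |y * q y|) volume 0 x := by
    rw [intervalIntegrable_iff_integrableOn_Ioo_of_le hx.1.le]
    exact (integrableOn_rpow_mul_abs hκ hi).mono_set (Ioo_subset_Ioo_right hx.2.le)
  -- In the z-term y^κ is replaced by x^κ; integration over (0, x) and the factor x^(-κ) leave
  -- C‖z‖x.
  have h1 : ‖∫ y in (0 : ℝ)..x, F y‖ ≤
      ∫ y in (0 : ℝ)..x, (C * (y ^ (κ - 1) * |y * q y|) + C * ‖z‖ * x ^ κ) := by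
    refine intervalIntegral.norm_integral_le_of_norm_le hx.1.le (Eventually.of_forall
      fun y hy => ?_) ((hint.const_mul C).add intervalIntegrable_const)
    rw [hf y hy.1]
    have hU := hC y ⟨hy.1.le, hy.2.trans hx.2.le⟩
    have hyκ := Real.rpow_le_rpow hy.1.le hy.2 (by linarith : 0 ≤ κ)
    have hy0 := Real.rpow_nonneg hy.1.le κ
    have hx0 := Real.rpow_nonneg hx.1.le κ
    have hy1 := Real.rpow_nonneg hy.1.le (κ - 1)
    calc _ ≤ ‖((y ^ κ * q y : ℝ) : ℂ)‖ * ‖U y‖ + ‖z‖ * ‖((y ^ κ : ℝ) : ℂ)‖ * ‖U y‖ := by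
          refine (norm_sub_le _ _).trans (le_of_eq ?_)
          rw [norm_mul, norm_mul, norm_mul]
      _ ≤ y ^ (κ - 1) * |y * q y| * C + ‖z‖ * x ^ κ * C := by
          rw [ofReal_rpow_mul_potential_norm q hy.1, Complex.norm_real, Real.norm_of_nonneg hy0]
          gcongr
      _ = _ := by ring
  rw [intervalIntegral.integral_add (hint.const_mul C) intervalIntegrable_const,
    intervalIntegral.integral_const_mul, intervalIntegral.integral_const, smul_eq_mul,
    sub_zero] at h1
  rw [norm_mul, Complex.norm_real, Real.norm_of_nonneg hxκ]
  have h2 : x ^ (-κ) * x ^ κ = 1 := by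
    rw [← Real.rpow_add hx.1, neg_add_cancel, Real.rpow_zero]
  calc _ ≤ x ^ (-κ) * (C * (∫ y in (0 : ℝ)..x, y ^ (κ - 1) * |y * q y|)
        + x * (C * ‖z‖ * x ^ κ)) := mul_le_mul_of_nonneg_left h1 hxκ
    _ = C * (x ^ (-κ) * ∫ y in (0 : ℝ)..x, y ^ (κ - 1) * |y * q y|)
        + C * ‖z‖ * x * (x ^ (-κ) * x ^ κ) := by ring
    _ = _ := by rw [h2, mul_one]

/-- U' is dominated by the Hardy transform of |yq| plus a multiple of x, which yields the L^p bound.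
For xU', the factor x^(1-κ) y^(κ-1) is at most 1 on y ≤ x, leaving the integral of |yq| over (0, x),
which tends to 0. -/
theorem VolterraAdmissible.regular_regularity {κ : ℝ} {p : ℝ≥0∞} {q : ℝ → ℝ} {z : ℂ} {U F : ℝ → ℂ}
    (hκ : 1 ≤ κ) (hp : 1 ≤ p) (hi : IntegrableOn (fun y => y * q y) (Ioo 0 1))
    (hD : MemLp (fun x => x ^ (-κ) * ∫ y in (0 : ℝ)..x, y ^ (κ - 1) * |y * q y|) p
      (volume.restrict (Ioo (0 : ℝ) 1)))
    (hF : VolterraAdmissible (fun s => s ^ (-κ)) F)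
    (hf : ∀ y, 0 < y → F y = ((y ^ κ * q y : ℝ) : ℂ) * U y - z * ((y ^ κ : ℝ) : ℂ) * U y)
    (hU : ∀ x, 0 ≤ x → U x = 1 + volterraInt (fun s => s ^ (-κ)) F x) :
    MemSobolevOne p U ∧ (∀ x, 0 < x → DifferentiableAt ℝ U x) ∧
      Tendsto (fun x : ℝ => (x : ℂ) * deriv U x) (𝓝[>] 0) (𝓝 0) := by
  have hUc : ContinuousOn U (Ici 0) :=
    (continuousOn_const.add hF.continuousOn_volterraInt).congr fun x hx => hU x hx
  have hUd : ∀ x, 0 < x → HasDerivAt U (((x ^ (-κ) : ℝ) : ℂ) * ∫ y in (0 : ℝ)..x, F y) x := by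
    intro x hx
    refine ((hF.hasDerivAt_volterraInt hx).const_add 1).congr_of_eventuallyEq ?_
    filter_upwards [Ioi_mem_nhds hx] with y hy using hU y (le_of_lt hy)
  obtain ⟨C, hC0, hC⟩ := VolterraAdmissible.regular_deriv_le hκ hi hUc hf
  refine ⟨memSobolevOne_of_hasDerivAt hp (hUc.mono fun _ hx => hx.1) (fun x hx => hUd x hx.1) ?_,
    fun x hx => (hUd x hx).differentiableAt, ?_⟩
  · refine MemLp.mono' ((hD.const_mul C).add ((memLp_id_unit p).const_mul (C * ‖z‖))) ?_ ?_
    · refine ContinuousOn.aestronglyMeasurable (((continuousOn_ofReal_rpow _).mul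
        (VolterraAdmissible.continuousOn_inner hF.integrable)).mono Ioo_subset_Ioi_self)
        measurableSet_Ioo
    · filter_upwards [ae_restrict_mem measurableSet_Ioo] with x hx using hC x hx
  · have h1 : Tendsto (fun x : ℝ => C * (∫ y in (0 : ℝ)..x, |y * q y|) + C * ‖z‖ * (x * x))
        (𝓝[>] 0) (𝓝 0) := by
      have hx : Tendsto (fun x : ℝ => x) (𝓝[>] 0) (𝓝 0) := tendsto_id.mono_left nhdsWithin_le_nhds
      simpa using ((tendsto_primitive_nhdsGT_zero hi.abs).const_mul C).add
        ((hx.mul hx).const_mul (C * ‖z‖))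
    refine squeeze_zero_norm' ?_ h1
    filter_upwards [Ioo_mem_nhdsGT one_pos] with x hx
    rw [(hUd x hx.1).deriv, norm_mul, Complex.norm_real, Real.norm_of_nonneg hx.1.le]
    have hint : ∀ {f : ℝ → ℝ}, IntegrableOn f (Ioo 0 1) → IntervalIntegrable f volume 0 x := by
      intro f hf
      rw [intervalIntegrable_iff_integrableOn_Ioo_of_le hx.1.le]
      exact hf.mono_set (Ioo_subset_Ioo_right hx.2.le)
    have hle : x * (x ^ (-κ) * ∫ y in (0 : ℝ)..x, y ^ (κ - 1) * |y * q y|) ≤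
        ∫ y in (0 : ℝ)..x, |y * q y| := by
      have e : x * x ^ (-κ) = x ^ (-(κ - 1)) := by
        rw [neg_sub, sub_eq_add_neg, Real.rpow_add hx.1, Real.rpow_one]
      rw [← mul_assoc, e, ← intervalIntegral.integral_const_mul]
      refine intervalIntegral.integral_mono_on hx.1.le
        ((hint (integrableOn_rpow_mul_abs hκ hi)).const_mul _) (hint hi.abs) fun y hy => ?_
      rw [← mul_assoc]
      refine mul_le_of_le_one_left (abs_nonneg _) ?_
      rw [Real.rpow_neg hx.1.le, inv_mul_le_iff₀ (Real.rpow_pos_of_pos hx.1 _), mul_one]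
      exact Real.rpow_le_rpow hy.1 hy.2 (by linarith)
    calc x * _ ≤ x * (C * (x ^ (-κ) * ∫ y in (0 : ℝ)..x, y ^ (κ - 1) * |y * q y|)
          + C * ‖z‖ * x) := mul_le_mul_of_nonneg_left (hC x hx) hx.1.le
      _ = C * (x * (x ^ (-κ) * ∫ y in (0 : ℝ)..x, y ^ (κ - 1) * |y * q y|))
          + C * ‖z‖ * (x * x) := by ring
      _ ≤ _ := by gcongr

/-- Dominated convergence: (x/y)^b is at most 1 for y > x and tends to 0 for fixed y. -/
theorem tendsto_rpow_mul_integral_rpow_neg {b : ℝ} {h : ℝ → ℝ} (hb : 0 < b)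
    (hh : IntegrableOn h (Ioo 0 1)) :
    Tendsto (fun x => x ^ b * ∫ y in x..1, y ^ (-b) * |h y|) (𝓝[>] 0) (𝓝 0) := by
  set f : ℝ → ℝ → ℝ := fun x => (Ioi x).indicator fun y => x ^ b * (y ^ (-b) * |h y|) with hf
  have hlim : Tendsto (fun x => ∫ y in Ioo 0 1, f x y) (𝓝[>] 0)
      (𝓝 (∫ _ in Ioo (0 : ℝ) 1, (0 : ℝ))) := by
    refine tendsto_integral_filter_of_dominated_convergence (fun y => |h y|)
      (Eventually.of_forall fun x => ?_) ?_ hh.abs ?_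
    · have hm : AEStronglyMeasurable (fun y : ℝ => x ^ b * (y ^ (-b) * |h y|))
          (volume.restrict (Ioo (0 : ℝ) 1)) :=
        ((by fun_prop : Measurable fun y : ℝ => y ^ (-b)).aestronglyMeasurable.mul
          hh.abs.1).const_mul _
      exact hm.indicator measurableSet_Ioi
    · filter_upwards [self_mem_nhdsWithin] with x hx
      have hx0 : (0 : ℝ) < x := hx
      filter_upwards with y
      by_cases hy : x < y
      · have hy0 : 0 < y := hx0.trans hy
        rw [hf]
        simp only
        rw [indicator_of_mem (mem_Ioi.2 hy), Real.norm_of_nonneg (by positivity), ← mul_assoc]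
        refine mul_le_of_le_one_left (abs_nonneg _) ?_
        rw [Real.rpow_neg hy0.le, mul_inv_le_iff₀ (Real.rpow_pos_of_pos hy0 _), one_mul]
        exact Real.rpow_le_rpow hx0.le hy.le hb.le
      · rw [hf]
        simp only
        rw [indicator_of_notMem (by simpa using hy), norm_zero]
        exact abs_nonneg _
    · filter_upwards [ae_restrict_mem measurableSet_Ioo] with y hy
      have h1 := (tendsto_rpow_nhdsGT_zero hb).mul_const (y ^ (-b) * |h y|)
      rw [zero_mul] at h1
      refine h1.congr' ?_
      filter_upwards [Ioo_mem_nhdsGT hy.1] with x hx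
      rw [hf]
      simp only
      rw [indicator_of_mem (mem_Ioi.2 hx.2)]
  rw [integral_zero] at hlim
  refine hlim.congr' ?_
  filter_upwards [Ioo_mem_nhdsGT one_pos] with x hx
  rw [hf]
  simp only
  rw [setIntegral_indicator measurableSet_Ioi, intervalIntegral.integral_of_le hx.2.le,
    integral_Ioc_eq_integral_Ioo, ← integral_const_mul]
  congr 2
  ext y
  simp only [mem_inter_iff, mem_Ioi, mem_Ioo]
  exact ⟨fun h => ⟨h.2, h.1.2⟩, fun h => ⟨⟨hx.1.trans h.1, h.2⟩, h.1⟩⟩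

/-- The derivative of the normalized second solution. -/
theorem SolvesBessel.singular_deriv_le {l : ℝ} {q : ℝ → ℝ} {z : ℂ} {u w ψ : ℝ → ℂ}
    (hq : LocallyIntegrableOn q (Ioi (0 : ℝ)) volume) (hu : SolvesBessel l q z (fun _ => 0) u w)
    (hψ : ∀ x, 0 < x → ψ x = (((2 * l + 1) * x ^ l : ℝ) : ℂ) * u x)
    (hψc : ContinuousOn ψ (Icc 0 1)) :
    ∃ (C : ℝ) (P : ℝ → ℂ), 0 ≤ C ∧ ContinuousOn P (Ioi 0) ∧
      (∀ x, 0 < x → HasDerivAt ψ (((x ^ (2 * l) : ℝ) : ℂ) * P x) x) ∧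
      ∀ x ∈ Ioo (0 : ℝ) 1, ‖P x‖ ≤
        C + C * ∫ y in x..1, y ^ (-(2 * l) - 1) * |(|y * q y| + ‖z‖ * y)| := by
  -- P is x^(-2l) ψ' written in terms of u and its derivative. In P' the singular term l(l+1)/x²
  -- cancels, leaving x^(-2l) (q - z) ψ.
  set P : ℝ → ℂ := fun x => ((2 * l + 1 : ℝ) : ℂ) *
    (((l : ℝ) : ℂ) * (((x ^ (-l - 1) : ℝ) : ℂ) * u x) + ((x ^ (-l) : ℝ) : ℂ) * w x) with hP
  have hw := hu.2
  have huw : HasLocACDeriv u w := HasLocACDeriv.of_hasDerivAt hu.1 hw.continuousOn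
  have hPac : HasLocACDeriv P fun x => ((x ^ (-(2 * l)) : ℝ) : ℂ) * (((q x : ℝ) : ℂ) - z) * ψ x := by
    refine (((((hasLocACDeriv_ofReal_rpow (-l - 1)).mul huw).const_mul ((l : ℝ) : ℂ)).add
      ((hasLocACDeriv_ofReal_rpow (-l)).mul hw)).const_mul ((2 * l + 1 : ℝ) : ℂ)).congr
      (fun x _ => rfl) fun x hx => ?_
    have hx0 : (0 : ℝ) < x := hx
    have hx' : (x : ℂ) ≠ 0 := by exact_mod_cast hx0.ne'
    have hA' : ((x ^ l : ℝ) : ℂ) ≠ 0 := by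
      exact_mod_cast (Real.rpow_pos_of_pos hx0 l).ne'
    have e : x ^ (2 * l) = x ^ l * x ^ l := by rw [two_mul, Real.rpow_add hx0]
    simp only
    rw [hψ x hx0, Real.rpow_sub_one hx0.ne', Real.rpow_sub_one hx0.ne', Real.rpow_neg hx0.le,
      Real.rpow_neg hx0.le, e]
    push_cast
    field_simp
    ring
  have hψd : ∀ x, 0 < x → HasDerivAt ψ (((x ^ (2 * l) : ℝ) : ℂ) * P x) x := by
    intro x hx0
    have hx' : (x : ℂ) ≠ 0 := by exact_mod_cast hx0.ne'
    have hA' : ((x ^ l : ℝ) : ℂ) ≠ 0 := by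
      exact_mod_cast (Real.rpow_pos_of_pos hx0 l).ne'
    have e : x ^ (2 * l) = x ^ l * x ^ l := by rw [two_mul, Real.rpow_add hx0]
    have h1 : HasDerivAt (fun x => ((2 * l + 1 : ℝ) : ℂ) * (((x ^ l : ℝ) : ℂ) * u x))
        (((x ^ (2 * l) : ℝ) : ℂ) * P x) x := by
      refine (((hasDerivAt_ofReal_rpow l hx0).mul (hu.1 x hx0)).const_mul _).congr_deriv ?_
      rw [hP]
      simp only
      rw [Real.rpow_sub_one hx0.ne', Real.rpow_sub_one hx0.ne', Real.rpow_neg hx0.le, e]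
      push_cast
      field_simp
    refine h1.congr_of_eventuallyEq ?_
    filter_upwards [Ioi_mem_nhds hx0] with y hy
    rw [hψ y hy]
    push_cast
    ring
  obtain ⟨M, hM⟩ := isCompact_Icc.exists_bound_of_continuousOn hψc
  have hM0 : 0 ≤ M := (norm_nonneg _).trans (hM 0 ⟨le_rfl, zero_le_one⟩)
  refine ⟨max M ‖P 1‖, P, hM0.trans (le_max_left _ _), hPac.continuousOn, hψd, fun x hx => ?_⟩
  have hsub : uIcc x 1 ⊆ Ioi 0 := fun y hy => lt_of_lt_of_le (lt_min hx.1 one_pos) hy.1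
  have hqi : IntervalIntegrable q volume x 1 := by
    rw [intervalIntegrable_iff']
    exact hq.integrableOn_compact_subset hsub isCompact_uIcc
  have hψi : ContinuousOn ψ (uIcc x 1) := hψc.mono (by
    rw [uIcc_of_le hx.2.le]
    exact Icc_subset_Icc_left hx.1.le)
  have hqz : IntervalIntegrable (fun y => ((q y : ℝ) : ℂ) - z) volume x 1 :=
    IntervalIntegrable.sub (f := fun y => ((q y : ℝ) : ℂ)) ⟨hqi.1.ofReal, hqi.2.ofReal⟩
      intervalIntegrable_const
  have hint := (hqz.continuousOn_mul ((continuousOn_ofReal_rpow (-(2 * l))).mono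
    hsub)).mul_continuousOn hψi
  have hyqi : IntervalIntegrable (fun y => |y * q y| + ‖z‖ * y) volume x 1 :=
    (hqi.continuousOn_mul continuousOn_id).abs.add
      (Continuous.intervalIntegrable (by fun_prop) _ _)
  have hbi : IntervalIntegrable (fun y => y ^ (-(2 * l) - 1) * |(|y * q y| + ‖z‖ * y)|)
      volume x 1 := hyqi.abs.continuousOn_mul ((continuousOn_rpow_const_Ioi _).mono hsub)
  have hFTC := hPac.integral_eq_sub hx.1 hx.2.le hint
  have hle : ‖∫ y in x..1, ((y ^ (-(2 * l)) : ℝ) : ℂ) * (((q y : ℝ) : ℂ) - z) * ψ y‖ ≤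
      M * ∫ y in x..1, y ^ (-(2 * l) - 1) * |(|y * q y| + ‖z‖ * y)| := by
    rw [← intervalIntegral.integral_const_mul]
    refine intervalIntegral.norm_integral_le_of_norm_le hx.2.le (Eventually.of_forall
      fun y hy => ?_) (hbi.const_mul M)
    have hy0 : 0 < y := hx.1.trans hy.1
    have hyl := Real.rpow_nonneg hy0.le (-(2 * l))
    rw [norm_mul, norm_mul, Complex.norm_real, Real.norm_of_nonneg hyl,
      Real.rpow_sub_one hy0.ne', abs_of_nonneg (by positivity), abs_mul, abs_of_pos hy0]
    have h1 : ‖((q y : ℝ) : ℂ) - z‖ ≤ |q y| + ‖z‖ := by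
      refine (norm_sub_le _ _).trans ?_
      rw [Complex.norm_real, Real.norm_eq_abs]
    calc _ ≤ y ^ (-(2 * l)) * (|q y| + ‖z‖) * M := by
          gcongr
          exact hM y ⟨hy0.le, hy.2⟩
      _ = _ := by
          field_simp
  have hi0 : 0 ≤ ∫ y in x..1, y ^ (-(2 * l) - 1) * |(|y * q y| + ‖z‖ * y)| :=
    intervalIntegral.integral_nonneg hx.2.le fun y hy =>
      mul_nonneg (Real.rpow_nonneg (hx.1.le.trans hy.1) _) (abs_nonneg _)
  have e : P x = P 1 - ∫ y in x..1, ((y ^ (-(2 * l)) : ℝ) : ℂ) * (((q y : ℝ) : ℂ) - z) * ψ y := by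
    rw [hFTC]
    ring
  rw [e]
  refine (norm_sub_le _ _).trans (add_le_add (le_max_right _ _) (hle.trans ?_))
  exact mul_le_mul_of_nonneg_right (le_max_left _ _) hi0

/-- ψ' is dominated by x^(2l), from the boundary value at 1, plus the dual Hardy operator with a =
2l. The restriction on r for l ≤ 0 is the one both terms tolerate; multiplied by x, both tend to 0
since 2l + 1 > 0. -/
theorem SolvesBessel.singular_regularity {l : ℝ} {q : ℝ → ℝ} {z : ℂ} {u w ψ : ℝ → ℂ}
    (hl : -(1 / 2) < l)
    (hq : LocallyIntegrableOn q (Ioi (0 : ℝ)) volume) (hu : SolvesBessel l q z (fun _ => 0) u w)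
    (hψ : ∀ x, 0 < x → ψ x = (((2 * l + 1) * x ^ l : ℝ) : ℂ) * u x)
    (hψc : ContinuousOn ψ (Icc 0 1)) (hi : IntegrableOn (fun y => y * q y) (Ioo 0 1)) :
    (∀ r : ℝ≥0∞, 1 ≤ r → (0 < l ∨ (l ≤ 0 ∧ r < (ENNReal.ofReal (-(2 * l)))⁻¹)) →
      MemLp (fun y => y * q y) r (volume.restrict (Ioo (0 : ℝ) 1)) → MemSobolevOne r ψ) ∧
      (∀ x, 0 < x → DifferentiableAt ℝ ψ x) ∧
      Tendsto (fun x : ℝ => (x : ℂ) * deriv ψ x) (𝓝[>] 0) (𝓝 0) := by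
  obtain ⟨C, P, hC0, hPc, hψd, hC⟩ := hu.singular_deriv_le hq hψ hψc
  have hbound : ∀ x ∈ Ioo (0 : ℝ) 1, ‖((x ^ (2 * l) : ℝ) : ℂ) * P x‖ ≤ C * x ^ (2 * l) +
      C * (x ^ (2 * l) * ∫ y in x..1, y ^ (-(2 * l) - 1) * |(|y * q y| + ‖z‖ * y)|) := by
    intro x hx
    have hx0 := Real.rpow_nonneg hx.1.le (2 * l)
    rw [norm_mul, Complex.norm_real, Real.norm_of_nonneg hx0]
    refine (mul_le_mul_of_nonneg_left (hC x hx) hx0).trans (le_of_eq ?_)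
    ring
  refine ⟨fun r hr hc hm => ?_, fun x hx => (hψd x hx).differentiableAt, ?_⟩
  · refine memSobolevOne_of_hasDerivAt hr hψc (fun x hx => hψd x hx.1) ?_
    have hh : MemLp (fun y => |y * q y| + ‖z‖ * y) r (volume.restrict (Ioo (0 : ℝ) 1)) :=
      hm.abs.add ((memLp_id_unit r).const_mul ‖z‖)
    have h1 : MemLp (fun x : ℝ => x ^ (2 * l)) r (volume.restrict (Ioo (0 : ℝ) 1)) := by
      refine memLp_rpow_unit ?_
      rcases hc with hc | ⟨hc, hr2⟩
      · exact Or.inl (by linarith)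
      · rcases hc.eq_or_lt with h0 | h0
        -- At l = 0 the inverse of `ENNReal.ofReal 0` is ∞, so r is merely finite. The power x^(2l)
        -- would allow r = ∞; it is the Hardy term that does not.
        · exact Or.inl (by linarith)
        · exact Or.inr ⟨by linarith, hr2⟩
    have h2 := memLp_hardy_right (a := 2 * l) hr (by
      rcases hc with hc | ⟨hc, hr2⟩
      · exact Or.inl (by linarith)
      · exact Or.inr ⟨by linarith, by linarith, hr2⟩) hh
    refine MemLp.mono' ((h1.const_mul C).add (h2.const_mul C)) ?_ ?_
    · exact ContinuousOn.aestronglyMeasurable (((continuousOn_ofReal_rpow _).mul hPc).mono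
        Ioo_subset_Ioi_self) measurableSet_Ioo
    · filter_upwards [ae_restrict_mem measurableSet_Ioo] with x hx using hbound x hx
  · have hb : 0 < 2 * l + 1 := by linarith
    have hh : IntegrableOn (fun y => |y * q y| + ‖z‖ * y) (Ioo 0 1) :=
      hi.abs.add (integrableOn_of_memLp (p := 1) le_rfl ((memLp_id_unit 1).const_mul ‖z‖))
    have h1 := ((tendsto_rpow_nhdsGT_zero hb).const_mul C).add
      ((tendsto_rpow_mul_integral_rpow_neg hb hh).const_mul C)
    rw [mul_zero, add_zero] at h1
    refine squeeze_zero_norm' ?_ h1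
    filter_upwards [Ioo_mem_nhdsGT one_pos] with x hx
    rw [(hψd x hx.1).deriv, norm_mul, Complex.norm_real, Real.norm_of_nonneg hx.1.le]
    refine (mul_le_mul_of_nonneg_left (hbound x hx) hx.1.le).trans (le_of_eq ?_)
    rw [Real.rpow_add_one hx.1.ne', show -(2 * l) - 1 = -(2 * l + 1) by ring]
    ring

/-! ### Wronskian and linear independence -/

/-- The powers of x cancel: the Wronskian is θ̃φ̃ + (θ̃ · xφ̃' - xθ̃' · φ̃)/(2l+1). No differential
equation enters, so the two spectral parameters may differ. -/
theorem tendsto_besselWronskian {l : ℝ} {θ φ θt φt : ℝ → ℂ} (hl : -(1 / 2) < l)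
    (hθ : ∀ x, 0 < x → θ x = ((x ^ (-l) / (2 * l + 1) : ℝ) : ℂ) * θt x)
    (hφ : ∀ x, 0 < x → φ x = ((x ^ (l + 1) : ℝ) : ℂ) * φt x)
    (hθd : ∀ x, 0 < x → DifferentiableAt ℝ θt x) (hφd : ∀ x, 0 < x → DifferentiableAt ℝ φt x)
    (hθ1 : Tendsto θt (𝓝[>] 0) (𝓝 1)) (hφ1 : Tendsto φt (𝓝[>] 0) (𝓝 1))
    (hθ0 : Tendsto (fun x : ℝ => (x : ℂ) * deriv θt x) (𝓝[>] 0) (𝓝 0))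
    (hφ0 : Tendsto (fun x : ℝ => (x : ℂ) * deriv φt x) (𝓝[>] 0) (𝓝 0)) :
    Tendsto (besselWronskian θ φ) (𝓝[>] 0) (𝓝 1) := by
  have hl0 : (0 : ℝ) < 2 * l + 1 := by linarith
  have hlc : ((2 * l + 1 : ℝ) : ℂ) ≠ 0 := by exact_mod_cast hl0.ne'
  have h := ((hθ1.mul hφ1).add (((hθ1.mul hφ0).sub (hθ0.mul hφ1)).div_const
    ((2 * l + 1 : ℝ) : ℂ)))
  simp only [mul_one, mul_zero, sub_zero, zero_div, add_zero] at h
  refine h.congr' ?_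
  filter_upwards [self_mem_nhdsWithin] with x hx
  have hx0 : (0 : ℝ) < x := hx
  have dθ : deriv θ x = ((-l * x ^ (-l - 1) : ℝ) : ℂ) * (((2 * l + 1 : ℝ) : ℂ)⁻¹ * θt x) +
      ((x ^ (-l) : ℝ) : ℂ) * (((2 * l + 1 : ℝ) : ℂ)⁻¹ * deriv θt x) := by
    refine HasDerivAt.deriv (HasDerivAt.congr_of_eventuallyEq ((hasDerivAt_ofReal_rpow (-l)
      hx0).mul ((hθd x hx0).hasDerivAt.const_mul ((2 * l + 1 : ℝ) : ℂ)⁻¹)) ?_)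
    filter_upwards [Ioi_mem_nhds hx0] with y hy
    rw [hθ y hy, Complex.ofReal_div]
    simp only [Pi.mul_apply]
    ring
  have dφ : deriv φ x = (((l + 1) * x ^ (l + 1 - 1) : ℝ) : ℂ) * φt x +
      ((x ^ (l + 1) : ℝ) : ℂ) * deriv φt x := by
    refine HasDerivAt.deriv (HasDerivAt.congr_of_eventuallyEq ((hasDerivAt_ofReal_rpow (l + 1)
      hx0).mul (hφd x hx0).hasDerivAt) ?_)
    filter_upwards [Ioi_mem_nhds hx0] with y hy using hφ y hy
  have hA' : ((x ^ l : ℝ) : ℂ) ≠ 0 := by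
    exact_mod_cast (Real.rpow_pos_of_pos hx0 l).ne'
  have hx' : (x : ℂ) ≠ 0 := by exact_mod_cast hx0.ne'
  rw [besselWronskian, dθ, dφ, hθ x hx0, hφ x hx0, add_sub_cancel_right,
    Real.rpow_sub_one hx0.ne', Real.rpow_neg hx0.le, Real.rpow_add_one hx0.ne']
  simp only [Complex.ofReal_mul, Complex.ofReal_div, Complex.ofReal_inv, Complex.ofReal_neg]
  field_simp
  push_cast
  ring

/-- The solutions have different orders at 0: after scaling, φ tends to 0 and θ to 1, which kills
the coefficient of θ; then U → 1 kills the other. This also covers l = -1/2. -/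
theorem linearIndependent_domRestrict_bessel {l : ℝ} {φ θ U : ℝ → ℂ} (hl : -(1 / 2) ≤ l)
    (hφ : ∀ x, 0 < x → φ x = ((x ^ (l + 1) : ℝ) : ℂ) * U x) (hU : Tendsto U (𝓝[>] 0) (𝓝 1))
    (hθ : Tendsto (fun x => (besselScale l x : ℂ) * θ x) (𝓝[>] 0) (𝓝 1)) :
    LinearIndependent ℂ ![(Ioi (0 : ℝ)).domRestrict φ, (Ioi (0 : ℝ)).domRestrict θ] := by
  rw [LinearIndependent.pair_iff]
  intro s t hst
  have h0 : ∀ x, 0 < x → s * φ x + t * θ x = 0 := fun x hx => congrFun hst ⟨x, hx⟩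
  have hb : Tendsto (fun x => ((besselScale l x * x ^ (l + 1) : ℝ) : ℂ)) (𝓝[>] 0) (𝓝 0) := by
    have := (Complex.continuous_ofReal.tendsto 0).comp (tendsto_besselScale_mul_rpow hl)
    rw [Complex.ofReal_zero] at this
    exact this
  have ht : t = 0 := by
    have h1 := ((hb.mul hU).const_mul s).add (hθ.const_mul t)
    rw [zero_mul, mul_zero, mul_one, zero_add] at h1
    refine tendsto_nhds_unique h1 (tendsto_const_nhds.congr' ?_)
    filter_upwards [self_mem_nhdsWithin] with x hx
    have := h0 x hx
    rw [hφ x hx] at this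
    push_cast
    linear_combination (-(besselScale l x : ℂ)) * this
  refine ⟨?_, ht⟩
  have h2 := hU.const_mul s
  rw [mul_one] at h2
  refine tendsto_nhds_unique h2 (tendsto_const_nhds.congr' ?_)
  filter_upwards [self_mem_nhdsWithin] with x hx
  have hx0 : (0 : ℝ) < x := hx
  have hA : ((x ^ (l + 1) : ℝ) : ℂ) ≠ 0 := by
    exact_mod_cast (Real.rpow_pos_of_pos hx0 _).ne'
  have := h0 x hx0
  rw [ht, zero_mul, add_zero, hφ x hx0, mul_left_comm] at this
  exact ((mul_eq_zero.1 this).resolve_left hA).symm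

/-! ### Assembly of the theorem -/

/-- The function from Hardy's inequality controlling the derivative of the regular solution. -/
theorem memLp_potential_hardy {l : ℝ} {q : ℝ → ℝ} {p : ℝ≥0∞}
    (hq : LocallyIntegrableOn q (Ioi (0 : ℝ)) volume) (hp : 1 ≤ p)
    (hlq :
      (-(1 / 2 : ℝ) < l ∧
        MemLp (fun x : ℝ => x * q x) p (volume.restrict (Ioo (0 : ℝ) 1))) ∨
      (l = -(1 / 2 : ℝ) ∧
        ((1 < p ∧ MemLp (fun x : ℝ => x * q x) p (volume.restrict (Ioo (0 : ℝ) 1))) ∨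
          (p = 1 ∧ MemLp (fun x : ℝ => (1 - Real.log x) * (x * q x)) 1
            (volume.restrict (Ioo (0 : ℝ) 1)))))) :
    IntegrableOn (fun y => y * q y) (Ioo 0 1) ∧
      MemLp (fun x => x ^ (-(2 * l + 2)) * ∫ y in (0 : ℝ)..x, y ^ (2 * l + 2 - 1) * |y * q y|) p
        (volume.restrict (Ioo (0 : ℝ) 1)) := by
  rcases hlq with ⟨hl, hm⟩ | ⟨hl, ⟨hp1, hm⟩ | ⟨hp1, hm⟩⟩
  · exact ⟨integrableOn_of_memLp hp hm,
      memLp_hardy_left (by linarith) hp (Or.inl (by linarith)) hm⟩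
  · exact ⟨integrableOn_of_memLp hp hm,
      memLp_hardy_left (by linarith) hp (Or.inr hp1) hm⟩
  · subst hl hp1
    have hqm : AEStronglyMeasurable q (volume.restrict (Ioo (0 : ℝ) 1)) :=
      (hq.aestronglyMeasurable).mono_set Ioo_subset_Ioi_self
    -- The weight 1 - log x is at least 1 on (0,1), so the weighted hypothesis contains the
    -- unweighted one.
    have hi : IntegrableOn (fun y => y * q y) (Ioo 0 1) := by
      refine Integrable.mono (memLp_one_iff_integrable.1 hm)
        (measurable_id.aestronglyMeasurable.mul hqm) ?_
      filter_upwards [ae_restrict_mem measurableSet_Ioo] with x hx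
      rw [norm_mul (1 - Real.log x)]
      refine le_mul_of_one_le_left (norm_nonneg _) ?_
      have := Real.log_neg hx.1 hx.2
      rw [Real.norm_of_nonneg (by linarith)]
      linarith
    refine ⟨hi, ?_⟩
    have := memLp_hardy_log hm hi
    norm_num at this ⊢
    exact this

theorem besselScale_mul_self {l x : ℝ} (hl : -(1 / 2) < l) (hx : 0 < x) :
    x ^ (-l) / (2 * l + 1) * besselScale l x = 1 := by
  have h0 : 2 * l + 1 ≠ 0 := by linarith
  have h1 := (Real.rpow_pos_of_pos hx l).ne'
  rw [besselScale, if_neg hl.ne', Real.rpow_neg hx.le]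
  field_simp

/-- Joint continuity of the normalized second solution. -/
theorem continuousOn_normalized {l : ℝ} {θ : ℂ → ℝ → ℂ} {S : Set ℝ}
    (hc : ContinuousOn (Function.uncurry θ) (univ ×ˢ Ioi (0 : ℝ)))
    (h0 : ∀ z, ContinuousWithinAt (fun w : ℂ × ℝ =>
      if w.2 = 0 then 1 else (besselScale l w.2 : ℂ) * θ w.1 w.2) (univ ×ˢ Ici (0 : ℝ)) (z, 0))
    (hS : S ⊆ Ici 0) (hb : ContinuousOn (besselScale l) (S ∩ Ioi 0)) :
    ContinuousOn (Function.uncurry fun z x => if x = 0 then 1 else (besselScale l x : ℂ) * θ z x)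
      (univ ×ˢ S) := by
  rintro ⟨z, x⟩ ⟨-, hx⟩
  rcases (show (0 : ℝ) ≤ x from hS hx).eq_or_lt with h | h
  · have h' : x = 0 := h.symm
    subst h'
    exact (h0 z).mono (prod_mono_right hS)
  · have hx0 : (0 : ℝ) < x := h
    have h1 : ContinuousWithinAt (fun w : ℂ × ℝ => (besselScale l w.2 : ℂ) * θ w.1 w.2)
        (univ ×ˢ (S ∩ Ioi 0)) (z, x) := by
      refine ContinuousWithinAt.mul ?_ ((hc (z, x) ⟨mem_univ _, h⟩).mono
        (prod_mono_right inter_subset_right))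
      exact (Complex.continuous_ofReal.comp_continuousOn (hb.comp continuousOn_snd
        fun w hw => hw.2)) (z, x) ⟨mem_univ _, hx, h⟩
    have hn : Prod.snd ⁻¹' Ioi (0 : ℝ) ∈ 𝓝 (z, x) :=
      continuous_snd.continuousAt.preimage_mem_nhds (Ioi_mem_nhds hx0)
    have e : (univ ×ˢ (S ∩ Ioi 0) : Set (ℂ × ℝ)) = univ ×ˢ S ∩ Prod.snd ⁻¹' Ioi (0 : ℝ) := by
      ext w
      simp
    rw [e, continuousWithinAt_inter hn] at h1
    refine h1.congr_of_eventuallyEq ?_ ?_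
    · filter_upwards [nhdsWithin_le_nhds hn] with w hw
      exact if_neg (ne_of_gt hw)
    · exact if_neg hx0.ne'

theorem lemma3p2 (l : ℝ) (q : ℝ → ℝ) (p : ℝ≥0∞)
    (hq : LocallyIntegrableOn q (Ioi (0 : ℝ)) volume)
    (hp : 1 ≤ p)
    (hlq :
      (-(1 / 2 : ℝ) < l ∧
        MemLp (fun x : ℝ => x * q x) p (volume.restrict (Ioo (0 : ℝ) 1))) ∨
      (l = -(1 / 2 : ℝ) ∧
        ((1 < p ∧ MemLp (fun x : ℝ => x * q x) p (volume.restrict (Ioo (0 : ℝ) 1))) ∨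
          (p = 1 ∧ MemLp (fun x : ℝ => (1 - Real.log x) * (x * q x)) 1
            (volume.restrict (Ioo (0 : ℝ) 1)))))) :
    ∃ φ θ φt θt : ℂ → ℝ → ℂ,
      -- two linearly independent solutions
      (∀ z : ℂ, IsBesselSolution l q z (φ z) ∧ IsBesselSolution l q z (θ z) ∧
        LinearIndependent ℂ ![(Ioi (0 : ℝ)).domRestrict (φ z), (Ioi (0 : ℝ)).domRestrict (θ z)]) ∧
      -- entire with respect to the spectral parameter
      (∀ x : ℝ, 0 < x →
        Differentiable ℂ (fun z : ℂ => φ z x) ∧ Differentiable ℂ (fun z : ℂ => θ z x)) ∧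
      -- normalization at the origin
      (∀ z : ℂ, φt z 0 = 1 ∧ θt z 0 = 1) ∧
      -- the first solution
      (∀ z : ℂ, ∀ x : ℝ, 0 < x → φ z x = ((x ^ (l + 1) : ℝ) : ℂ) * φt z x) ∧
      (∀ z : ℂ, MemSobolevOne p (φt z)) ∧
      ContinuousOn (Function.uncurry φt) (univ ×ˢ Icc (0 : ℝ) 1) ∧
      -- the second solution and the limits at the origin, nonlogarithmic case
      (-(1 / 2 : ℝ) < l →
        (∀ z : ℂ, ∀ x : ℝ, 0 < x →
          θ z x = ((x ^ (-l) / (2 * l + 1) : ℝ) : ℂ) * θt z x) ∧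
        (0 < l → ∀ z : ℂ, MemSobolevOne p (θt z)) ∧
        (l ≤ 0 → ∀ r : ℝ≥0∞, 1 ≤ r → r ≤ p → r < (ENNReal.ofReal (-(2 * l)))⁻¹ →
          ∀ z : ℂ, MemSobolevOne r (θt z)) ∧
        ContinuousOn (Function.uncurry θt) (univ ×ˢ Icc (0 : ℝ) 1) ∧
        (∀ z : ℂ, Tendsto (fun x : ℝ => (x : ℂ) * deriv (φt z) x) (𝓝[>] 0) (𝓝 0)) ∧
        (∀ z : ℂ, Tendsto (fun x : ℝ => (x : ℂ) * deriv (θt z) x) (𝓝[>] 0) (𝓝 0)) ∧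
        (∀ z ζ : ℂ, Tendsto (besselWronskian (θ z) (φ ζ)) (𝓝[>] 0) (𝓝 1))) ∧
      -- the second solution, logarithmic case; the logarithm vanishes at the point one
      (l = -(1 / 2 : ℝ) →
        (∀ z : ℂ, ∀ x : ℝ, 0 < x → x < 1 →
          θ z x = ((-Real.log x * x ^ (1 / 2 : ℝ) : ℝ) : ℂ) * θt z x) ∧
        ContinuousOn (Function.uncurry θt) (univ ×ˢ Ico (0 : ℝ) 1) ∧
        ContinuousOn (Function.uncurry θ) (univ ×ˢ Ioc (0 : ℝ) 1)) := by
  obtain ⟨hi, hD⟩ := memLp_potential_hardy hq hp hlq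
  have hl : -(1 / 2) ≤ l := by
    rcases hlq with h | h
    · exact h.1.le
    · exact h.1.ge
  have hκ : 1 ≤ 2 * l + 2 := by linarith
  have h₁ := VolterraAdmissible.potential hκ hq hi (integrableOn_of_memLp hp hD)
  obtain ⟨U, hUc, hUd, hUF⟩ := exists_regular_solution hl h₁
  obtain ⟨θ, hθs, hθd, hθc, hθ0⟩ := exists_singular_solution hl h₁
  set φ : ℂ → ℝ → ℂ := fun z x => ((x ^ (l + 1) : ℝ) : ℂ) * U z x with hφ
  -- The value at 0 is imposed by hand, since the scaled product need not equal 1 there; `hθ0` makes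
  -- this the continuous extension.
  set ψ : ℂ → ℝ → ℂ := fun z x => if x = 0 then 1 else (besselScale l x : ℂ) * θ z x with hψ
  have hU0 : ∀ z, U z 0 = 1 := fun z => by
    obtain ⟨F, -, -, hU⟩ := hUF z
    rw [hU 0 le_rfl]
    simp [volterraInt]
  have hUlim : ∀ z, Tendsto (U z) (𝓝[>] 0) (𝓝 1) := fun z => by
    have : ContinuousOn (U z) (Ici 0) :=
      hUc.comp (f := fun x => (z, x)) (by fun_prop) fun x hx => ⟨mem_univ _, hx⟩
    rw [← hU0 z]
    exact ((this 0 (mem_Ici.2 le_rfl)).mono Ioi_subset_Ici_self).tendsto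
  have hψpos : ∀ z x, 0 < x → ψ z x = (besselScale l x : ℂ) * θ z x :=
    fun z x hx => if_neg hx.ne'
  have hψ0 : ∀ z, ψ z 0 = 1 := fun z => if_pos rfl
  have hψlim : ∀ z, Tendsto (ψ z) (𝓝[>] 0) (𝓝 1) := fun z => by
    have h1 : ContinuousWithinAt (ψ z) (Ici 0) 0 :=
      (hθ0 z).comp (f := fun x : ℝ => (z, x)) (x := 0) (by fun_prop) fun x hx => ⟨mem_univ _, hx⟩
    rw [← hψ0 z]
    exact (h1.mono Ioi_subset_Ici_self).tendsto
  have hθlim : ∀ z, Tendsto (fun x => (besselScale l x : ℂ) * θ z x) (𝓝[>] 0) (𝓝 1) :=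
    fun z => (hψlim z).congr' (by
      filter_upwards [self_mem_nhdsWithin] with x hx using hψpos z x hx)
  have hreg : ∀ z, MemSobolevOne p (U z) ∧ (∀ x, 0 < x → DifferentiableAt ℝ (U z) x) ∧
      Tendsto (fun x : ℝ => (x : ℂ) * deriv (U z) x) (𝓝[>] 0) (𝓝 0) := fun z => by
    obtain ⟨F, hF, hf, hU⟩ := hUF z
    exact VolterraAdmissible.regular_regularity hκ hp hi hD hF hf hU
  refine ⟨φ, θ, U, ψ, fun z => ⟨?_, ?_, ?_⟩, fun x hx => ⟨?_, hθd x hx⟩,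
    fun z => ⟨hU0 z, hψ0 z⟩, fun _ _ _ => rfl, fun z => (hreg z).1,
    hUc.mono (prod_mono_right Icc_subset_Ici_self), fun hl' => ?_, fun hl' => ⟨?_, ?_, ?_⟩⟩
  · obtain ⟨F, hF, hf, hU⟩ := hUF z
    refine (hF.solvesBessel (l := l) (q := q) (z := z) (f := fun _ => 0) (c := 1) hU
      fun y hy => ?_).isBesselSolution fun _ _ => rfl
    rw [hf y hy]
    ring
  · obtain ⟨w, hw⟩ := hθs z
    exact hw.isBesselSolution fun _ _ => rfl
  · exact linearIndependent_domRestrict_bessel hl (fun _ _ => rfl) (hUlim z) (hθlim z)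
  · exact (hUd x hx.le).const_mul _
  · have hm : MemLp (fun x : ℝ => x * q x) p (volume.restrict (Ioo (0 : ℝ) 1)) := by
      rcases hlq with h | h
      · exact h.2
      · exact absurd h.1 hl'.ne'
    have hform : ∀ z x, 0 < x → θ z x = ((x ^ (-l) / (2 * l + 1) : ℝ) : ℂ) * ψ z x :=
      fun z x hx => by
        rw [hψpos z x hx, ← mul_assoc, ← Complex.ofReal_mul, besselScale_mul_self hl' hx,
          Complex.ofReal_one, one_mul]
    have hψc : ContinuousOn (Function.uncurry ψ) (univ ×ˢ Icc (0 : ℝ) 1) :=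
      continuousOn_normalized hθc hθ0 Icc_subset_Ici_self
        ((continuousOn_besselScale_Ioi hl').mono inter_subset_right)
    have hsing := fun z => (hθs z).choose_spec.singular_regularity (ψ := ψ z) hl' hq
      (fun x hx => by rw [hψpos z x hx, besselScale, if_neg hl'.ne'])
      (hψc.comp (f := fun x => (z, x)) (by fun_prop) fun x hx => ⟨mem_univ _, hx⟩) hi
    refine ⟨hform, fun h0 z => (hsing z).1 p hp (Or.inl h0) hm,
      fun h0 r hr hrp hr2 z => (hsing z).1 r hr (Or.inr ⟨h0, hr2⟩) (hm.mono_exponent hrp), hψc,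
      fun z => (hreg z).2.2, fun z => (hsing z).2.2, fun z ζ => ?_⟩
    exact tendsto_besselWronskian hl' (hform z) (fun _ _ => rfl) (hsing z).2.1 (hreg ζ).2.1
      (hψlim z) (hUlim ζ) (hsing z).2.2 (hreg ζ).2.2
  · intro z x hx hx1
    have h1 := (Real.rpow_pos_of_pos hx (1 / 2 : ℝ)).ne'
    have h2 := (Real.log_neg hx hx1).ne
    rw [hψpos z x hx, besselScale, if_pos hl', ← mul_assoc, ← Complex.ofReal_mul,
      mul_inv_cancel₀ (mul_ne_zero (neg_ne_zero.2 h2) h1), Complex.ofReal_one, one_mul]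
  -- For l = -1/2 the scale factor blows up as x → 1 from below, so the endpoint 1 is excluded for
  -- ψ, while θ itself is continuous there.
  · exact continuousOn_normalized hθc hθ0 Ico_subset_Ici_self
      ((continuousOn_besselScale_Ioo l).mono fun x hx => ⟨hx.2, hx.1.2⟩)
  · exact hθc.mono (prod_mono_right Ioc_subset_Ioi_self)
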